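/- Let $\Omega\subset\mathbb{R}^2$ be an open regular hexagon (arbitrary centre, orientation and side length $\ell>0$). For each integer $M\ge 1$ divide $\overline\Omega$ into $6M^2$ congruent equilateral triangles of side $h=\ell/M$ (the uniform mesh $\mathcal T_h$), let $n=n(h)=3M(M-1)+1$ be the number of internal nodes, and let $\varphi_1,\dots,\varphi_n$ be the nodal basis of the continuous functions on $\overline\Omega$ that are affine on every triangle and vanish on $\partial\Omega$. Let $a\in C^2(\overline\Omega)$ with $a\ge a_0>0$ on $\overline\Omega$, and let $$\big(A_n(a)\big)_{i,j}=\int_\Omega a\,\nabla\varphi_j\cdot\nabla\varphi_i,\qquad D_n(a)=\mathrm{diag}(A_n(a))\,\mathrm{diag}(A_n(1))^{-1},\qquad P_n(a)=D_n(a)^{1/2}A_n(1)D_n(a)^{1/2}.$$ Then, for every $M \ge 1$, $A_n(a)$ and $P_n(a)$ are symmetric positive definite, and the following hold. 1. (Proper clustering at $1$.) For every $\varepsilon>0$ there is a constant $N_\varepsilon$, independent of $n$, such that for every $M\ge 1$ at most $N_\varepsilon$ eigenvalues of $P_n(a)^{-1}A_n(a)$, counted with multiplicity, lie outside $\{z\in\mathbb{C}:|z-1|<\varepsilon\}$.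 2. (Spectral equivalence.) There are constants $0<d\le D$, independent of $n$, such that for every $M\ge 1$ all the eigenvalues of $P_n(a)^{-1}A_n(a)$ are real and lie in $[d,D]$. 3. (PCG optimality.) For every $\varepsilon>0$ there is a constant $K_\varepsilon$, independent of $n$, such that for every $M\ge 1$, every right-hand side $b$ and every initial guess $x_0$, the preconditioned conjugate gradient method for $A_n(a)u=b$ with preconditioner $P_n(a)$ produces, for some $k\le K_\varepsilon$, an iterate $x_k$ with $\|x_k-u\|_{A_n(a)}\le\varepsilon\,\|x_0-u\|_{A_n(a)}$, where $\|e\|_{A_n(a)}=(e^{T}A_n(a)e)^{1/2}$. The conclusions also hold if $A_n(a)$ is computed by quadrature. That is, replace the mean value of $a$ on each triangle $K\in\mathcal T_h$ by a number $q_{h,K}$ with $\big|q_{h,K}-\frac1{|K|}\int_K a\big|\le C h^2$, where $C$ does not depend on $h$ and $K$. The entries then become $\sum_{K}q_{h,K}\int_K\nabla\varphi_j\cdot\nabla\varphi_i$, and $D_n$ and $P_n$ are formed from them as above. Provided that the resulting matrices in place of $A_n(a)$ are positive definite for every $M\ge1$, so are the corresponding $P_n$, and items 1, 2 and 3 hold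 for these matrices. -/

import Mathlib

open MeasureTheory Matrix

noncomputable section

/-- The plane `ℝ²` with its Euclidean structure and Lebesgue measure. -/
abbrev Plane : Type := EuclideanSpace ℝ (Fin 2)

/-- The unit vector of angle `t`. -/
def dir (t : ℝ) : Plane := !₂[Real.cos t, Real.sin t]

/-! ### The regular hexagon and its uniform mesh of equilateral triangles -/

/-- The norm on the plane whose unit ball is the regular hexagon with the six vertices
`dir (θ + k * π / 3)`: the hexagon is the intersection of the three strips with unit normals
`dir (θ + π / 6)`, `dir (θ + π / 2)`, `dir (θ + 5 * π / 6)` and half-width `√3 / 2`. -/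
def hexNorm (θ : ℝ) (v : Plane) : ℝ :=
  2 / √3 * max (|inner ℝ v (dir (θ + Real.pi / 6))|)
    (max (|inner ℝ v (dir (θ + Real.pi / 2))|) (|inner ℝ v (dir (θ + 5 * Real.pi / 6))|))

/-- The open regular hexagon `Ω` with centre `c`, side length `ℓ` and vertices
`c + ℓ • dir (θ + k * π / 3)`. -/
def hexagon (c : Plane) (ℓ θ : ℝ) : Set Plane := {p | hexNorm θ (p - c) < ℓ}

/-- The closed regular hexagon, that is, the closure of `Ω`. -/
def closedHexagon (c : Plane) (ℓ θ : ℝ) : Set Plane := {p | hexNorm θ (p - c) ≤ ℓ}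

/-- The mesh size `h` (the common diameter of all the triangles) when every side of the hexagon is
divided into `M` equal parts. -/
def meshSize (ℓ : ℝ) (M : ℕ) : ℝ := ℓ / M

/-- The point of the triangular lattice with mesh size `ℓ / M` and integer coordinates `s`. -/
def node (c : Plane) (ℓ θ : ℝ) (M : ℕ) (s : ℤ × ℤ) : Plane :=
  c + meshSize ℓ M • ((s.1 : ℝ) • dir θ + (s.2 : ℝ) • dir (θ + Real.pi / 3))

/-- The lattice coordinates of the nodes of the mesh (those lying in the closed hexagon). -/
def meshNodes (M : ℕ) : Finset (ℤ × ℤ) :=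
  (Finset.Icc (-(M : ℤ)) M ×ˢ Finset.Icc (-(M : ℤ)) M).filter fun s => |s.1 + s.2| ≤ (M : ℤ)

/-- The lattice coordinates of the internal nodes of the mesh (those lying in `Ω`). -/
def innerNodes (M : ℕ) : Finset (ℤ × ℤ) :=
  (meshNodes M).filter fun s => |s.1| < (M : ℤ) ∧ |s.2| < (M : ℤ) ∧ |s.1 + s.2| < (M : ℤ)

/-- The lattice coordinates of the three vertices of a lattice triangle. A triangle is coded by
`(s, false)` or `(s, true)`; the two triangles with the same `s` form a rhombus. -/
def triVertices (T : (ℤ × ℤ) × Bool) : Finset (ℤ × ℤ) :=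
  {if T.2 then T.1 + (1, 1) else T.1, T.1 + (1, 0), T.1 + (0, 1)}

/-- The triangles of the mesh: all lattice triangles whose vertices lie in the closed hexagon. -/
def meshTriangles (M : ℕ) : Finset ((ℤ × ℤ) × Bool) :=
  ((Finset.Icc (-(M : ℤ)) M ×ˢ Finset.Icc (-(M : ℤ)) M) ×ˢ (Finset.univ : Finset Bool)).filter
    fun T => triVertices T ⊆ meshNodes M

/-- The closed triangle of the plane coded by `T`. -/
def tri (c : Plane) (ℓ θ : ℝ) (M : ℕ) (T : (ℤ × ℤ) × Bool) : Set Plane :=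
  convexHull ℝ (node c ℓ θ M '' (triVertices T : Set (ℤ × ℤ)))

/-! ### Linear finite elements -/

/-- The nodal basis function (hat function) of the node `s`: the continuous function that is affine
on every triangle, equal to `1` at the node `s` and to `0` at all the other nodes. -/
def hat (c : Plane) (ℓ θ : ℝ) (M : ℕ) (s : ℤ × ℤ) (p : Plane) : ℝ :=
  max 0 (1 - hexNorm θ (p - node c ℓ θ M s) / meshSize ℓ M)

/-- The diffusion (stiffness) matrix `A_n(a)`, with entries `∫_Ω a ∇φ_j ⬝ ∇φ_i`, indexed by the
internal nodes. -/
def stiffness (c : Plane) (ℓ θ : ℝ) (a : Plane → ℝ) (M : ℕ) :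
    Matrix (innerNodes M) (innerNodes M) ℝ :=
  Matrix.of fun i j =>
    ∫ x in hexagon c ℓ θ, a x * inner ℝ (gradient (hat c ℓ θ M j) x) (gradient (hat c ℓ θ M i) x)

/-- The diffusion matrix obtained by quadrature: on every triangle `K` of the mesh, where the
gradients are constant, the mean value of the coefficient is replaced by a number `q K`. -/
def quadStiffness (c : Plane) (ℓ θ : ℝ) (M : ℕ) (q : (ℤ × ℤ) × Bool → ℝ) :
    Matrix (innerNodes M) (innerNodes M) ℝ :=
  Matrix.of fun i j => ∑ K ∈ meshTriangles M,
    q K * ∫ x in tri c ℓ θ M K,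
      inner ℝ (gradient (hat c ℓ θ M j) x) (gradient (hat c ℓ θ M i) x)

/-- The values `q M K` come from a quadrature formula with error `O(h²)` for the mean values of `a`
on the mesh triangles. -/
def IsQuadratureOrderTwo (c : Plane) (ℓ θ : ℝ) (a : Plane → ℝ)
    (q : ℕ → (ℤ × ℤ) × Bool → ℝ) : Prop :=
  ∃ C : ℝ, ∀ M : ℕ, 1 ≤ M → ∀ K ∈ meshTriangles M,
    |q M K - ⨍ x in tri c ℓ θ M K, a x| ≤ C * meshSize ℓ M ^ 2

/-! ### The preconditioner and the spectral notions -/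

/-- `D^{1/2} A₁ D^{1/2}` with `D = diag(A) diag(A₁)⁻¹`. -/
def precond {ι : Type} [Fintype ι] [DecidableEq ι] (A A₁ : Matrix ι ι ℝ) : Matrix ι ι ℝ :=
  let Dhalf : Matrix ι ι ℝ := Matrix.diagonal fun i => √(A i i / A₁ i i)
  Dhalf * A₁ * Dhalf

/-- The complex eigenvalues of a real matrix, counted with algebraic multiplicity. -/
def eigs {ι : Type} [Fintype ι] [DecidableEq ι] (B : Matrix ι ι ℝ) : Multiset ℂ :=
  (B.map Complex.ofReal).charpoly.roots

open Classical in
/-- The matrix sequence `B 1, B 2, …` is properly (strongly) clustered at `z₀`: for every `ε > 0`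
the number of eigenvalues outside the open disk of radius `ε` and centre `z₀` is bounded by a
constant that does not depend on the matrix. -/
def ProperlyClusteredAt {ι : ℕ → Type} [∀ M, Fintype (ι M)] [∀ M, DecidableEq (ι M)]
    (B : ∀ M, Matrix (ι M) (ι M) ℝ) (z₀ : ℂ) : Prop :=
  ∀ ε : ℝ, 0 < ε → ∃ N : ℕ, ∀ M : ℕ, 1 ≤ M →
    (eigs (B M)).countP (fun z => z ∉ Metric.ball z₀ ε) ≤ N

/-- All the eigenvalues of `B 1, B 2, …` lie in one interval `[d, D]` with `d > 0`. -/
def EigsInPositiveInterval {ι : ℕ → Type} [∀ M, Fintype (ι M)] [∀ M, DecidableEq (ι M)]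
    (B : ∀ M, Matrix (ι M) (ι M) ℝ) : Prop :=
  ∃ d D : ℝ, 0 < d ∧ ∀ M : ℕ, 1 ≤ M → ∀ z ∈ eigs (B M), ∃ t ∈ Set.Icc d D, z = (t : ℂ)

/-! ### The preconditioned conjugate gradient method -/

/-- The vectors that the method updates: iterate, residual, preconditioned residual, direction. -/
structure PCGState (ι : Type) where
  x : ι → ℝ
  r : ι → ℝ
  z : ι → ℝ
  p : ι → ℝ

/-- The initial state for the system `A x = b`, the preconditioner `P` and the guess `x₀`. -/
def pcgInit {ι : Type} [Fintype ι] [DecidableEq ι] (A P : Matrix ι ι ℝ) (b x₀ : ι → ℝ) :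
    PCGState ι :=
  let r := b - A *ᵥ x₀
  let z := P⁻¹ *ᵥ r
  ⟨x₀, r, z, z⟩

/-- One iteration. After the exact solution is reached (`r = 0`, `p = 0`), the state no longer
changes, since `0 / 0 = 0`. -/
def pcgStep {ι : Type} [Fintype ι] [DecidableEq ι] (A P : Matrix ι ι ℝ) (S : PCGState ι) :
    PCGState ι :=
  let α := (S.r ⬝ᵥ S.z) / (S.p ⬝ᵥ (A *ᵥ S.p))
  let x := S.x + α • S.p
  let r := S.r - α • (A *ᵥ S.p)
  let z := P⁻¹ *ᵥ r
  let β := (r ⬝ᵥ z) / (S.r ⬝ᵥ S.z)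
  ⟨x, r, z, z + β • S.p⟩

/-- The `k`-th iterate of the preconditioned conjugate gradient method. -/
def pcgIterate {ι : Type} [Fintype ι] [DecidableEq ι] (A P : Matrix ι ι ℝ) (b x₀ : ι → ℝ)
    (k : ℕ) : ι → ℝ :=
  ((pcgStep A P)^[k] (pcgInit A P b x₀)).x

/-- The energy norm `√(eᵀ A e)`. -/
def energyNorm {ι : Type} [Fintype ι] (A : Matrix ι ι ℝ) (e : ι → ℝ) : ℝ := √(e ⬝ᵥ (A *ᵥ e))

/-- The number of iterations that the method needs to reduce the energy norm of the error by a
prescribed factor `ε` is bounded by a constant independent of the matrix of the sequence, of the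
right-hand side and of the initial guess. -/
def PCGOptimal {ι : ℕ → Type} [∀ M, Fintype (ι M)] [∀ M, DecidableEq (ι M)]
    (A P : ∀ M, Matrix (ι M) (ι M) ℝ) : Prop :=
  ∀ ε : ℝ, 0 < ε → ∃ N : ℕ, ∀ M : ℕ, 1 ≤ M → ∀ b x₀ u : ι M → ℝ, A M *ᵥ u = b →
    ∃ k ≤ N, energyNorm (A M) (pcgIterate (A M) (P M) b x₀ k - u)
      ≤ ε * energyNorm (A M) (x₀ - u)

end

/-!
Clustering of the preconditioned stiffness matrices and optimality of the preconditioned conjugate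
gradient method.

On a mesh triangle the gradients of the hat functions are constant, and the local stiffness matrix
of an equilateral triangle does not depend on its size: its entries are proportional to `2` on the
diagonal and `-1` off it. So a stiffness matrix is a fixed positive multiple of a `meshMatrix`,
assembled from these local matrices with weights `q K`, the mean values of `a` on the triangles or
their quadrature approximations (`stiffness_eq`, `quadStiffness_eq`). Exact integration is thus a
quadrature with error zero. The preconditioner is invariant under the common factor. Let `A` be the
mesh matrix with weights `q`, let `A₁` be the one with weights `1`, and let `P` be formed from them.

*The difference `A - P` is `O(h²)`.* The two matrices have the same diagonal. For two neighbours `i`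
and `j`, the entry of `A` is `-(q K + q K')`, where `K` and `K'` are the triangles on their common
edge, and that of `P` is `-2 √(d i) √(d j)`, where `d i` is the average of the weights around `i`. As
`K` and `K'` are exchanged by the reflection about the midpoint of the edge, the second difference
estimate for a `C²` function gives `q K + q K' = a i + a j + O(h²)`
(`abs_setAverage_pair_sub_le`). The triangles around a node form three pairs that are opposite in the
same sense, whence `d i = a i + O(h²)`. Finally `2 √x √y` and `x + y` differ by `(√x - √y) ^ 2`,
which is `O(h²)` as `d i - d j = O(h)`. This is `abs_meshMatrix_sub_precond_le`.

*Lower bounds for `A` and `P`.* By a discrete Poincaré inequality the form of `A₁` is at least a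
multiple of `h² |y|²` (`poincare_meshMatrix_one`), and the same holds for `A` and `P` once the weights
are bounded below. Hence each of the two forms is bounded by a constant times the other, uniformly
for all fine meshes (`formEquiv_meshMatrix`); for the finitely many coarse ones positive definiteness
is enough (`exists_uniform_formEquiv`). This is the spectral equivalence.

*Clustering.* If the sums of `y` over `(3 R)²` blocks of the lattice vanish, the Poincaré inequality
on each block improves the lower bound for the form of `A₁` by a factor of order `R²`
(`poincare_meshMatrix_one_of_blockSums`). So for given `ε` there is an `R`, independent of the mesh,
such that `|A - P| < ε P` on a space of codimension at most `(3 R)²`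
(`abs_form_sub_precond_lt`), and a dimension count leaves at most `2 (3 R)²` eigenvalues of `P⁻¹ A`
at distance at least `ε` from `1` (`countP_eigs_le`).

*Conjugate gradients.* If each form is at most `C` times the other, then one step of the method
reduces the square of the energy norm of the error at least by the factor `1 - C⁻²`, by comparison
with a step of steepest descent (`pcgStep_spec`). The number of steps needed depends only on `C`
and `ε`.
-/

noncomputable section

/-! ### Pencils of symmetric matrices -/

/-- Dimension count behind the variational characterization of eigenvalues. -/
lemma card_le_card_of_ker_trivial {ι κ : Type} [Fintype κ] (s : Finset ι) (L : (ι → ℝ) →ₗ[ℝ] (κ → ℝ))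
    (h : ∀ c : ι → ℝ, (∀ i ∉ s, c i = 0) → L c = 0 → c = 0) : s.card ≤ Fintype.card κ := by
  let E : (s → ℝ) →ₗ[ℝ] (ι → ℝ) := Function.ExtendByZero.linearMap ℝ (Subtype.val : s → ι)
  have hE : ∀ (c : s → ℝ) (i : s), E c i = c i := fun c i => by
    exact Subtype.val_injective.extend_apply c 0 i
  have hinj : Function.Injective (L ∘ₗ E) := by
    rw [injective_iff_map_eq_zero]
    intro c hc
    have h0 := h (E c) (fun i hi => by
      change Function.extend Subtype.val c 0 i = 0
      rw [Function.extend_apply']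
      · rfl
      · rintro ⟨a, rfl⟩; exact hi a.2) hc
    ext i
    rw [← hE c i, h0]; rfl
  simpa using LinearMap.finrank_le_finrank_of_injective hinj

section Pencil

variable {ι κ : Type} [Fintype ι] [Fintype κ]

lemma Matrix.IsHermitian.dotProduct_mulVec_comm {A : Matrix ι ι ℝ} (hA : A.IsHermitian)
    (x y : ι → ℝ) : x ⬝ᵥ (A *ᵥ y) = y ⬝ᵥ (A *ᵥ x) := by
  have h : Aᵀ = A := by simpa [Matrix.IsHermitian, conjTranspose_eq_transpose_of_trivial] using hA
  rw [dotProduct_mulVec, ← mulVec_transpose, h, dotProduct_comm]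

lemma dotProduct_congruence_mulVec (Y A : Matrix ι ι ℝ) (c : ι → ℝ) :
    (Y *ᵥ c) ⬝ᵥ (A *ᵥ (Y *ᵥ c)) = c ⬝ᵥ ((Yᵀ * A * Y) *ᵥ c) := by
  rw [← mulVec_mulVec, ← mulVec_mulVec, dotProduct_mulVec c, vecMul_transpose]

lemma Matrix.PosDef.dotProduct_pos {A : Matrix ι ι ℝ} (hA : A.PosDef) {y : ι → ℝ} (hy : y ≠ 0) :
    0 < y ⬝ᵥ (A *ᵥ y) := by simpa using hA.dotProduct_mulVec_pos hy

lemma Matrix.PosDef.dotProduct_nonneg {A : Matrix ι ι ℝ} (hA : A.PosDef) (y : ι → ℝ) :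
    0 ≤ y ⬝ᵥ (A *ᵥ y) := by simpa using hA.posSemidef.dotProduct_mulVec_nonneg y

/-- The form inequalities `P ≤ C A` and `A ≤ C P`. -/
def FormEquiv (A P : Matrix ι ι ℝ) (C : ℝ) : Prop :=
  ∀ y : ι → ℝ, y ⬝ᵥ (P *ᵥ y) ≤ C * (y ⬝ᵥ (A *ᵥ y)) ∧ y ⬝ᵥ (A *ᵥ y) ≤ C * (y ⬝ᵥ (P *ᵥ y))

lemma FormEquiv.mono {A P : Matrix ι ι ℝ} {C C' : ℝ} (h : FormEquiv A P C) (hA : A.PosDef)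
    (hP : P.PosDef) (hC : C ≤ C') : FormEquiv A P C' := fun y =>
  ⟨(h y).1.trans (mul_le_mul_of_nonneg_right hC (hA.dotProduct_nonneg y)),
    (h y).2.trans (mul_le_mul_of_nonneg_right hC (hP.dotProduct_nonneg y))⟩

variable [DecidableEq ι]

/-- Simultaneous diagonalization of a symmetric matrix `A` and a positive definite matrix `P`: the
columns of `Y` are `P`-orthonormal and `A`-orthogonal. -/
theorem exists_simultaneous_diagonalization {A P : Matrix ι ι ℝ} (hA : A.IsHermitian)
    (hP : P.PosDef) :
    ∃ (lam : ι → ℝ) (Y : Matrix ι ι ℝ), Yᵀ * P * Y = 1 ∧ Yᵀ * A * Y = diagonal lam ∧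
      eigs (P⁻¹ * A) = Finset.univ.val.map (fun i => (lam i : ℂ)) := by
  -- With `P = Bᵀ B`, the matrix `H = B⁻ᵀ A B⁻¹` is symmetric; `Y = B⁻¹ U` for an orthogonal `U`
  -- which diagonalizes `H`.
  open scoped MatrixOrder in
  obtain ⟨B, hB⟩ := CStarAlgebra.nonneg_iff_eq_star_mul_self.mp hP.posSemidef.nonneg
  have hB' : P = Bᵀ * B := by
    rw [hB, star_eq_conjTranspose, conjTranspose_eq_transpose_of_trivial]
  have hdet : IsUnit B.det := by
    have := hP.det_pos
    rw [hB', det_mul, det_transpose] at this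
    exact isUnit_iff_ne_zero.mpr fun h => by simp [h] at this
  have hBB : B * B⁻¹ = 1 := mul_nonsing_inv _ hdet
  set H : Matrix ι ι ℝ := B⁻¹ᵀ * A * B⁻¹ with hH
  have hHh : H.IsHermitian := by
    have := isHermitian_conjTranspose_mul_mul B⁻¹ hA
    rwa [conjTranspose_eq_transpose_of_trivial] at this
  set U : Matrix ι ι ℝ := (hHh.eigenvectorUnitary : Matrix ι ι ℝ)
  have hU : Uᵀ * U = 1 := by
    have := Unitary.coe_star_mul_self hHh.eigenvectorUnitary
    simpa [star_eq_conjTranspose, conjTranspose_eq_transpose_of_trivial] using this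
  have hHU : Uᵀ * H * U = diagonal hHh.eigenvalues := by
    have := hHh.conjStarAlgAut_star_eigenvectorUnitary
    rw [Unitary.conjStarAlgAut_star_apply] at this
    simpa [star_eq_conjTranspose, conjTranspose_eq_transpose_of_trivial, Function.comp_def]
      using this
  have hYP : (B⁻¹ * U)ᵀ * P * (B⁻¹ * U) = 1 := by
    have h2 : (B⁻¹ * U)ᵀ * P * (B⁻¹ * U) = Uᵀ * (B * B⁻¹)ᵀ * (B * B⁻¹) * U := by
      simp only [hB', transpose_mul, Matrix.mul_assoc]
    rw [h2, hBB, transpose_one, Matrix.mul_one, Matrix.mul_one, hU]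
  have hYA : (B⁻¹ * U)ᵀ * A * (B⁻¹ * U) = diagonal hHh.eigenvalues := by
    rw [← hHU, hH, transpose_mul]
    simp only [Matrix.mul_assoc]
  refine ⟨hHh.eigenvalues, B⁻¹ * U, hYP, hYA, ?_⟩
  set Y := B⁻¹ * U
  have hinv : P⁻¹ = Y * Yᵀ := by
    apply inv_eq_right_inv
    have h3 : (P * Y) * Yᵀ = 1 := mul_eq_one_comm.mp (by rw [← Matrix.mul_assoc]; exact hYP)
    rw [← Matrix.mul_assoc]; exact h3
  have hchar : (P⁻¹ * A).charpoly = (diagonal hHh.eigenvalues).charpoly := by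
    rw [hinv, Matrix.mul_assoc, charpoly_mul_comm, hYA]
  have hmap : ((P⁻¹ * A).map Complex.ofReal).charpoly =
      (P⁻¹ * A).charpoly.map Complex.ofRealHom := (charpoly_map (P⁻¹ * A) Complex.ofRealHom)
  rw [eigs, hmap, hchar, charpoly_diagonal, Polynomial.map_prod]
  simp only [Polynomial.map_sub, Polynomial.map_X, Polynomial.map_C]
  rw [Polynomial.roots_prod _ _
    (Finset.prod_ne_zero_iff.mpr fun i _ => Polynomial.X_sub_C_ne_zero _)]
  simp

lemma exists_form_le {A P : Matrix ι ι ℝ} (hA : A.IsHermitian) (hP : P.PosDef) :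
    ∃ C : ℝ, 0 ≤ C ∧ ∀ y : ι → ℝ, y ⬝ᵥ (A *ᵥ y) ≤ C * (y ⬝ᵥ (P *ᵥ y)) := by
  obtain ⟨lam, Y, hYP, hYA, -⟩ := exists_simultaneous_diagonalization hA hP
  refine ⟨∑ i, |lam i|, Finset.sum_nonneg fun i _ => abs_nonneg _, fun y => ?_⟩
  have hY : Y * (Yᵀ * P) = 1 := mul_eq_one_comm.mp hYP
  obtain ⟨c, rfl⟩ : ∃ c, y = Y *ᵥ c := ⟨(Yᵀ * P) *ᵥ y, by rw [mulVec_mulVec, hY, one_mulVec]⟩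
  rw [dotProduct_congruence_mulVec, dotProduct_congruence_mulVec, hYP, hYA, one_mulVec]
  simp only [dotProduct, mulVec_diagonal, Finset.mul_sum]
  refine Finset.sum_le_sum fun i _ => ?_
  have h1 : lam i ≤ ∑ i, |lam i| :=
    (le_abs_self _).trans (Finset.single_le_sum (f := fun i => |lam i|)
      (fun i _ => abs_nonneg _) (Finset.mem_univ i))
  nlinarith [mul_le_mul_of_nonneg_right h1 (mul_self_nonneg (c i))]

lemma exists_formEquiv {A P : Matrix ι ι ℝ} (hA : A.PosDef) (hP : P.PosDef) :
    ∃ C : ℝ, FormEquiv A P C := by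
  obtain ⟨C, -, h⟩ := exists_form_le hA.isHermitian hP
  obtain ⟨C', -, h'⟩ := exists_form_le hP.isHermitian hA
  exact ⟨max C C', fun y =>
    ⟨(h' y).trans (mul_le_mul_of_nonneg_right (le_max_right _ _) (hA.dotProduct_nonneg y)),
    (h y).trans (mul_le_mul_of_nonneg_right (le_max_left _ _) (hP.dotProduct_nonneg y))⟩⟩

lemma FormEquiv.eigs_mem_Icc {A P : Matrix ι ι ℝ} {C : ℝ} (h : FormEquiv A P C) (hC : 0 < C)
    (hA : A.IsHermitian) (hP : P.PosDef) {z : ℂ} (hz : z ∈ eigs (P⁻¹ * A)) :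
    ∃ t ∈ Set.Icc C⁻¹ C, z = (t : ℂ) := by
  obtain ⟨lam, Y, hYP, hYA, he⟩ := exists_simultaneous_diagonalization hA hP
  rw [he, Multiset.mem_map] at hz
  obtain ⟨i, -, rfl⟩ := hz
  refine ⟨lam i, ?_, rfl⟩
  have := h (Y *ᵥ Pi.single i 1)
  rw [dotProduct_congruence_mulVec, dotProduct_congruence_mulVec, hYP, hYA, one_mulVec] at this
  simp only [mulVec_single_one, single_dotProduct, Pi.single_eq_same, col_apply,
    diagonal_apply_eq, one_mul, mul_one] at this
  exact ⟨by rw [inv_le_iff_one_le_mul₀' hC]; exact this.1, this.2⟩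

open Classical in
/-- If `|A - P| < ε P` on the common kernel of `card κ` linear functionals, then at most
`2 * card κ` eigenvalues of `P⁻¹ A` have distance at least `ε` from `1`. -/
theorem countP_eigs_le {A P : Matrix ι ι ℝ} (hA : A.IsHermitian) (hP : P.PosDef) {ε : ℝ}
    (L : (ι → ℝ) →ₗ[ℝ] (κ → ℝ))
    (h : ∀ y : ι → ℝ, L y = 0 → y ≠ 0 →
      |y ⬝ᵥ (A *ᵥ y) - y ⬝ᵥ (P *ᵥ y)| < ε * (y ⬝ᵥ (P *ᵥ y))) :
    (eigs (P⁻¹ * A)).countP (fun z => z ∉ Metric.ball (1 : ℂ) ε) ≤ 2 * Fintype.card κ := by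
  obtain ⟨lam, Y, hYP, hYA, he⟩ := exists_simultaneous_diagonalization hA hP
  have key : ∀ c : ι → ℝ, L (Y *ᵥ c) = 0 → c ≠ 0 →
      |∑ i, (lam i - 1) * c i ^ 2| < ε * ∑ i, c i ^ 2 := by
    intro c hc hc0
    have := h (Y *ᵥ c) hc (fun h0 => hc0 (by
      have h1 := congrArg (fun v => (Yᵀ * P) *ᵥ v) h0
      simpa [mulVec_mulVec, hYP] using h1))
    rw [dotProduct_congruence_mulVec, dotProduct_congruence_mulVec, hYP, hYA, one_mulVec] at this
    simp only [dotProduct, mulVec_diagonal, ← Finset.sum_sub_distrib] at this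
    convert this using 3 <;> ring
  have bound : ∀ s : Finset ι, ((∀ i ∈ s, ε ≤ lam i - 1) ∨ (∀ i ∈ s, ε ≤ 1 - lam i)) →
      s.card ≤ Fintype.card κ := by
    intro s hs
    refine card_le_card_of_ker_trivial s (L ∘ₗ Y.mulVecLin) fun c hc hL => ?_
    by_contra hc0
    have h1 := abs_lt.mp (key c hL hc0)
    rcases hs with hs | hs
    · have : ε * ∑ i, c i ^ 2 ≤ ∑ i, (lam i - 1) * c i ^ 2 := by
        rw [Finset.mul_sum]
        refine Finset.sum_le_sum fun i _ => ?_
        by_cases hi : i ∈ s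
        · exact mul_le_mul_of_nonneg_right (hs i hi) (sq_nonneg _)
        · simp [hc i hi]
      linarith [h1.2]
    · have : ∑ i, (lam i - 1) * c i ^ 2 ≤ - (ε * ∑ i, c i ^ 2) := by
        rw [Finset.mul_sum, ← Finset.sum_neg_distrib]
        refine Finset.sum_le_sum fun i _ => ?_
        by_cases hi : i ∈ s
        · nlinarith [mul_le_mul_of_nonneg_right (hs i hi) (sq_nonneg (c i))]
        · simp [hc i hi]
      linarith [h1.1]
  -- An outlier has `1 + ε ≤ lam i` or `lam i ≤ 1 - ε`; each of the two sets has at most `card κ`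
  -- elements.
  rw [he, Multiset.countP_map]
  have hsub : (Finset.univ.filter fun i : ι => (lam i : ℂ) ∉ Metric.ball (1 : ℂ) ε) ⊆
      (Finset.univ.filter fun i => ε ≤ lam i - 1) ∪ (Finset.univ.filter fun i => ε ≤ 1 - lam i) := by
    intro i hi
    simp only [Finset.mem_filter, Finset.mem_univ, true_and, Metric.mem_ball, not_lt,
      Finset.mem_union] at hi ⊢
    rw [Complex.dist_eq, ← Complex.ofReal_one, ← Complex.ofReal_sub, Complex.norm_real,
      Real.norm_eq_abs, le_abs] at hi
    rcases hi with hi | hi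
    · exact Or.inl hi
    · exact Or.inr (by linarith)
  calc _ = (Finset.univ.filter fun i : ι => (lam i : ℂ) ∉ Metric.ball (1 : ℂ) ε).card := rfl
    _ ≤ _ := Finset.card_le_card hsub
    _ ≤ _ := Finset.card_union_le _ _
    _ ≤ Fintype.card κ + Fintype.card κ := by
        gcongr
        · exact bound _ (Or.inl fun i hi => (Finset.mem_filter.mp hi).2)
        · exact bound _ (Or.inr fun i hi => (Finset.mem_filter.mp hi).2)
    _ = _ := by ring

lemma countP_eigs_le_card (B : Matrix ι ι ℝ) (p : ℂ → Prop) [DecidablePred p] :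
    (eigs B).countP p ≤ Fintype.card ι := by
  refine (Multiset.countP_le_card _ _).trans ((Polynomial.card_roots' _).trans ?_)
  rw [charpoly_natDegree_eq_dim]

end Pencil

/-! ### Convergence of the preconditioned conjugate gradient method -/

section PCG

variable {ι : Type} [Fintype ι] [DecidableEq ι]

/-- The invariant of the method for a system with solution `u`. The vector `p - z` is a multiple of
the previous direction: it is orthogonal to the residual and `A`-orthogonal to the direction `p`. -/
structure PCGInvariant (A P : Matrix ι ι ℝ) (u : ι → ℝ) (S : PCGState ι) : Prop where
  residual : S.r = A *ᵥ (u - S.x)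
  precond : S.z = P⁻¹ *ᵥ S.r
  orth : S.r ⬝ᵥ (S.p - S.z) = 0
  conj : (S.p - S.z) ⬝ᵥ (A *ᵥ S.p) = 0

lemma pcgInvariant_init {A P : Matrix ι ι ℝ} {b x₀ u : ι → ℝ} (hu : A *ᵥ u = b) :
    PCGInvariant A P u (pcgInit A P b x₀) :=
  ⟨by simp [pcgInit, mulVec_sub, hu], rfl, by simp [pcgInit], by simp [pcgInit]⟩

/-- One iteration keeps the invariant and contracts the square of the energy norm of the error at
least as much as a step of steepest descent does. -/
lemma pcgStep_spec {A P : Matrix ι ι ℝ} (hA : A.PosDef) (hP : P.PosDef) {C : ℝ} (hC : 0 < C)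
    (hAP : FormEquiv A P C) {u : ι → ℝ} {S : PCGState ι} (hS : PCGInvariant A P u S) :
    PCGInvariant A P u (pcgStep A P S) ∧
      (u - (pcgStep A P S).x) ⬝ᵥ (A *ᵥ (u - (pcgStep A P S).x)) ≤
        (1 - (C ^ 2)⁻¹) * ((u - S.x) ⬝ᵥ (A *ᵥ (u - S.x))) := by
  obtain ⟨hr, hz, ho, hc⟩ := hS
  rcases S with ⟨x, r, z, p⟩
  simp only at hr hz ho hc
  have hPr : P *ᵥ z = r := by
    rw [hz, mulVec_mulVec, mul_nonsing_inv _ (isUnit_iff_ne_zero.mpr hP.det_pos.ne'), one_mulVec]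
  -- Once the residual is zero, the step divides by zero and leaves the iterate, already exact,
  -- unchanged.
  by_cases hr0 : r = 0
  · have hz0 : z = 0 := by rw [hz, hr0, mulVec_zero]
    have he : u - x = 0 := by
      by_contra hne
      have := hA.dotProduct_pos hne
      rw [← hr, hr0, dotProduct_zero] at this
      exact lt_irrefl _ this
    subst hr0 hz0
    constructor
    · constructor <;> simp [pcgStep, he]
    · simp [pcgStep, he]
  have hz0 : z ≠ 0 := fun h => hr0 (by rw [← hPr, h, mulVec_zero])
  set ρ := r ⬝ᵥ z with hρ
  have hρP : ρ = z ⬝ᵥ (P *ᵥ z) := by rw [hPr, hρ, dotProduct_comm]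
  have hρ0 : 0 < ρ := hρP ▸ hP.dotProduct_pos hz0
  have hrp : r ⬝ᵥ p = ρ := by
    rw [dotProduct_sub] at ho; linarith
  have hp0 : p ≠ 0 := fun h => by simp [h] at hrp; linarith
  set π := p ⬝ᵥ (A *ᵥ p) with hπ
  have hπ0 : 0 < π := hA.dotProduct_pos hp0
  have hzAp : z ⬝ᵥ (A *ᵥ p) = π := by
    rw [sub_dotProduct] at hc; linarith
  have hpAz : p ⬝ᵥ (A *ᵥ z) = π := by rw [hA.isHermitian.dotProduct_mulVec_comm, hzAp]
  -- `A`-orthogonality of `p` and `p - z` gives `pᵀ A p ≤ zᵀ A z`.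
  have hπz : π ≤ z ⬝ᵥ (A *ᵥ z) := by
    have := hA.dotProduct_nonneg (p - z)
    simp only [mulVec_sub, sub_dotProduct, dotProduct_sub, hzAp, hpAz] at this
    linarith
  have hπρ : π ≤ C * ρ := hπz.trans (hρP ▸ (hAP z).2)
  -- Expanding `0 ≤ (u - x - C z)ᵀ P (u - x - C z)`, where `P z = A (u - x)`.
  have hAe : (u - x) ⬝ᵥ (A *ᵥ (u - x)) ≤ C * ρ := by
    have h1 := hP.dotProduct_nonneg ((u - x) - C • z)
    have h2 := (hAP (u - x)).1
    have h3 : (u - x) ⬝ᵥ (P *ᵥ z) = (u - x) ⬝ᵥ (A *ᵥ (u - x)) := by rw [hPr, hr]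
    have h4 : z ⬝ᵥ (P *ᵥ (u - x)) = (u - x) ⬝ᵥ (A *ᵥ (u - x)) := by
      rw [hP.isHermitian.dotProduct_mulVec_comm, h3]
    rw [mulVec_sub, sub_dotProduct, dotProduct_sub, dotProduct_sub, mulVec_smul, smul_dotProduct,
      smul_dotProduct, dotProduct_smul, dotProduct_smul, h3, h4, ← hρP] at h1
    simp only [smul_eq_mul] at h1
    have h5 : C * ((u - x) ⬝ᵥ (A *ᵥ (u - x))) ≤ C * (C * ρ) := by nlinarith
    exact le_of_mul_le_mul_left h5 hC
  set α := ρ / π with hα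
  have hαπ : α * π = ρ := div_mul_cancel₀ _ hπ0.ne'
  have hα0 : 0 < α := div_pos hρ0 hπ0
  set r' := r - α • (A *ᵥ p) with hr'
  set z' := P⁻¹ *ᵥ r' with hz'
  set β := (r' ⬝ᵥ z') / ρ with hβ
  have hstep : pcgStep A P ⟨x, r, z, p⟩ = ⟨x + α • p, r', z', z' + β • p⟩ := rfl
  rw [hstep]
  have hres : r' = A *ᵥ (u - (x + α • p)) := by
    rw [hr', hr, ← sub_sub, mulVec_sub _ (u - x), mulVec_smul]
  have hr'p : r' ⬝ᵥ p = 0 := by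
    rw [hr', sub_dotProduct, smul_dotProduct, hrp, dotProduct_comm (A *ᵥ p), ← hπ, smul_eq_mul,
      hαπ, sub_self]
  have hr'z : r' ⬝ᵥ z = 0 := by
    rw [hr', sub_dotProduct, smul_dotProduct, dotProduct_comm (A *ᵥ p), hzAp, smul_eq_mul, hαπ,
      sub_self]
  have hPi : P⁻¹.IsHermitian := hP.isHermitian.inv
  have hz'r : z' ⬝ᵥ r = 0 := by
    rw [dotProduct_comm, hz', hPi.dotProduct_mulVec_comm, ← hz, hr'z]
  refine ⟨⟨hres, rfl, ?_, ?_⟩, ?_⟩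
  · simp [hr'p]
  · have h1 : α * (z' ⬝ᵥ (A *ᵥ p)) = - (r' ⬝ᵥ z') := by
      have : α • (A *ᵥ p) = r - r' := by rw [hr']; abel
      rw [← smul_eq_mul, ← dotProduct_smul, this, dotProduct_sub, hz'r, dotProduct_comm z']; ring
    have h2 : α * (β * π) = r' ⬝ᵥ z' := by
      rw [mul_left_comm, hαπ, hβ, div_mul_cancel₀ _ hρ0.ne']
    simp only [add_sub_cancel_left, smul_dotProduct, mulVec_add, mulVec_smul, dotProduct_add,
      dotProduct_smul, smul_eq_mul]
    rw [← hπ, hA.isHermitian.dotProduct_mulVec_comm p z']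
    have h3 : z' ⬝ᵥ (A *ᵥ p) + β * π = 0 := by
      have : α * (z' ⬝ᵥ (A *ᵥ p) + β * π) = 0 := by rw [mul_add, h1, h2]; ring
      exact (mul_eq_zero.mp this).resolve_left hα0.ne'
    rw [← mul_add, h3, mul_zero]
  · have hpe : p ⬝ᵥ (A *ᵥ (u - x)) = ρ := by rw [← hr, dotProduct_comm, hrp]
    have hep : (u - x) ⬝ᵥ (A *ᵥ p) = ρ := by rw [hA.isHermitian.dotProduct_mulVec_comm, hpe]
    have hnew : (u - (x + α • p)) ⬝ᵥ (A *ᵥ (u - (x + α • p))) =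
        (u - x) ⬝ᵥ (A *ᵥ (u - x)) - α * ρ := by
      rw [← sub_sub, mulVec_sub _ (u - x), sub_dotProduct, dotProduct_sub, dotProduct_sub,
        mulVec_smul, smul_dotProduct, smul_dotProduct, dotProduct_smul, dotProduct_smul, hpe, hep,
        ← hπ]
      simp only [smul_eq_mul]
      rw [hαπ]; ring
    simp only [hnew]
    have h1 : C⁻¹ ≤ α := by
      rw [hα, le_div_iff₀ hπ0, inv_mul_le_iff₀ hC]; exact hπρ
    have h2 : (C ^ 2)⁻¹ * ((u - x) ⬝ᵥ (A *ᵥ (u - x))) ≤ C⁻¹ * ρ := by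
      have : (C ^ 2)⁻¹ * (C * ρ) = C⁻¹ * ρ := by field_simp
      rw [← this]; gcongr
    have h3 := mul_le_mul_of_nonneg_right h1 hρ0.le
    linarith

/-- After `k` iterations the energy norm of the error has shrunk by the factor
`(1 - C⁻²) ^ (k / 2)`. -/
lemma pcgIterate_energy_le {A P : Matrix ι ι ℝ} (hA : A.PosDef) (hP : P.PosDef) {C : ℝ}
    (hC : 1 ≤ C) (hAP : FormEquiv A P C) {b x₀ u : ι → ℝ} (hu : A *ᵥ u = b) (k : ℕ) :
    energyNorm A (pcgIterate A P b x₀ k - u) ≤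
      √((1 - (C ^ 2)⁻¹) ^ k) * energyNorm A (x₀ - u) := by
  have hC0 : 0 < C := by linarith
  have hq : 0 ≤ 1 - (C ^ 2)⁻¹ := sub_nonneg.mpr (inv_le_one_of_one_le₀ (one_le_pow₀ hC))
  have hneg : ∀ v : ι → ℝ, (v - u) ⬝ᵥ (A *ᵥ (v - u)) = (u - v) ⬝ᵥ (A *ᵥ (u - v)) := fun v => by
    rw [← neg_sub u v, mulVec_neg, neg_dotProduct, dotProduct_neg, neg_neg]
  have key : PCGInvariant A P u ((pcgStep A P)^[k] (pcgInit A P b x₀)) ∧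
      (u - pcgIterate A P b x₀ k) ⬝ᵥ (A *ᵥ (u - pcgIterate A P b x₀ k)) ≤
        (1 - (C ^ 2)⁻¹) ^ k * ((u - x₀) ⬝ᵥ (A *ᵥ (u - x₀))) := by
    induction k with
    | zero => exact ⟨pcgInvariant_init hu, by simp [pcgIterate, pcgInit]⟩
    | succ k ih =>
      have := pcgStep_spec hA hP hC0 hAP ih.1
      simp only [pcgIterate, Function.iterate_succ_apply'] at this ih ⊢
      refine ⟨this.1, this.2.trans ?_⟩
      rw [pow_succ' (1 - (C ^ 2)⁻¹) k, mul_assoc]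
      exact mul_le_mul_of_nonneg_left ih.2 hq
  rw [energyNorm, energyNorm, ← Real.sqrt_mul (pow_nonneg hq k), hneg, hneg]
  exact Real.sqrt_le_sqrt key.2

lemma exists_pcg_iterations {C ε : ℝ} (hC : 1 ≤ C) (hε : 0 < ε) :
    ∃ N : ℕ, √((1 - (C ^ 2)⁻¹) ^ N) ≤ ε := by
  have hq : 1 - (C ^ 2)⁻¹ < 1 := by
    have : 0 < (C ^ 2)⁻¹ := by positivity
    linarith
  obtain ⟨N, hN⟩ := exists_pow_lt_of_lt_one (pow_pos hε 2) hq
  exact ⟨N, Real.sqrt_le_iff.mpr ⟨hε.le, hN.le⟩⟩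

end PCG

/-! ### Uniformly equivalent sequences of matrices -/

section Sequences

variable {ι : ℕ → Type} [∀ M, Fintype (ι M)] [∀ M, DecidableEq (ι M)]

/-- It is enough to have a uniform constant for all large matrices of the sequence. -/
lemma exists_uniform_formEquiv {A P : ∀ M, Matrix (ι M) (ι M) ℝ}
    (hA : ∀ M, 1 ≤ M → (A M).PosDef) (hP : ∀ M, 1 ≤ M → (P M).PosDef) {C₀ : ℝ} {M₀ : ℕ}
    (h : ∀ M, 1 ≤ M → M₀ ≤ M → FormEquiv (A M) (P M) C₀) :
    ∃ C : ℝ, 1 ≤ C ∧ ∀ M, 1 ≤ M → FormEquiv (A M) (P M) C := by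
  have h1 : ∀ M, ∃ C, 1 ≤ M → FormEquiv (A M) (P M) C := fun M => by
    by_cases hM : 1 ≤ M
    · obtain ⟨C, hC⟩ := exists_formEquiv (hA M hM) (hP M hM)
      exact ⟨C, fun _ => hC⟩
    · exact ⟨0, fun h => absurd h hM⟩
  choose C hC using h1
  have hsum : 0 ≤ ∑ M ∈ Finset.range M₀, |C M| := Finset.sum_nonneg fun _ _ => abs_nonneg _
  refine ⟨1 + |C₀| + ∑ M ∈ Finset.range M₀, |C M|, by linarith [abs_nonneg C₀], fun M hM => ?_⟩
  by_cases hM₀ : M₀ ≤ M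
  · exact (h M hM hM₀).mono (hA M hM) (hP M hM) (by linarith [le_abs_self C₀])
  · refine (hC M hM).mono (hA M hM) (hP M hM) ?_
    have := Finset.single_le_sum (f := fun M => |C M|) (fun _ _ => abs_nonneg _)
      (Finset.mem_range.mpr (not_le.mp hM₀))
    linarith [le_abs_self (C M), abs_nonneg C₀]

lemma eigsInPositiveInterval_of_formEquiv {A P : ∀ M, Matrix (ι M) (ι M) ℝ}
    (hA : ∀ M, 1 ≤ M → (A M).PosDef) (hP : ∀ M, 1 ≤ M → (P M).PosDef) {C : ℝ} (hC : 1 ≤ C)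
    (h : ∀ M, 1 ≤ M → FormEquiv (A M) (P M) C) :
    EigsInPositiveInterval (fun M => (P M)⁻¹ * A M) :=
  ⟨C⁻¹, C, by positivity, fun M hM _ hz =>
    (h M hM).eigs_mem_Icc (by linarith) (hA M hM).isHermitian (hP M hM) hz⟩

lemma pcgOptimal_of_formEquiv {A P : ∀ M, Matrix (ι M) (ι M) ℝ}
    (hA : ∀ M, 1 ≤ M → (A M).PosDef) (hP : ∀ M, 1 ≤ M → (P M).PosDef) {C : ℝ} (hC : 1 ≤ C)
    (h : ∀ M, 1 ≤ M → FormEquiv (A M) (P M) C) : PCGOptimal A P := by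
  intro ε hε
  obtain ⟨N, hN⟩ := exists_pcg_iterations hC hε
  exact ⟨N, fun M hM b x₀ u hu => ⟨N, le_rfl,
    (pcgIterate_energy_le (hA M hM) (hP M hM) hC (h M hM) hu N).trans
      (mul_le_mul_of_nonneg_right hN (Real.sqrt_nonneg _))⟩⟩

/-- It is enough to bound the number of outliers for all large matrices of the sequence. -/
lemma properlyClusteredAt_of_eventually {B : ∀ M, Matrix (ι M) (ι M) ℝ} {z₀ : ℂ}
    (h : ∀ ε : ℝ, 0 < ε → ∃ N M₀ : ℕ, ∀ M : ℕ, 1 ≤ M → M₀ ≤ M →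
      (open Classical in (eigs (B M)).countP (fun z => z ∉ Metric.ball z₀ ε)) ≤ N) :
    ProperlyClusteredAt B z₀ := by
  classical
  intro ε hε
  obtain ⟨N, M₀, hN⟩ := h ε hε
  refine ⟨N + ∑ M ∈ Finset.range M₀, Fintype.card (ι M), fun M hM => ?_⟩
  by_cases hM₀ : M₀ ≤ M
  · exact (hN M hM hM₀).trans (Nat.le_add_right _ _)
  · refine (countP_eigs_le_card (B M) _).trans (le_add_left ?_)
    exact Finset.single_le_sum (f := fun M => Fintype.card (ι M)) (fun _ _ => Nat.zero_le _)
      (Finset.mem_range.mpr (not_le.mp hM₀))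

end Sequences

/-! ### A Poincaré inequality on squares of lattice points -/

lemma sq_sub_le_of_lt {f : ℕ → ℝ} {m i j : ℕ} (hi : i < m) (hj : j < m) :
    (f i - f j) ^ 2 ≤ m * ∑ k ∈ Finset.range m, (f (k + 1) - f k) ^ 2 := by
  wlog hij : i ≤ j generalizing i j
  · rw [← neg_sub, neg_sq]; exact this hj hi (le_of_not_ge hij)
  have h1 : f j - f i = ∑ k ∈ Finset.Ico i j, (f (k + 1) - f k) := by
    rw [Finset.sum_Ico_eq_sub _ hij, Finset.sum_range_sub, Finset.sum_range_sub]; ring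
  have hsub : Finset.Ico i j ⊆ Finset.range m := fun k hk => by
    simp only [Finset.mem_Ico, Finset.mem_range] at hk ⊢; omega
  rw [← neg_sub, neg_sq, h1]
  refine sq_sum_le_card_mul_sum_sq.trans ?_
  gcongr
  · rw [Nat.card_Ico]; omega

lemma sum_sum_sq_sub {α : Type*} (s : Finset α) (g : α → ℝ) :
    ∑ p ∈ s, ∑ p' ∈ s, (g p - g p') ^ 2 =
      2 * (s.card * ∑ p ∈ s, g p ^ 2) - 2 * (∑ p ∈ s, g p) ^ 2 := by
  have h : ∀ p p', (g p - g p') ^ 2 = g p ^ 2 - 2 * (g p * g p') + g p' ^ 2 := fun p p' => by ring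
  simp only [h, Finset.sum_add_distrib, Finset.sum_sub_distrib, ← Finset.mul_sum,
    Finset.sum_const, nsmul_eq_mul, ← Finset.sum_mul]
  ring

/-- The energy of a lattice function at a point: the sum of the squares of its forward differences
in the two coordinate directions. -/
def diffSq (g : ℕ → ℕ → ℝ) (i j : ℕ) : ℝ :=
  (g (i + 1) j - g i j) ^ 2 + (g i (j + 1) - g i j) ^ 2

lemma diffSq_nonneg (g : ℕ → ℕ → ℝ) (i j : ℕ) : 0 ≤ diffSq g i j := by
  unfold diffSq; positivity

/-- The Poincaré inequality on a square of `m × m` lattice points. -/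
theorem sq_mul_sum_sq_le (g : ℕ → ℕ → ℝ) (m : ℕ) :
    (m : ℝ) ^ 2 * ∑ i ∈ Finset.range m, ∑ j ∈ Finset.range m, g i j ^ 2 ≤
      (∑ i ∈ Finset.range m, ∑ j ∈ Finset.range m, g i j) ^ 2 +
      (m : ℝ) ^ 4 * ∑ i ∈ Finset.range m, ∑ j ∈ Finset.range m, diffSq g i j := by
  have h1 := sum_sum_sq_sub (Finset.range m ×ˢ Finset.range m) (fun p => g p.1 p.2)
  simp only [Finset.sum_product, Finset.card_product, Finset.card_range, Nat.cast_mul] at h1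
  have h2 : ∑ i ∈ Finset.range m, ∑ j ∈ Finset.range m, ∑ i' ∈ Finset.range m,
      ∑ j' ∈ Finset.range m, (g i j - g i' j') ^ 2 ≤
      ∑ i ∈ Finset.range m, ∑ j ∈ Finset.range m, ∑ i' ∈ Finset.range m, ∑ j' ∈ Finset.range m,
        (2 * (m * ∑ k ∈ Finset.range m, (g (k + 1) j - g k j) ^ 2) +
          2 * (m * ∑ k ∈ Finset.range m, (g i' (k + 1) - g i' k) ^ 2)) := by
    refine Finset.sum_le_sum fun i hi => Finset.sum_le_sum fun j hj =>
      Finset.sum_le_sum fun i' hi' => Finset.sum_le_sum fun j' hj' => ?_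
    have ha := sq_sub_le_of_lt (f := fun k => g k j) (Finset.mem_range.mp hi)
      (Finset.mem_range.mp hi')
    have hb := sq_sub_le_of_lt (f := fun k => g i' k) (Finset.mem_range.mp hj)
      (Finset.mem_range.mp hj')
    -- From `(i, j)` to `(i', j')` by way of `(i', j)`.
    nlinarith [sq_nonneg ((g i j - g i' j) - (g i' j - g i' j'))]
  have h3 : ∑ i ∈ Finset.range m, ∑ j ∈ Finset.range m, ∑ i' ∈ Finset.range m,
      ∑ j' ∈ Finset.range m,
        (2 * (m * ∑ k ∈ Finset.range m, (g (k + 1) j - g k j) ^ 2) +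
          2 * (m * ∑ k ∈ Finset.range m, (g i' (k + 1) - g i' k) ^ 2)) =
      2 * ((m : ℝ) ^ 4 * ∑ i ∈ Finset.range m, ∑ j ∈ Finset.range m, diffSq g i j) := by
    simp only [diffSq, Finset.sum_add_distrib, Finset.sum_const, Finset.card_range, nsmul_eq_mul,
      ← Finset.mul_sum]
    rw [Finset.sum_comm]
    ring
  rw [h3] at h2
  linarith

lemma sum_range_mul_eq (F : ℕ → ℝ) (B m : ℕ) :
    ∑ i ∈ Finset.range (B * m), F i =
      ∑ b ∈ Finset.range B, ∑ i ∈ Finset.range m, F (b * m + i) := by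
  induction B with
  | zero => simp
  | succ B ih => rw [Nat.succ_mul, Finset.sum_range_add, ih, Finset.sum_range_succ]

lemma sum_sum_range_mul_eq (F : ℕ → ℕ → ℝ) (B m : ℕ) :
    ∑ i ∈ Finset.range (B * m), ∑ j ∈ Finset.range (B * m), F i j =
      ∑ b ∈ Finset.range B, ∑ b' ∈ Finset.range B,
        ∑ i ∈ Finset.range m, ∑ j ∈ Finset.range m, F (b * m + i) (b' * m + j) := by
  rw [sum_range_mul_eq]
  refine Finset.sum_congr rfl fun b _ => ?_
  simp only [sum_range_mul_eq]
  rw [Finset.sum_comm]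

/-- The Poincaré inequality for functions with vanishing means on all the `m × m` blocks. -/
theorem sum_sq_le_of_block_sums_eq_zero (g : ℕ → ℕ → ℝ) {B m : ℕ} (hm : 0 < m)
    (h : ∀ b < B, ∀ b' < B,
      ∑ i ∈ Finset.range m, ∑ j ∈ Finset.range m, g (b * m + i) (b' * m + j) = 0) :
    ∑ i ∈ Finset.range (B * m), ∑ j ∈ Finset.range (B * m), g i j ^ 2 ≤
      (m : ℝ) ^ 2 * ∑ i ∈ Finset.range (B * m), ∑ j ∈ Finset.range (B * m), diffSq g i j := by
  rw [sum_sum_range_mul_eq, sum_sum_range_mul_eq]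
  simp only [Finset.mul_sum (Finset.range B)]
  refine Finset.sum_le_sum fun b hb => Finset.sum_le_sum fun b' hb' => ?_
  have h1 := sq_mul_sum_sq_le (fun i j => g (b * m + i) (b' * m + j)) m
  rw [h b (Finset.mem_range.mp hb) b' (Finset.mem_range.mp hb')] at h1
  have hm2 : (0 : ℝ) < (m : ℝ) ^ 2 := by positivity
  refine le_of_mul_le_mul_left ?_ hm2
  calc _ ≤ _ := h1
    _ = _ := by simp only [diffSq, add_assoc]; ring

/-- The Poincaré inequality for functions that vanish outside `N × N` lattice points. On a square of
twice the size the support is a quarter of the points, so that the square of the sum is at most a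
quarter of what the Poincaré inequality bounds. -/
theorem sum_sq_le_of_support (g : ℕ → ℕ → ℝ) {N : ℕ} (hN : 0 < N)
    (h : ∀ i j, N ≤ i ∨ N ≤ j → g i j = 0) :
    3 * ∑ i ∈ Finset.range (2 * N), ∑ j ∈ Finset.range (2 * N), g i j ^ 2 ≤
      16 * (N : ℝ) ^ 2 *
        ∑ i ∈ Finset.range (2 * N), ∑ j ∈ Finset.range (2 * N), diffSq g i j := by
  have h1 := sq_mul_sum_sq_le g (2 * N)
  have hsum : ∀ F : ℕ → ℕ → ℝ, (∀ i j, N ≤ i ∨ N ≤ j → F i j = 0) →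
      ∑ i ∈ Finset.range (2 * N), ∑ j ∈ Finset.range (2 * N), F i j =
        ∑ p ∈ Finset.range N ×ˢ Finset.range N, F p.1 p.2 := by
    intro F hF
    rw [← Finset.sum_product' (Finset.range (2 * N)) (Finset.range (2 * N)) F]
    refine (Finset.sum_subset ?_ ?_).symm
    · intro p hp
      simp only [Finset.mem_product, Finset.mem_range] at hp ⊢; omega
    · intro p _ hp
      apply hF
      simp only [Finset.mem_product, Finset.mem_range] at hp; omega
  have h2 := sq_sum_le_card_mul_sum_sq (s := Finset.range N ×ˢ Finset.range N)
    (f := fun p => g p.1 p.2)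
  rw [← hsum g h, ← hsum (fun i j => g i j ^ 2) (fun i j hij => by simp [h i j hij])] at h2
  simp only [Finset.card_product, Finset.card_range, Nat.cast_mul, Nat.cast_ofNat] at h1 h2
  set S := ∑ i ∈ Finset.range (2 * N), ∑ j ∈ Finset.range (2 * N), g i j ^ 2
  set D := ∑ i ∈ Finset.range (2 * N), ∑ j ∈ Finset.range (2 * N), diffSq g i j
  have hN2 : (0 : ℝ) < (N : ℝ) ^ 2 := by positivity
  refine le_of_mul_le_mul_left ?_ hN2
  nlinarith

/-! ### The matrices of the mesh -/

lemma mem_meshNodes {M : ℕ} {s : ℤ × ℤ} :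
    s ∈ meshNodes M ↔ |s.1| ≤ (M : ℤ) ∧ |s.2| ≤ (M : ℤ) ∧ |s.1 + s.2| ≤ (M : ℤ) := by
  simp only [meshNodes, Finset.mem_filter, Finset.mem_product, Finset.mem_Icc, abs_le]
  tauto

lemma mem_innerNodes {M : ℕ} {s : ℤ × ℤ} :
    s ∈ innerNodes M ↔ |s.1| < (M : ℤ) ∧ |s.2| < (M : ℤ) ∧ |s.1 + s.2| < (M : ℤ) := by
  simp only [innerNodes, Finset.mem_filter, mem_meshNodes]
  constructor
  · exact fun h => h.2
  · exact fun h => ⟨⟨h.1.le, h.2.1.le, h.2.2.le⟩, h⟩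

/-- The six triangles that meet at a node. -/
def star6 (s : ℤ × ℤ) : Finset ((ℤ × ℤ) × Bool) :=
  {(s, false), (s - (1, 0), false), (s - (0, 1), false),
    (s - (1, 1), true), (s - (1, 0), true), (s - (0, 1), true)}

lemma mem_triVertices_iff {s : ℤ × ℤ} {K : (ℤ × ℤ) × Bool} : s ∈ triVertices K ↔ K ∈ star6 s := by
  obtain ⟨⟨a, b⟩, c⟩ := K
  obtain ⟨x, y⟩ := s
  cases c <;> simp [triVertices, star6, Prod.ext_iff] <;> omega

lemma mem_meshTriangles_of_innerNode {M : ℕ} {s : ℤ × ℤ} {K : (ℤ × ℤ) × Bool}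
    (hs : s ∈ innerNodes M) (hK : s ∈ triVertices K) : K ∈ meshTriangles M := by
  obtain ⟨⟨a, b⟩, c⟩ := K
  obtain ⟨x, y⟩ := s
  rw [mem_innerNodes] at hs
  simp only [abs_lt] at hs
  simp only [meshTriangles, Finset.mem_filter, Finset.mem_product, Finset.mem_Icc,
    Finset.mem_univ, and_true, Finset.subset_iff, mem_meshNodes, abs_le]
  cases c <;>
  · simp [triVertices, Prod.ext_iff] at hK ⊢
    exact ⟨by omega, fun u v h => by omega⟩

/-- The entries, up to a common factor, of the stiffness matrix of the triangle `K`. -/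
def triCoef (K : (ℤ × ℤ) × Bool) (s t : ℤ × ℤ) : ℝ :=
  if s ∈ triVertices K ∧ t ∈ triVertices K then (if s = t then 2 else -1) else 0

/-- The matrix assembled from the triangles of the mesh with weights `q`. It agrees with the
stiffness matrix up to a positive factor. -/
def meshMatrix (M : ℕ) (q : (ℤ × ℤ) × Bool → ℝ) : Matrix (innerNodes M) (innerNodes M) ℝ :=
  Matrix.of fun i j => ∑ K ∈ meshTriangles M, q K * triCoef K i j

/-- The extension by zero of a function on the internal nodes to the whole lattice. -/
def zeroExt {M : ℕ} (y : innerNodes M → ℝ) (s : ℤ × ℤ) : ℝ :=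
  if h : s ∈ innerNodes M then y ⟨s, h⟩ else 0

/-- The sum of the squares of the differences of `U` along the three edges of the triangle `K`. -/
def triEnergy (K : (ℤ × ℤ) × Bool) (U : ℤ × ℤ → ℝ) : ℝ :=
  (U (K.1 + (1, 0)) - U (if K.2 then K.1 + (1, 1) else K.1)) ^ 2 +
  (U (K.1 + (0, 1)) - U (if K.2 then K.1 + (1, 1) else K.1)) ^ 2 +
  (U (K.1 + (1, 0)) - U (K.1 + (0, 1))) ^ 2

lemma triEnergy_nonneg (K : (ℤ × ℤ) × Bool) (U : ℤ × ℤ → ℝ) : 0 ≤ triEnergy K U := by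
  unfold triEnergy; positivity

lemma triCoef_comm (K : (ℤ × ℤ) × Bool) (s t : ℤ × ℤ) : triCoef K s t = triCoef K t s := by
  simp only [triCoef, and_comm, eq_comm]

lemma meshMatrix_isHermitian (M : ℕ) (q : (ℤ × ℤ) × Bool → ℝ) : (meshMatrix M q).IsHermitian := by
  ext i j
  simp [meshMatrix, triCoef_comm]

lemma sum_triVertices (K : (ℤ × ℤ) × Bool) (F : ℤ × ℤ → ℝ) :
    ∑ s ∈ triVertices K, F s =
      F (if K.2 then K.1 + (1, 1) else K.1) + (F (K.1 + (1, 0)) + F (K.1 + (0, 1))) := by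
  obtain ⟨⟨a, b⟩, c⟩ := K
  rw [triVertices, Finset.sum_insert, Finset.sum_insert, Finset.sum_singleton]
  · simp
  · cases c <;> simp

lemma sum_innerNodes_mul {M : ℕ} (y : innerNodes M → ℝ) (V : Finset (ℤ × ℤ)) (F : ℤ × ℤ → ℝ)
    (hF : ∀ s ∉ V, F s = 0) :
    ∑ i : innerNodes M, F i * y i = ∑ s ∈ V, F s * zeroExt y s := by
  have h1 : ∀ i : innerNodes M, F i * y i = F i * zeroExt y i := fun i => by
    simp [zeroExt]
  rw [Finset.sum_congr rfl fun i _ => h1 i,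
    Finset.sum_coe_sort (innerNodes M) (fun s => F s * zeroExt y s)]
  rw [← Finset.sum_subset (Finset.inter_subset_left : innerNodes M ∩ V ⊆ _),
    ← Finset.sum_subset (Finset.inter_subset_right : innerNodes M ∩ V ⊆ V)]
  · intro s hs hs'
    have : s ∉ innerNodes M := fun h => hs' (Finset.mem_inter.mpr ⟨h, hs⟩)
    simp [zeroExt, this]
  · intro s hs hs'
    rw [hF s fun h => hs' (Finset.mem_inter.mpr ⟨hs, h⟩), zero_mul]

/-- The quadratic form of a mesh matrix is a weighted sum of squared differences along the edges, so
it is monotone in the weights. -/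
theorem dotProduct_meshMatrix_mulVec {M : ℕ} (q : (ℤ × ℤ) × Bool → ℝ) (y : innerNodes M → ℝ) :
    y ⬝ᵥ (meshMatrix M q *ᵥ y) = ∑ K ∈ meshTriangles M, q K * triEnergy K (zeroExt y) := by
  have h1 : y ⬝ᵥ (meshMatrix M q *ᵥ y) =
      ∑ K ∈ meshTriangles M, q K * ∑ i : innerNodes M, (∑ j : innerNodes M, triCoef K i j * y j) * y i := by
    simp only [dotProduct, mulVec, meshMatrix, Matrix.of_apply, Finset.mul_sum, Finset.sum_mul]
    rw [Finset.sum_congr rfl fun i _ => Finset.sum_comm, Finset.sum_comm]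
    refine Finset.sum_congr rfl fun K _ => Finset.sum_congr rfl fun i _ =>
      Finset.sum_congr rfl fun j _ => ?_
    ring
  rw [h1]
  refine Finset.sum_congr rfl fun K _ => ?_
  congr 1
  have h2 : ∀ s : ℤ × ℤ, ∑ j : innerNodes M, triCoef K s j * y j =
      ∑ t ∈ triVertices K, triCoef K s t * zeroExt y t := fun s =>
    sum_innerNodes_mul y (triVertices K) (triCoef K s) fun t ht => by simp [triCoef, ht]
  simp only [h2]
  rw [sum_innerNodes_mul y (triVertices K)
    (fun s => ∑ t ∈ triVertices K, triCoef K s t * zeroExt y t)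
    (fun s hs => by simp [triCoef, hs])]
  simp only [sum_triVertices]
  obtain ⟨⟨a, b⟩, c⟩ := K
  cases c <;> simp [triCoef, triVertices, triEnergy] <;> ring

lemma triEnergy_eq_zero_of_notMem {M : ℕ} (y : innerNodes M → ℝ) {K : (ℤ × ℤ) × Bool}
    (hK : K ∉ meshTriangles M) : triEnergy K (zeroExt y) = 0 := by
  have h : ∀ s ∈ triVertices K, zeroExt y s = 0 := fun s hs => by
    have : s ∉ innerNodes M := fun h => hK (mem_meshTriangles_of_innerNode h hs)
    simp [zeroExt, this]
  simp [triEnergy, h _ (show (if K.2 then K.1 + (1, 1) else K.1) ∈ triVertices K by simp [triVertices]),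
    h _ (show K.1 + (1, 0) ∈ triVertices K by simp [triVertices]),
    h _ (show K.1 + (0, 1) ∈ triVertices K by simp [triVertices])]

/-- The zero extension of `y` in coordinates that are natural numbers on the mesh. -/
def gridFun {M : ℕ} (y : innerNodes M → ℝ) (i j : ℕ) : ℝ := zeroExt y ((i : ℤ) - M, (j : ℤ) - M)

lemma gridFun_eq_zero {M : ℕ} (y : innerNodes M → ℝ) (i j : ℕ) (h : 2 * M + 1 ≤ i ∨ 2 * M + 1 ≤ j) :
    gridFun y i j = 0 := by
  have : ((i : ℤ) - M, (j : ℤ) - M) ∉ innerNodes M := by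
    rw [mem_innerNodes]; simp only [abs_lt]; omega
  simp [gridFun, zeroExt, this]

lemma gridEmb_injective (M : ℕ) :
    Function.Injective (fun p : ℕ × ℕ => ((p.1 : ℤ) - (M : ℤ), (p.2 : ℤ) - (M : ℤ))) := by
  intro p p' h
  simp only [Prod.ext_iff] at h ⊢
  omega

lemma sum_gridFun_sq {M : ℕ} (y : innerNodes M → ℝ) {n : ℕ} (hn : 2 * M + 1 ≤ n) :
    ∑ i ∈ Finset.range n, ∑ j ∈ Finset.range n, gridFun y i j ^ 2 = y ⬝ᵥ y := by
  have h1 : y ⬝ᵥ y = ∑ s ∈ innerNodes M, zeroExt y s ^ 2 := by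
    rw [← Finset.sum_coe_sort (innerNodes M) (fun s => zeroExt y s ^ 2)]
    simp [dotProduct, zeroExt, sq]
  rw [h1, ← Finset.sum_product' (Finset.range n) (Finset.range n) fun i j => gridFun y i j ^ 2]
  simp only [gridFun]
  rw [← Finset.sum_image (f := fun s => zeroExt y s ^ 2)
    (g := fun p : ℕ × ℕ => ((p.1 : ℤ) - (M : ℤ), (p.2 : ℤ) - (M : ℤ))) fun p _ p' _ h =>
      gridEmb_injective M h]
  refine (Finset.sum_subset ?_ ?_).symm
  · intro s hs
    rw [mem_innerNodes] at hs
    simp only [abs_lt] at hs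
    simp only [Finset.mem_image, Finset.mem_product, Finset.mem_range]
    refine ⟨((s.1 + M).toNat, (s.2 + M).toNat), ⟨by omega, by omega⟩, ?_⟩
    ext <;> simp only <;> omega
  · intro s _ hs
    simp [zeroExt, hs]

/-- The two edges of the lattice directions of the upward triangles already carry the energy of the
forward differences. -/
lemma sum_diffSq_gridFun_le {M : ℕ} (y : innerNodes M → ℝ) (n : ℕ) :
    ∑ i ∈ Finset.range n, ∑ j ∈ Finset.range n, diffSq (gridFun y) i j ≤
      y ⬝ᵥ (meshMatrix M (fun _ => 1) *ᵥ y) := by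
  rw [dotProduct_meshMatrix_mulVec]
  simp only [one_mul]
  rw [← Finset.sum_product' (Finset.range n) (Finset.range n) fun i j => diffSq (gridFun y) i j]
  set φ : ℕ × ℕ → (ℤ × ℤ) × Bool :=
    fun p => (((p.1 : ℤ) - (M : ℤ), (p.2 : ℤ) - (M : ℤ)), false) with hφ
  have hinj : Function.Injective φ := fun p p' h => gridEmb_injective M (Prod.ext_iff.mp h).1
  calc ∑ p ∈ Finset.range n ×ˢ Finset.range n, diffSq (gridFun y) p.1 p.2
      ≤ ∑ p ∈ Finset.range n ×ˢ Finset.range n, triEnergy (φ p) (zeroExt y) := by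
        refine Finset.sum_le_sum fun p _ => ?_
        simp only [diffSq, gridFun, triEnergy, hφ, Prod.mk_add_mk, Nat.cast_add, Nat.cast_one,
          add_zero, Bool.false_eq_true, if_false, sub_add_eq_add_sub]
        exact le_add_of_nonneg_right (sq_nonneg _)
    _ = ∑ K ∈ (Finset.range n ×ˢ Finset.range n).image φ, triEnergy K (zeroExt y) := by
        rw [Finset.sum_image fun p _ p' _ h => hinj h]
    _ = ∑ K ∈ (Finset.range n ×ˢ Finset.range n).image φ ∩ meshTriangles M,
          triEnergy K (zeroExt y) := by
        refine (Finset.sum_subset Finset.inter_subset_left fun K hK hK' => ?_).symm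
        exact triEnergy_eq_zero_of_notMem y fun h => hK' (Finset.mem_inter.mpr ⟨hK, h⟩)
    _ ≤ _ := Finset.sum_le_sum_of_subset_of_nonneg Finset.inter_subset_right
        fun K _ _ => triEnergy_nonneg K _

/-- The smallest eigenvalue of the matrix with constant coefficient is at least of order `h²`. -/
theorem poincare_meshMatrix_one {M : ℕ} (hM : 1 ≤ M) (y : innerNodes M → ℝ) :
    y ⬝ᵥ y ≤ 48 * (M : ℝ) ^ 2 * (y ⬝ᵥ (meshMatrix M (fun _ => 1) *ᵥ y)) := by
  have h1 := sum_sq_le_of_support (gridFun y) (N := 2 * M + 1) (by omega) (gridFun_eq_zero y)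
  rw [sum_gridFun_sq y (by omega)] at h1
  have h2 := sum_diffSq_gridFun_le y (2 * (2 * M + 1))
  have h3 : (((2 * M + 1 : ℕ) : ℝ)) ^ 2 ≤ 9 * (M : ℝ) ^ 2 := by
    have : (1 : ℝ) ≤ M := by exact_mod_cast hM
    push_cast; nlinarith
  set S := ∑ i ∈ Finset.range (2 * (2 * M + 1)), ∑ j ∈ Finset.range (2 * (2 * M + 1)),
    diffSq (gridFun y) i j
  have hS : 0 ≤ S := Finset.sum_nonneg fun i _ => Finset.sum_nonneg fun j _ => diffSq_nonneg _ i j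
  have h4 : 16 * (((2 * M + 1 : ℕ) : ℝ)) ^ 2 * S ≤ 16 * (9 * (M : ℝ) ^ 2) *
      (y ⬝ᵥ (meshMatrix M (fun _ => 1) *ᵥ y)) := by gcongr
  linarith

/-- The sums of a function on the internal nodes over the blocks of `m × m` lattice points, for
`B × B` blocks. -/
def blockSums (M B m : ℕ) : (innerNodes M → ℝ) →ₗ[ℝ] (Fin B × Fin B → ℝ) where
  toFun y b := ∑ i ∈ Finset.range m, ∑ j ∈ Finset.range m, gridFun y (b.1 * m + i) (b.2 * m + j)
  map_add' y y' := by
    ext b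
    simp only [Pi.add_apply, ← Finset.sum_add_distrib]
    refine Finset.sum_congr rfl fun i _ => Finset.sum_congr rfl fun j _ => ?_
    simp only [gridFun, zeroExt]; split_ifs <;> simp
  map_smul' c y := by
    ext b
    simp only [Pi.smul_apply, smul_eq_mul, RingHom.id_apply, Finset.mul_sum]
    refine Finset.sum_congr rfl fun i _ => Finset.sum_congr rfl fun j _ => ?_
    simp only [gridFun, zeroExt]; split_ifs <;> simp

/-- Outside a space whose dimension does not depend on `M`, the matrix with constant coefficient is
bounded below by an arbitrarily large multiple of `h²`. -/
theorem poincare_meshMatrix_one_of_blockSums {M R : ℕ} (hR : 1 ≤ R) (hM : R ≤ M)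
    (y : innerNodes M → ℝ) (hy : blockSums M (3 * R) (M / R + 1) y = 0) :
    (R : ℝ) ^ 2 * (y ⬝ᵥ y) ≤ 4 * (M : ℝ) ^ 2 * (y ⬝ᵥ (meshMatrix M (fun _ => 1) *ᵥ y)) := by
  set m := M / R + 1 with hm
  have hmR : M < m * R := by
    have := Nat.lt_mul_div_succ M (show 0 < R by omega)
    rw [hm, mul_comm]; exact this
  -- The `3 R` blocks of side `m = M / R + 1` in each direction cover the `2 M + 1` lattice lines.
  have hn : 2 * M + 1 ≤ 3 * R * m := by nlinarith
  have h1 := sum_sq_le_of_block_sums_eq_zero (gridFun y) (B := 3 * R) (m := m) (Nat.succ_pos _)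
    fun b hb b' hb' => congrFun hy (⟨b, hb⟩, ⟨b', hb'⟩)
  rw [sum_gridFun_sq y hn] at h1
  have h2 := sum_diffSq_gridFun_le y (3 * R * m)
  have h3 : (R : ℝ) * m ≤ 2 * M := by
    have h4 : R * (M / R) ≤ M := Nat.mul_div_le M R
    have : R * m ≤ 2 * M := by rw [hm, mul_add]; omega
    exact_mod_cast this
  have h5 : (R : ℝ) ^ 2 * (m : ℝ) ^ 2 ≤ 4 * (M : ℝ) ^ 2 := by
    have : ((R : ℝ) * m) ^ 2 ≤ (2 * M) ^ 2 := by gcongr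
    nlinarith
  set S := ∑ i ∈ Finset.range (3 * R * m), ∑ j ∈ Finset.range (3 * R * m), diffSq (gridFun y) i j
  have hS : 0 ≤ S := Finset.sum_nonneg fun i _ => Finset.sum_nonneg fun j _ => diffSq_nonneg _ i j
  calc (R : ℝ) ^ 2 * (y ⬝ᵥ y) ≤ (R : ℝ) ^ 2 * ((m : ℝ) ^ 2 * S) := by gcongr
    _ = (R : ℝ) ^ 2 * (m : ℝ) ^ 2 * S := by ring
    _ ≤ 4 * (M : ℝ) ^ 2 * (y ⬝ᵥ (meshMatrix M (fun _ => 1) *ᵥ y)) := by gcongr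

/-! ### Entries of the mesh matrices and of the preconditioner -/

lemma sum_star6 (s : ℤ × ℤ) (F : (ℤ × ℤ) × Bool → ℝ) :
    ∑ K ∈ star6 s, F K = F (s, false) + (F (s - (1, 0), false) + (F (s - (0, 1), false) +
      (F (s - (1, 1), true) + (F (s - (1, 0), true) + F (s - (0, 1), true))))) := by
  obtain ⟨a, b⟩ := s
  rw [star6, Finset.sum_insert, Finset.sum_insert, Finset.sum_insert, Finset.sum_insert,
    Finset.sum_insert, Finset.sum_singleton] <;> simp
  omega

lemma star6_subset_meshTriangles {M : ℕ} {s : ℤ × ℤ} (hs : s ∈ innerNodes M) :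
    star6 s ⊆ meshTriangles M := fun _ hK =>
  mem_meshTriangles_of_innerNode hs (mem_triVertices_iff.mpr hK)

lemma meshMatrix_apply {M : ℕ} (q : (ℤ × ℤ) × Bool → ℝ) (i j : innerNodes M) :
    meshMatrix M q i j = ∑ K ∈ star6 (i : ℤ × ℤ), q K * triCoef K i j := by
  refine (Finset.sum_subset (star6_subset_meshTriangles i.2) fun K _ hK => ?_).symm
  simp [triCoef, mem_triVertices_iff, hK]

lemma meshMatrix_apply_self {M : ℕ} (q : (ℤ × ℤ) × Bool → ℝ) (i : innerNodes M) :
    meshMatrix M q i i = 2 * ∑ K ∈ star6 (i : ℤ × ℤ), q K := by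
  rw [meshMatrix_apply, Finset.mul_sum]
  refine Finset.sum_congr rfl fun K hK => ?_
  simp [triCoef, mem_triVertices_iff, hK, mul_comm]

/-- Two mesh triangles of opposite orientations, coded by `σ` and `τ`, which share the nodes `s` and
`t` and are exchanged by the reflection about the midpoint of `s` and `t`. Either `s` and `t` are
the ends of the common edge, or `s = t` is the common vertex of two opposite triangles. -/
structure OppositePair (M : ℕ) (σ τ s t : ℤ × ℤ) : Prop where
  mem_left : (σ, false) ∈ meshTriangles M
  mem_right : (τ, true) ∈ meshTriangles M
  center : σ + (τ + (1, 1)) = s + t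
  left_s : s ∈ triVertices (σ, false)
  left_t : t ∈ triVertices (σ, false)
  right_s : s ∈ triVertices (τ, true)
  right_t : t ∈ triVertices (τ, true)

lemma oppositePair_of_innerNode {M : ℕ} {σ τ s t : ℤ × ℤ} (hs : s ∈ innerNodes M)
    (center : σ + (τ + (1, 1)) = s + t)
    (left_s : s ∈ triVertices (σ, false)) (left_t : t ∈ triVertices (σ, false))
    (right_s : s ∈ triVertices (τ, true)) (right_t : t ∈ triVertices (τ, true)) :
    OppositePair M σ τ s t :=
  ⟨mem_meshTriangles_of_innerNode hs left_s, mem_meshTriangles_of_innerNode hs right_s, center,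
    left_s, left_t, right_s, right_t⟩

/-- The triangles around an internal node form three pairs of opposite triangles. -/
lemma exists_sum_star6_eq {M : ℕ} {s : ℤ × ℤ} (hs : s ∈ innerNodes M) :
    ∃ σ τ : Fin 3 → ℤ × ℤ, (∀ k, OppositePair M (σ k) (τ k) s s) ∧
      ∀ F : (ℤ × ℤ) × Bool → ℝ,
        ∑ K ∈ star6 s, F K = ∑ k, (F (σ k, false) + F (τ k, true)) := by
  refine ⟨![s, s - (1, 0), s - (0, 1)], ![s - (1, 1), s - (0, 1), s - (1, 0)], ?_, ?_⟩
  · obtain ⟨a, b⟩ := s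
    intro k
    fin_cases k <;>
    · apply oppositePair_of_innerNode hs <;> simp [triVertices, Prod.ext_iff]
  · intro F
    rw [sum_star6, Fin.sum_univ_three]
    simp
    ring

/-- An off-diagonal entry vanishes, or comes from the two triangles which share an edge. -/
lemma meshMatrix_apply_of_ne {M : ℕ} {i j : innerNodes M} (hij : i ≠ j) :
    (∀ q, meshMatrix M q i j = 0) ∨ ∃ σ τ : ℤ × ℤ, OppositePair M σ τ i j ∧
      ∀ q, meshMatrix M q i j = -(q (σ, false) + q (τ, true)) := by
  have hij' : (i : ℤ × ℤ) ≠ j := fun h => hij (Subtype.ext h)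
  by_cases h : ∃ σ τ : ℤ × ℤ, OppositePair M σ τ i j
  · obtain ⟨σ, τ, h⟩ := h
    refine Or.inr ⟨σ, τ, h, fun q => ?_⟩
    rw [meshMatrix_apply]
    have hne : (σ, false) ≠ (τ, true) := by simp
    rw [neg_add, ← Finset.sum_subset (s₁ := {(σ, false), (τ, true)}), Finset.sum_pair hne]
    · simp [triCoef, hij', h.left_s, h.left_t, h.right_s, h.right_t]
    · intro K hK
      simp only [Finset.mem_insert, Finset.mem_singleton] at hK
      rcases hK with rfl | rfl
      · exact mem_triVertices_iff.mp h.left_s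
      · exact mem_triVertices_iff.mp h.right_s
    · intro K _ hK
      rw [triCoef, if_neg, mul_zero]
      rintro ⟨hi, hj⟩
      apply hK
      obtain ⟨-, -, h1, h2, h3, h4, h5⟩ := h
      generalize (i : ℤ × ℤ) = s at *
      generalize (j : ℤ × ℤ) = t at *
      obtain ⟨x, y⟩ := s
      obtain ⟨x', y'⟩ := t
      obtain ⟨⟨a, b⟩, c⟩ := K
      obtain ⟨u, v⟩ := σ
      obtain ⟨u', v'⟩ := τ
      cases c <;> simp [triVertices, Prod.ext_iff] at * <;> omega
  · refine Or.inl fun q => ?_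
    rw [meshMatrix_apply]
    refine Finset.sum_eq_zero fun K hK => ?_
    rw [triCoef, if_neg, mul_zero]
    rintro ⟨hi, hj⟩
    apply h
    have hin := i.2
    generalize (i : ℤ × ℤ) = s at *
    generalize (j : ℤ × ℤ) = t at *
    obtain ⟨⟨a, b⟩, c⟩ := K
    -- The reflected triangle is `K` translated by `s + t` and reflected.
    cases c
    · refine ⟨(a, b), s + t - (a, b) - (1, 1), oppositePair_of_innerNode hin (by abel) hi hj ?_ ?_⟩ <;>
      · obtain ⟨x, y⟩ := s
        obtain ⟨x', y'⟩ := t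
        simp [triVertices, Prod.ext_iff] at *
        omega
    · refine ⟨s + t - (a, b) - (1, 1), (a, b), oppositePair_of_innerNode hin (by abel) ?_ ?_ hi hj⟩ <;>
      · obtain ⟨x, y⟩ := s
        obtain ⟨x', y'⟩ := t
        simp [triVertices, Prod.ext_iff] at *
        omega

/-- The weights `q` on the triangles approximate the nodal values `α` to second order in `δ`, in the
sense of averages over pairs of triangles, and the nodal values vary by `O(δ)` on a triangle. -/
structure ApproxNodal (M : ℕ) (q : (ℤ × ℤ) × Bool → ℝ) (α : ℤ × ℤ → ℝ) (C δ : ℝ) : Prop where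
  pair : ∀ σ τ s t, OppositePair M σ τ s t →
    |q (σ, false) + q (τ, true) - (α s + α t)| ≤ C * δ ^ 2
  lip : ∀ K ∈ meshTriangles M, ∀ s ∈ triVertices K, ∀ t ∈ triVertices K, |α s - α t| ≤ C * δ

/-- The ratio of the diagonal entries of two mesh matrices: the average of the weights around a
node. -/
def diagRatio {M : ℕ} (q : (ℤ × ℤ) × Bool → ℝ) (i : innerNodes M) : ℝ :=
  meshMatrix M q i i / meshMatrix M (fun _ => 1) i i

lemma diagRatio_eq {M : ℕ} (q : (ℤ × ℤ) × Bool → ℝ) (i : innerNodes M) :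
    diagRatio q i = (∑ K ∈ star6 (i : ℤ × ℤ), q K) / 6 := by
  rw [diagRatio, meshMatrix_apply_self, meshMatrix_apply_self, sum_star6 _ (fun _ => (1 : ℝ))]
  ring

lemma le_diagRatio {M : ℕ} {q : (ℤ × ℤ) × Bool → ℝ} {m₀ : ℝ}
    (hq : ∀ K ∈ meshTriangles M, m₀ ≤ q K) (i : innerNodes M) : m₀ ≤ diagRatio q i := by
  have h : ∑ K ∈ star6 (i : ℤ × ℤ), m₀ ≤ ∑ K ∈ star6 (i : ℤ × ℤ), q K :=
    Finset.sum_le_sum fun K hK => hq K (star6_subset_meshTriangles i.2 hK)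
  rw [sum_star6 _ (fun _ => m₀)] at h
  rw [diagRatio_eq]
  linarith

lemma abs_diagRatio_sub_le {M : ℕ} {q : (ℤ × ℤ) × Bool → ℝ} {α : ℤ × ℤ → ℝ} {C δ : ℝ}
    (h : ApproxNodal M q α C δ) (i : innerNodes M) : |diagRatio q i - α i| ≤ C * δ ^ 2 / 2 := by
  obtain ⟨σ, τ, hp, hs⟩ := exists_sum_star6_eq i.2
  have h3 : diagRatio q i - α i =
      (∑ k, (q (σ k, false) + q (τ k, true) - (α i + α i))) / 6 := by
    rw [diagRatio_eq, hs]; simp [Fin.sum_univ_three]; ring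
  rw [h3, abs_div, abs_of_pos (show (0 : ℝ) < 6 by norm_num), div_le_iff₀ (by norm_num)]
  refine (Finset.abs_sum_le_sum_abs _ _).trans ?_
  refine (Finset.sum_le_sum fun k _ => h.pair _ _ _ _ (hp k)).trans ?_
  simp only [Finset.sum_const, Finset.card_univ, Fintype.card_fin, nsmul_eq_mul]
  linarith

lemma precond_apply {ι : Type} [Fintype ι] [DecidableEq ι] (A A₁ : Matrix ι ι ℝ) (i j : ι) :
    precond A A₁ i j = √(A i i / A₁ i i) * A₁ i j * √(A j j / A₁ j j) := by
  simp [precond, Matrix.mul_diagonal, Matrix.diagonal_mul]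

/-- The arithmetic and the geometric mean differ by `(√x - √y) ^ 2`, which is of second order in
`x - y`. -/
lemma add_sub_two_mul_sqrt_le {x y m₀ r : ℝ} (hm : 0 < m₀) (hx : m₀ ≤ x) (hy : m₀ ≤ y)
    (hr : |x - y| ≤ r) : |x + y - 2 * (√x * √y)| ≤ r ^ 2 / (2 * m₀) := by
  have hx' := Real.sq_sqrt (hm.le.trans hx)
  have hy' := Real.sq_sqrt (hm.le.trans hy)
  have h1 : x + y - 2 * (√x * √y) = (√x - √y) ^ 2 := by rw [sub_sq, hx', hy']; ring
  have h2 : (√x - √y) ^ 2 * (√x + √y) ^ 2 = (x - y) ^ 2 := by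
    rw [← mul_pow, mul_comm, ← sq_sub_sq, hx', hy']
  have h3 : 2 * m₀ ≤ (√x + √y) ^ 2 := by
    rw [add_sq, hx', hy']
    have := mul_nonneg (Real.sqrt_nonneg x) (Real.sqrt_nonneg y)
    nlinarith
  rw [h1, abs_of_nonneg (sq_nonneg _), le_div_iff₀ (by linarith)]
  calc (√x - √y) ^ 2 * (2 * m₀) ≤ (√x - √y) ^ 2 * (√x + √y) ^ 2 := by gcongr
    _ = |x - y| ^ 2 := by rw [h2, sq_abs]
    _ ≤ r ^ 2 := by gcongr

/-- The preconditioner differs from the matrix by `O(δ²)` in every entry, and not at all on the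
diagonal and for nodes that are not neighbours. -/
lemma abs_meshMatrix_sub_precond_le {M : ℕ} {q : (ℤ × ℤ) × Bool → ℝ} {α : ℤ × ℤ → ℝ}
    {C δ m₀ : ℝ} (hC : 0 ≤ C) (hδ : 0 ≤ δ) (hδ1 : δ ≤ 1) (hm : 0 < m₀)
    (hq : ∀ K ∈ meshTriangles M, m₀ ≤ q K) (h : ApproxNodal M q α C δ) (i j : innerNodes M) :
    |meshMatrix M q i j - precond (meshMatrix M q) (meshMatrix M fun _ => 1) i j| ≤
      if |(j : ℤ × ℤ).1 - (i : ℤ × ℤ).1| ≤ 1 ∧ |(j : ℤ × ℤ).2 - (i : ℤ × ℤ).2| ≤ 1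
      then (2 * C + 2 * C ^ 2 / m₀) * δ ^ 2 else 0 := by
  have hrhs : 0 ≤ (2 * C + 2 * C ^ 2 / m₀) * δ ^ 2 := by positivity
  have hd := le_diagRatio hq
  rw [precond_apply]
  change |meshMatrix M q i j - √(diagRatio q i) * meshMatrix M (fun _ => 1) i j *
    √(diagRatio q j)| ≤ _
  by_cases hij : i = j
  · subst hij
    have h0 : meshMatrix M (fun _ => 1) i i ≠ 0 := by
      rw [meshMatrix_apply_self, sum_star6]; norm_num
    rw [mul_right_comm, Real.mul_self_sqrt (hm.le.trans (hd i)), diagRatio, div_mul_cancel₀ _ h0]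
    simp [hrhs]
  rcases meshMatrix_apply_of_ne hij with h0 | ⟨σ, τ, hp, h0⟩
  · rw [h0, h0]; split_ifs <;> simp [hrhs]
  · have hadj : |(j : ℤ × ℤ).1 - (i : ℤ × ℤ).1| ≤ 1 ∧ |(j : ℤ × ℤ).2 - (i : ℤ × ℤ).2| ≤ 1 := by
      have h1 := hp.left_s
      have h2 := hp.left_t
      simp only [triVertices, Finset.mem_insert, Finset.mem_singleton, Prod.ext_iff] at h1 h2
      simp only [abs_le]
      simp at h1 h2
      omega
    rw [if_pos hadj, h0, h0]
    have e1 := h.pair _ _ _ _ hp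
    have e2 := abs_diagRatio_sub_le h i
    have e3 := abs_diagRatio_sub_le h j
    have e4 := h.lip _ hp.mem_left _ hp.left_s _ hp.left_t
    have hδ2 : C * δ ^ 2 ≤ C * δ := by
      have : δ ^ 2 ≤ δ := by nlinarith
      gcongr
    have e5 : |diagRatio q i - diagRatio q j| ≤ 2 * C * δ := by
      rw [abs_le] at *
      constructor <;> linarith [e2.1, e2.2, e3.1, e3.2, e4.1, e4.2]
    have e6 := add_sub_two_mul_sqrt_le hm (hd i) (hd j) e5
    have e7 : (2 * C * δ) ^ 2 / (2 * m₀) = 2 * C ^ 2 / m₀ * δ ^ 2 := by field_simp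
    rw [e7] at e6
    rw [abs_le] at *
    constructor <;> nlinarith [e1.1, e1.2, e2.1, e2.2, e3.1, e3.2, e6.1, e6.2]

/-- The quadratic form of a symmetric matrix is bounded by the largest absolute row sum. -/
lemma abs_dotProduct_mulVec_le {ι : Type} [Fintype ι] {E : Matrix ι ι ℝ} (hE : E.IsHermitian)
    {r : ℝ} (hr : ∀ i, ∑ j, |E i j| ≤ r) (y : ι → ℝ) :
    |y ⬝ᵥ (E *ᵥ y)| ≤ r * (y ⬝ᵥ y) := by
  have hsym : ∀ i j, |E i j| = |E j i| := fun i j => by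
    rw [← hE.apply i j]; simp
  have h1 : ∑ i, ∑ j, |E i j| * y j ^ 2 = ∑ i, ∑ j, |E i j| * y i ^ 2 := by
    rw [Finset.sum_comm]
    exact Finset.sum_congr rfl fun i _ => Finset.sum_congr rfl fun j _ => by rw [hsym]
  calc |y ⬝ᵥ (E *ᵥ y)| ≤ ∑ i, ∑ j, |y i * (E i j * y j)| := by
        simp only [dotProduct, mulVec, Finset.mul_sum]
        exact (Finset.abs_sum_le_sum_abs _ _).trans
          (Finset.sum_le_sum fun i _ => Finset.abs_sum_le_sum_abs _ _)
    _ ≤ ∑ i, ∑ j, (|E i j| * y i ^ 2 / 2 + |E i j| * y j ^ 2 / 2) := by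
        refine Finset.sum_le_sum fun i _ => Finset.sum_le_sum fun j _ => ?_
        rw [abs_mul, abs_mul, ← sq_abs (y i), ← sq_abs (y j)]
        nlinarith [mul_nonneg (abs_nonneg (E i j)) (sq_nonneg (|y i| - |y j|))]
    _ = ∑ i, ∑ j, |E i j| * y i ^ 2 := by
        simp only [Finset.sum_add_distrib, ← Finset.sum_div]
        rw [h1]; ring
    _ = ∑ i, (∑ j, |E i j|) * y i ^ 2 := by simp only [Finset.sum_mul]
    _ ≤ ∑ i, r * y i ^ 2 := Finset.sum_le_sum fun i _ =>
        mul_le_mul_of_nonneg_right (hr i) (sq_nonneg _)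
    _ = r * (y ⬝ᵥ y) := by simp only [dotProduct, Finset.mul_sum, sq]

lemma card_filter_neighbours_le {M : ℕ} (i : innerNodes M) :
    (Finset.univ.filter fun j : innerNodes M =>
      |(j : ℤ × ℤ).1 - (i : ℤ × ℤ).1| ≤ 1 ∧ |(j : ℤ × ℤ).2 - (i : ℤ × ℤ).2| ≤ 1).card ≤ 9 := by
  have h9 : (Finset.Icc (-1 : ℤ) 1 ×ˢ Finset.Icc (-1 : ℤ) 1).card = 9 := rfl
  rw [← h9]
  refine Finset.card_le_card_of_injOn (fun j => (j : ℤ × ℤ) - (i : ℤ × ℤ)) ?_ ?_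
  · intro j hj
    simp only [Finset.coe_filter, Finset.mem_univ, true_and, Set.mem_ofPred_eq, abs_le] at hj
    simp only [Finset.coe_product, Set.mem_prod, Finset.mem_coe, Finset.mem_Icc, Prod.fst_sub,
      Prod.snd_sub]
    exact hj
  · intro j _ j' _ hjj
    exact Subtype.ext (sub_left_injective hjj)

lemma precond_isHermitian {ι : Type} [Fintype ι] [DecidableEq ι] (A : Matrix ι ι ℝ)
    {A₁ : Matrix ι ι ℝ} (h : A₁.IsHermitian) : (precond A A₁).IsHermitian := by
  ext i j
  rw [conjTranspose_apply, precond_apply, precond_apply, ← h.apply i j]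
  simp; ring

/-- The quadratic form of the preconditioner. -/
lemma dotProduct_precond_mulVec {ι : Type} [Fintype ι] [DecidableEq ι] (A A₁ : Matrix ι ι ℝ)
    (y : ι → ℝ) :
    y ⬝ᵥ (precond A A₁ *ᵥ y) = (fun i => √(A i i / A₁ i i) * y i) ⬝ᵥ
      (A₁ *ᵥ fun i => √(A i i / A₁ i i) * y i) := by
  have h : (fun i => √(A i i / A₁ i i) * y i) =
      diagonal (fun i => √(A i i / A₁ i i)) *ᵥ y := by
    ext i; rw [mulVec_diagonal]
  rw [h, dotProduct_congruence_mulVec, diagonal_transpose]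
  rfl

lemma posDef_precond {ι : Type} [Fintype ι] [DecidableEq ι] {A A₁ : Matrix ι ι ℝ}
    (hA : ∀ i, 0 < A i i) (hA₁ : A₁.PosDef) : (precond A A₁).PosDef := by
  refine .of_dotProduct_mulVec_pos (precond_isHermitian A hA₁.isHermitian) fun y hy => ?_
  rw [star_trivial, dotProduct_precond_mulVec]
  refine hA₁.dotProduct_pos fun h => hy ?_
  ext i
  have := congrFun h i
  have hpos : 0 < √(A i i / A₁ i i) := Real.sqrt_pos.mpr (div_pos (hA i) hA₁.diag_pos)
  simpa [hpos.ne'] using this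

lemma precond_smul {ι : Type} [Fintype ι] [DecidableEq ι] {γ : ℝ} (hγ : γ ≠ 0)
    (A A₁ : Matrix ι ι ℝ) : precond (γ • A) (γ • A₁) = γ • precond A A₁ := by
  ext i j
  rw [precond_apply, Matrix.smul_apply (A := precond A A₁), precond_apply]
  simp only [Matrix.smul_apply, smul_eq_mul, mul_div_mul_left _ _ hγ]
  ring

lemma dotProduct_smul_mulVec {ι : Type} [Fintype ι] (γ : ℝ) (A : Matrix ι ι ℝ) (y : ι → ℝ) :
    y ⬝ᵥ ((γ • A) *ᵥ y) = γ * (y ⬝ᵥ (A *ᵥ y)) := by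
  rw [smul_mulVec, dotProduct_smul, smul_eq_mul]

/-! ### Comparison of the matrix and the preconditioner -/

section Comparison

variable {M : ℕ} {q : (ℤ × ℤ) × Bool → ℝ} {α : ℤ × ℤ → ℝ} {C m₀ : ℝ}

lemma posDef_meshMatrix (hM : 1 ≤ M) (hm : 0 < m₀) (hq : ∀ K ∈ meshTriangles M, m₀ ≤ q K) :
    (meshMatrix M q).PosDef := by
  refine .of_dotProduct_mulVec_pos (meshMatrix_isHermitian M q) fun y hy => ?_
  have h1 := poincare_meshMatrix_one hM y
  have h2 : 0 < y ⬝ᵥ y := by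
    refine lt_of_le_of_ne ?_ fun h => hy (dotProduct_self_eq_zero.mp h.symm)
    simpa using dotProduct_star_self_nonneg y
  have h3 : 0 < y ⬝ᵥ (meshMatrix M (fun _ => 1) *ᵥ y) := by
    by_contra h
    have : 48 * (M : ℝ) ^ 2 * (y ⬝ᵥ (meshMatrix M (fun _ => 1) *ᵥ y)) ≤ 0 :=
      mul_nonpos_of_nonneg_of_nonpos (by positivity) (not_lt.mp h)
    linarith
  rw [star_trivial]
  refine lt_of_lt_of_le (mul_pos hm h3) ?_
  rw [dotProduct_meshMatrix_mulVec, dotProduct_meshMatrix_mulVec, Finset.mul_sum]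
  refine Finset.sum_le_sum fun K hK => ?_
  rw [one_mul]
  exact mul_le_mul_of_nonneg_right (hq K hK) (triEnergy_nonneg _ _)

lemma mul_form_one_le (hq : ∀ K ∈ meshTriangles M, m₀ ≤ q K) (y : innerNodes M → ℝ) :
    m₀ * (y ⬝ᵥ (meshMatrix M (fun _ => 1) *ᵥ y)) ≤ y ⬝ᵥ (meshMatrix M q *ᵥ y) := by
  rw [dotProduct_meshMatrix_mulVec, dotProduct_meshMatrix_mulVec, Finset.mul_sum]
  refine Finset.sum_le_sum fun K hK => ?_
  rw [one_mul]
  exact mul_le_mul_of_nonneg_right (hq K hK) (triEnergy_nonneg _ _)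

/-- The constant in the estimate of `A - P`: the bound for an entry, times `9`, which bounds the
number of nonzero entries in a row. -/
def errConst (C m₀ : ℝ) : ℝ := 9 * (2 * C + 2 * C ^ 2 / m₀)

lemma errConst_nonneg (hC : 0 ≤ C) (hm : 0 < m₀) : 0 ≤ errConst C m₀ := by
  unfold errConst; positivity

lemma abs_form_sub_precond_le (hM : 1 ≤ M) (hC : 0 ≤ C) (hm : 0 < m₀)
    (hq : ∀ K ∈ meshTriangles M, m₀ ≤ q K) (h : ApproxNodal M q α C ((M : ℝ)⁻¹))
    (y : innerNodes M → ℝ) :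
    |y ⬝ᵥ (meshMatrix M q *ᵥ y) -
      y ⬝ᵥ (precond (meshMatrix M q) (meshMatrix M fun _ => 1) *ᵥ y)| ≤
      errConst C m₀ * ((M : ℝ)⁻¹) ^ 2 * (y ⬝ᵥ y) := by
  have hM' : (1 : ℝ) ≤ M := by exact_mod_cast hM
  rw [← dotProduct_sub, ← sub_mulVec]
  refine abs_dotProduct_mulVec_le ((meshMatrix_isHermitian M q).sub
    (precond_isHermitian _ (meshMatrix_isHermitian M _))) (fun i => ?_) y
  refine (Finset.sum_le_sum fun j _ => abs_meshMatrix_sub_precond_le hC (by positivity)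
    (inv_le_one_of_one_le₀ hM') hm hq h i j).trans ?_
  rw [← Finset.sum_filter, Finset.sum_const, nsmul_eq_mul, errConst, mul_assoc]
  have := card_filter_neighbours_le i
  gcongr
  exact_mod_cast this

lemma mul_dotProduct_le_sqrt_diagRatio (hm : 0 < m₀) (hq : ∀ K ∈ meshTriangles M, m₀ ≤ q K)
    (y : innerNodes M → ℝ) :
    m₀ * (y ⬝ᵥ y) ≤ (fun i => √(diagRatio q i) * y i) ⬝ᵥ (fun i => √(diagRatio q i) * y i) := by
  simp only [dotProduct, Finset.mul_sum]
  refine Finset.sum_le_sum fun i _ => ?_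
  have h1 := le_diagRatio hq i
  have h2 := Real.mul_self_sqrt (hm.le.trans h1)
  calc m₀ * (y i * y i) ≤ diagRatio q i * (y i * y i) :=
        mul_le_mul_of_nonneg_right h1 (mul_self_nonneg _)
    _ = √(diagRatio q i) * √(diagRatio q i) * (y i * y i) := by rw [h2]
    _ = _ := by ring

/-- The form of `A - P` is `O(h²)`, no larger than the smallest eigenvalues of `A` and of `P`. -/
lemma formEquiv_meshMatrix (hM : 1 ≤ M) (hC : 0 ≤ C) (hm : 0 < m₀)
    (hq : ∀ K ∈ meshTriangles M, m₀ ≤ q K) (h : ApproxNodal M q α C ((M : ℝ)⁻¹)) :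
    FormEquiv (meshMatrix M q) (precond (meshMatrix M q) (meshMatrix M fun _ => 1))
      (1 + 48 * errConst C m₀ / m₀) := by
  intro y
  have hM' : (1 : ℝ) ≤ M := by exact_mod_cast hM
  have h1 := abs_le.mp (abs_form_sub_precond_le hM hC hm hq h y)
  have hE := errConst_nonneg hC hm
  have h2 : m₀ * (y ⬝ᵥ y) ≤ 48 * (M : ℝ) ^ 2 *
      (y ⬝ᵥ (precond (meshMatrix M q) (meshMatrix M fun _ => 1) *ᵥ y)) := by
    rw [dotProduct_precond_mulVec]
    exact (mul_dotProduct_le_sqrt_diagRatio hm hq y).trans (poincare_meshMatrix_one hM _)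
  have h3 : m₀ * (y ⬝ᵥ y) ≤ 48 * (M : ℝ) ^ 2 * (y ⬝ᵥ (meshMatrix M q *ᵥ y)) := by
    have := mul_form_one_le hq y
    have h4 := poincare_meshMatrix_one hM y
    calc m₀ * (y ⬝ᵥ y) ≤ m₀ * (48 * (M : ℝ) ^ 2 * (y ⬝ᵥ (meshMatrix M (fun _ => 1) *ᵥ y))) := by
          gcongr
      _ = 48 * (M : ℝ) ^ 2 * (m₀ * (y ⬝ᵥ (meshMatrix M (fun _ => 1) *ᵥ y))) := by ring
      _ ≤ _ := by gcongr
  have key : ∀ X : ℝ, m₀ * (y ⬝ᵥ y) ≤ 48 * (M : ℝ) ^ 2 * X →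
      errConst C m₀ * ((M : ℝ)⁻¹) ^ 2 * (y ⬝ᵥ y) ≤ 48 * errConst C m₀ / m₀ * X := by
    intro X hX
    calc errConst C m₀ * ((M : ℝ)⁻¹) ^ 2 * (y ⬝ᵥ y)
        = errConst C m₀ * ((M : ℝ)⁻¹) ^ 2 / m₀ * (m₀ * (y ⬝ᵥ y)) := by field_simp
      _ ≤ errConst C m₀ * ((M : ℝ)⁻¹) ^ 2 / m₀ * (48 * (M : ℝ) ^ 2 * X) := by gcongr
      _ = _ := by field_simp
  have k2 := key _ h2
  have k3 := key _ h3
  constructor <;> linarith [h1.1, h1.2]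

/-- On the common kernel of a number of functionals that does not depend on `M`, the matrix
`A - P` is small relative to `P`. -/
lemma abs_form_sub_precond_lt (hC : 0 ≤ C) (hm : 0 < m₀) {ε : ℝ}
    (hq : ∀ K ∈ meshTriangles M, m₀ ≤ q K) (h : ApproxNodal M q α C ((M : ℝ)⁻¹))
    {R : ℕ} (hR : 1 ≤ R) (hRM : R ≤ M) (hRε : 4 * errConst C m₀ < ε * (m₀ * (R : ℝ) ^ 2))
    {y : innerNodes M → ℝ} (hy : y ≠ 0)
    (hL : blockSums M (3 * R) (M / R + 1) (fun i => √(diagRatio q i) * y i) = 0) :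
    |y ⬝ᵥ (meshMatrix M q *ᵥ y) -
      y ⬝ᵥ (precond (meshMatrix M q) (meshMatrix M fun _ => 1) *ᵥ y)| <
      ε * (y ⬝ᵥ (precond (meshMatrix M q) (meshMatrix M fun _ => 1) *ᵥ y)) := by
  have hM : 1 ≤ M := hR.trans hRM
  have hM' : (1 : ℝ) ≤ M := by exact_mod_cast hM
  have hR' : (1 : ℝ) ≤ R := by exact_mod_cast hR
  have hE := errConst_nonneg hC hm
  refine (abs_form_sub_precond_le hM hC hm hq h y).trans_lt ?_
  have h1 := mul_dotProduct_le_sqrt_diagRatio hm hq y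
  have h2 := poincare_meshMatrix_one_of_blockSums hR hRM _ hL
  have hP : (precond (meshMatrix M q) (meshMatrix M fun _ => 1)).PosDef :=
    posDef_precond (fun i => (posDef_meshMatrix hM hm hq).diag_pos)
      (posDef_meshMatrix hM one_pos fun _ _ => le_rfl)
  have h3 := hP.dotProduct_pos hy
  have h4 : (R : ℝ) ^ 2 * (m₀ * (y ⬝ᵥ y)) ≤ 4 * (M : ℝ) ^ 2 *
      (y ⬝ᵥ (precond (meshMatrix M q) (meshMatrix M fun _ => 1) *ᵥ y)) := by
    rw [dotProduct_precond_mulVec]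
    exact (mul_le_mul_of_nonneg_left h1 (by positivity)).trans h2
  set X := y ⬝ᵥ (precond (meshMatrix M q) (meshMatrix M fun _ => 1) *ᵥ y)
  calc errConst C m₀ * ((M : ℝ)⁻¹) ^ 2 * (y ⬝ᵥ y)
      = errConst C m₀ * ((M : ℝ)⁻¹) ^ 2 / (m₀ * (R : ℝ) ^ 2) *
          ((R : ℝ) ^ 2 * (m₀ * (y ⬝ᵥ y))) := by field_simp
    _ ≤ errConst C m₀ * ((M : ℝ)⁻¹) ^ 2 / (m₀ * (R : ℝ) ^ 2) * (4 * (M : ℝ) ^ 2 * X) := by gcongr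
    _ = 4 * errConst C m₀ / (m₀ * (R : ℝ) ^ 2) * X := by field_simp
    _ < ε * X := by
        refine mul_lt_mul_of_pos_right ?_ h3
        rwa [div_lt_iff₀ (by positivity)]

end Comparison

/-- The clustering, the spectral equivalence and the optimality, for matrices that are proportional
to mesh matrices whose weights are approximated by nodal values. -/
theorem clustered_and_optimal_of_approxNodal
    {A A₁ : ∀ M, Matrix (innerNodes M) (innerNodes M) ℝ} {γ : ℕ → ℝ}
    {q : ℕ → (ℤ × ℤ) × Bool → ℝ} {α : ℕ → ℤ × ℤ → ℝ} {C m₀ : ℝ} {M₀ : ℕ}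
    (hγ : ∀ M, 1 ≤ M → 0 < γ M) (hA : ∀ M, 1 ≤ M → A M = γ M • meshMatrix M (q M))
    (hA₁ : ∀ M, 1 ≤ M → A₁ M = γ M • meshMatrix M fun _ => 1)
    (hpos : ∀ M, 1 ≤ M → (A M).PosDef) (hC : 0 ≤ C) (hm : 0 < m₀)
    (hq : ∀ M, 1 ≤ M → M₀ ≤ M → ∀ K ∈ meshTriangles M, m₀ ≤ q M K)
    (h : ∀ M, 1 ≤ M → ApproxNodal M (q M) (α M) C ((M : ℝ)⁻¹)) :
    (∀ M, 1 ≤ M → (precond (A M) (A₁ M)).PosDef) ∧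
    ProperlyClusteredAt (fun M => (precond (A M) (A₁ M))⁻¹ * A M) 1 ∧
    EigsInPositiveInterval (fun M => (precond (A M) (A₁ M))⁻¹ * A M) ∧
    PCGOptimal A (fun M => precond (A M) (A₁ M)) := by
  have hPeq : ∀ M, 1 ≤ M → precond (A M) (A₁ M) =
      γ M • precond (meshMatrix M (q M)) (meshMatrix M fun _ => 1) := fun M hM => by
    rw [hA M hM, hA₁ M hM, precond_smul (hγ M hM).ne']
  have hP : ∀ M, 1 ≤ M → (precond (A M) (A₁ M)).PosDef := fun M hM => by
    refine posDef_precond (fun i => (hpos M hM).diag_pos) ?_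
    rw [hA₁ M hM]
    exact (posDef_meshMatrix hM one_pos fun _ _ => le_rfl).smul (hγ M hM)
  obtain ⟨C', hC', hF⟩ := exists_uniform_formEquiv (A := A) (P := fun M => precond (A M) (A₁ M))
    hpos hP (M₀ := M₀) (C₀ := 1 + 48 * errConst C m₀ / m₀) fun M hM hM₀ y => by
      have := formEquiv_meshMatrix hM hC hm (hq M hM hM₀) (h M hM) y
      rw [hPeq M hM, hA M hM, dotProduct_smul_mulVec, dotProduct_smul_mulVec]
      constructor
      · rw [mul_left_comm]; exact mul_le_mul_of_nonneg_left this.1 (hγ M hM).le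
      · rw [mul_left_comm]; exact mul_le_mul_of_nonneg_left this.2 (hγ M hM).le
  refine ⟨hP, properlyClusteredAt_of_eventually fun ε hε => ?_,
    eigsInPositiveInterval_of_formEquiv hpos hP hC' hF, pcgOptimal_of_formEquiv hpos hP hC' hF⟩
  obtain ⟨R, hR⟩ := exists_nat_gt (max 1 (4 * errConst C m₀ / (ε * m₀)))
  have hR1 : (1 : ℝ) < R := (le_max_left _ _).trans_lt hR
  have hRε : 4 * errConst C m₀ < ε * (m₀ * (R : ℝ) ^ 2) := by
    have h1 := (le_max_right _ _).trans_lt hR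
    rw [div_lt_iff₀ (by positivity)] at h1
    have h2 : (R : ℝ) * (ε * m₀) ≤ (R : ℝ) ^ 2 * (ε * m₀) := by
      gcongr; nlinarith
    linarith
  have hR1' : 1 ≤ R := by exact_mod_cast hR1.le
  refine ⟨2 * Fintype.card (Fin (3 * R) × Fin (3 * R)), max R M₀, fun M hM hRM => ?_⟩
  let S : (innerNodes M → ℝ) →ₗ[ℝ] (innerNodes M → ℝ) :=
    (diagonal fun i => √(diagRatio (q M) i)).mulVecLin
  refine countP_eigs_le (hpos M hM).isHermitian (hP M hM)
    (blockSums M (3 * R) (M / R + 1) ∘ₗ S) fun y hL hy => ?_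
  have hS : S y = fun i => √(diagRatio (q M) i) * y i := by
    ext i; simp [S, mulVec_diagonal]
  rw [LinearMap.comp_apply, hS] at hL
  have := abs_form_sub_precond_lt hC hm (hq M hM ((le_max_right _ _).trans hRM)) (h M hM) hR1'
    ((le_max_left _ _).trans hRM) hRε hy hL
  rw [hPeq M hM, hA M hM, dotProduct_smul_mulVec, dotProduct_smul_mulVec, ← mul_sub, abs_mul,
    abs_of_pos (hγ M hM), mul_left_comm]
  exact mul_lt_mul_of_pos_left this (hγ M hM)

/-! ### Lattice coordinates in the plane -/

/-- The first vector of the basis dual to `dir θ`, `dir (θ + π / 3)`. -/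
def dualX (θ : ℝ) : Plane := !₂[Real.cos θ + Real.sin θ / √3, Real.sin θ - Real.cos θ / √3]

/-- The second vector of the basis dual to `dir θ`, `dir (θ + π / 3)`. -/
def dualY (θ : ℝ) : Plane := !₂[-(2 * Real.sin θ / √3), 2 * Real.cos θ / √3]

lemma plane_inner (v w : Plane) : inner ℝ v w = v 0 * w 0 + v 1 * w 1 := by
  simp [PiLp.inner_apply, Fin.sum_univ_two, mul_comm]

lemma sqrt_three_sq : √3 ^ 2 = (3 : ℝ) := Real.sq_sqrt (by norm_num)

lemma sqrt_three_pos : (0 : ℝ) < √3 := Real.sqrt_pos.mpr (by norm_num)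

lemma dir_add_pi_div_three (θ : ℝ) : dir (θ + Real.pi / 3) =
    !₂[Real.cos θ / 2 - Real.sin θ * √3 / 2, Real.sin θ / 2 + Real.cos θ * √3 / 2] := by
  simp only [dir, Real.cos_add, Real.sin_add, Real.cos_pi_div_three, Real.sin_pi_div_three]
  congr 1
  ext i
  fin_cases i <;> simp <;> ring

lemma inner_dir_pi_div_two (θ : ℝ) (v : Plane) :
    inner ℝ v (dir (θ + Real.pi / 2)) = √3 / 2 * inner ℝ (dualY θ) v := by
  have h := sqrt_three_pos
  rw [plane_inner, plane_inner]
  simp only [dir, Real.cos_add_pi_div_two, Real.sin_add_pi_div_two, dualY]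
  simp
  field_simp

lemma inner_dir_five_pi_div_six (θ : ℝ) (v : Plane) :
    inner ℝ v (dir (θ + 5 * Real.pi / 6)) = -(√3 / 2 * inner ℝ (dualX θ) v) := by
  have h := sqrt_three_pos
  have e : θ + 5 * Real.pi / 6 = θ + (Real.pi - Real.pi / 6) := by ring
  rw [plane_inner, plane_inner, e]
  simp only [dir, Real.cos_add, Real.sin_add, Real.cos_pi_sub, Real.sin_pi_sub,
    Real.cos_pi_div_six, Real.sin_pi_div_six, dualX]
  simp
  field_simp
  ring

lemma inner_dir_pi_div_six (θ : ℝ) (v : Plane) :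
    inner ℝ v (dir (θ + Real.pi / 6)) =
      √3 / 2 * (inner ℝ (dualX θ) v + inner ℝ (dualY θ) v) := by
  have h := sqrt_three_pos
  have h3 := sqrt_three_sq
  rw [plane_inner, plane_inner, plane_inner]
  simp only [dir, Real.cos_add, Real.sin_add, Real.cos_pi_div_six, Real.sin_pi_div_six, dualX,
    dualY]
  simp
  field_simp
  ring

/-- The hexagonal norm in lattice coordinates. -/
lemma hexNorm_eq (θ : ℝ) (v : Plane) :
    hexNorm θ v = max |inner ℝ (dualX θ) v + inner ℝ (dualY θ) v|
      (max |inner ℝ (dualY θ) v| |inner ℝ (dualX θ) v|) := by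
  have h := sqrt_three_pos
  rw [hexNorm, inner_dir_pi_div_six, inner_dir_pi_div_two, inner_dir_five_pi_div_six, abs_neg,
    abs_mul, abs_mul, abs_mul, abs_of_pos (show 0 < √3 / 2 by positivity),
    ← mul_max_of_nonneg _ _ (show 0 ≤ √3 / 2 by positivity),
    ← mul_max_of_nonneg _ _ (show 0 ≤ √3 / 2 by positivity), ← mul_assoc,
    show 2 / √3 * (√3 / 2) = 1 by field_simp, one_mul]

section Dual
variable (θ : ℝ)

lemma inner_dualX_dir : inner ℝ (dualX θ) (dir θ) = 1 := by
  rw [plane_inner]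
  simp [dualX, dir]
  have := Real.cos_sq_add_sin_sq θ
  ring_nf; linarith

lemma inner_dualY_dir : inner ℝ (dualY θ) (dir θ) = 0 := by
  rw [plane_inner]
  simp [dualY, dir]
  ring

lemma inner_dualX_dir' : inner ℝ (dualX θ) (dir (θ + Real.pi / 3)) = 0 := by
  have h := sqrt_three_pos
  have h3 := sqrt_three_sq
  rw [plane_inner, dir_add_pi_div_three]
  simp [dualX]
  field_simp
  ring_nf

lemma inner_dualY_dir' : inner ℝ (dualY θ) (dir (θ + Real.pi / 3)) = 1 := by
  have h := sqrt_three_pos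
  rw [plane_inner, dir_add_pi_div_three]
  simp [dualY]
  have := Real.cos_sq_add_sin_sq θ
  field_simp
  linear_combination √3 * this

lemma inner_dualX_self : inner ℝ (dualX θ) (dualX θ) = (4 / 3 : ℝ) := by
  have h := sqrt_three_pos
  have h3 := sqrt_three_sq
  have := Real.cos_sq_add_sin_sq θ
  rw [plane_inner]
  simp [dualX]
  field_simp
  ring_nf
  simp only [h3]; linear_combination 12 * this

lemma inner_dualY_self : inner ℝ (dualY θ) (dualY θ) = (4 / 3 : ℝ) := by
  have h := sqrt_three_pos
  have h3 := sqrt_three_sq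
  have := Real.cos_sq_add_sin_sq θ
  rw [plane_inner]
  simp [dualY]
  field_simp
  ring_nf
  simp only [h3]; linear_combination 12 * this

lemma inner_dualX_dualY : inner ℝ (dualX θ) (dualY θ) = (-(2 / 3) : ℝ) := by
  have h := sqrt_three_pos
  have h3 := sqrt_three_sq
  have := Real.cos_sq_add_sin_sq θ
  rw [plane_inner]
  simp [dualX, dualY]
  field_simp
  ring_nf
  simp only [h3]; linear_combination (-3) * this

lemma eq_smul_dir_add (v : Plane) :
    v = (inner ℝ (dualX θ) v : ℝ) • dir θ + (inner ℝ (dualY θ) v : ℝ) • dir (θ + Real.pi / 3) := by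
  have h := sqrt_three_pos
  have h3 := sqrt_three_sq
  have := Real.cos_sq_add_sin_sq θ
  rw [plane_inner, plane_inner, dir_add_pi_div_three]
  ext i
  fin_cases i
  · simp [dualX, dualY, dir]
    field_simp
    linear_combination (-v 0 * √3) * this
  · simp [dualX, dualY, dir]
    field_simp
    linear_combination (-v 1 * √3) * this

end Dual

/-! ### The triangles of the mesh in lattice coordinates -/

/-- The first lattice coordinate of a point, for the lattice with mesh size `h` and origin `c`. -/
def coordX (c : Plane) (h θ : ℝ) (p : Plane) : ℝ := inner ℝ (dualX θ) (p - c) / h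

/-- The second lattice coordinate of a point, for the lattice with mesh size `h` and origin `c`. -/
def coordY (c : Plane) (h θ : ℝ) (p : Plane) : ℝ := inner ℝ (dualY θ) (p - c) / h

lemma meshSize_pos {ℓ : ℝ} (hℓ : 0 < ℓ) {M : ℕ} (hM : 1 ≤ M) : 0 < meshSize ℓ M :=
  div_pos hℓ (by exact_mod_cast hM)

lemma inner_dualX_node_sub (c : Plane) (ℓ θ : ℝ) (M : ℕ) (s : ℤ × ℤ) :
    inner ℝ (dualX θ) (node c ℓ θ M s - c) = meshSize ℓ M * s.1 := by
  simp only [node, add_sub_cancel_left, inner_smul_right, inner_add_right, inner_dualX_dir,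
    inner_dualX_dir']
  ring

lemma inner_dualY_node_sub (c : Plane) (ℓ θ : ℝ) (M : ℕ) (s : ℤ × ℤ) :
    inner ℝ (dualY θ) (node c ℓ θ M s - c) = meshSize ℓ M * s.2 := by
  simp only [node, add_sub_cancel_left, inner_smul_right, inner_add_right, inner_dualY_dir,
    inner_dualY_dir']
  ring

/-- The triangle with vertices `0`, `dir θ` and `dir (θ + π / 3)`. -/
def refTri (θ : ℝ) : Set Plane := convexHull ℝ {0, dir θ, dir (θ + Real.pi / 3)}

lemma mem_refTri {θ : ℝ} {v : Plane} : v ∈ refTri θ ↔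
    0 ≤ inner ℝ (dualX θ) v ∧ 0 ≤ inner ℝ (dualY θ) v ∧
      inner ℝ (dualX θ) v + inner ℝ (dualY θ) v ≤ 1 := by
  constructor
  · intro h
    have hconv : Convex ℝ {v : Plane | 0 ≤ inner ℝ (dualX θ) v ∧ 0 ≤ inner ℝ (dualY θ) v ∧
        inner ℝ (dualX θ) v + inner ℝ (dualY θ) v ≤ 1} := by
      rintro x ⟨hx1, hx2, hx3⟩ y ⟨hy1, hy2, hy3⟩ a b ha hb hab
      simp only [Set.mem_ofPred_eq, inner_add_right, inner_smul_right]
      refine ⟨by positivity, by positivity, ?_⟩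
      nlinarith [mul_le_mul_of_nonneg_left hx3 ha, mul_le_mul_of_nonneg_left hy3 hb]
    refine convexHull_min ?_ hconv h
    rintro w (rfl | rfl | rfl)
    · simp
    · simp [inner_dualX_dir, inner_dualY_dir]
    · simp [inner_dualX_dir', inner_dualY_dir']
  · rintro ⟨h1, h2, h3⟩
    have := (convex_convexHull ℝ {0, dir θ, dir (θ + Real.pi / 3)}).sum_mem
      (t := Finset.univ) (w := ![1 - inner ℝ (dualX θ) v - inner ℝ (dualY θ) v,
        inner ℝ (dualX θ) v, inner ℝ (dualY θ) v]) (z := ![0, dir θ, dir (θ + Real.pi / 3)])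
      (by intro i _; fin_cases i <;> simp <;> linarith)
      (by rw [Fin.sum_univ_three]; simp; ring)
      (by intro i _; apply subset_convexHull; fin_cases i <;> simp)
    rw [Fin.sum_univ_three] at this
    simp only [Matrix.cons_val_zero, Matrix.cons_val_one, Matrix.cons_val, smul_zero,
      zero_add] at this
    rw [← eq_smul_dir_add] at this
    exact this

/-- The vertex of the triangle `K` opposite to the edge of direction `dir (θ + 2 * π / 3)`. -/
def apex (K : (ℤ × ℤ) × Bool) : ℤ × ℤ := if K.2 then K.1 + (1, 1) else K.1

/-- The sign that tells the orientation of the triangle `K`: `1` for a translate of the reference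
triangle and `-1` for a reflected one. -/
def orient (K : (ℤ × ℤ) × Bool) : ℝ := if K.2 then -1 else 1

lemma orient_ne_zero (K : (ℤ × ℤ) × Bool) : orient K ≠ 0 := by
  unfold orient; split_ifs <;> norm_num

/-- Every mesh triangle is a homothetic image of the reference triangle. -/
lemma tri_eq_image (c : Plane) (ℓ θ : ℝ) (M : ℕ) (K : (ℤ × ℤ) × Bool) :
    tri c ℓ θ M K =
      (fun v => node c ℓ θ M (apex K) + (orient K * meshSize ℓ M) • v) '' refTri θ := by
  have h := (AffineMap.const ℝ Plane (node c ℓ θ M (apex K)) +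
    ((orient K * meshSize ℓ M) • (LinearMap.id : Plane →ₗ[ℝ] Plane)).toAffineMap).image_convexHull
      {0, dir θ, dir (θ + Real.pi / 3)}
  refine Eq.trans ?_ h.symm
  rw [tri]
  congr 1
  obtain ⟨⟨a, b⟩, o⟩ := K
  cases o
  · have e0 : node c ℓ θ M (a, b) = node c ℓ θ M (a, b) +
        (1 * meshSize ℓ M) • (0 : Plane) := by simp
    have e1 : node c ℓ θ M ((a, b) + (1, 0)) = node c ℓ θ M (a, b) +
        (1 * meshSize ℓ M) • dir θ := by
      simp only [node, Prod.mk_add_mk]; push_cast; module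
    have e2 : node c ℓ θ M ((a, b) + (0, 1)) = node c ℓ θ M (a, b) +
        (1 * meshSize ℓ M) • dir (θ + Real.pi / 3) := by
      simp only [node, Prod.mk_add_mk]; push_cast; module
    simp only [triVertices, apex, orient, Bool.false_eq_true, if_false,
      Finset.coe_insert, Finset.coe_singleton, Set.image_insert_eq, Set.image_singleton]
    change _ = ({node c ℓ θ M (a, b) + (1 * meshSize ℓ M) • (0 : Plane),
      node c ℓ θ M (a, b) + (1 * meshSize ℓ M) • dir θ,
      node c ℓ θ M (a, b) + (1 * meshSize ℓ M) • dir (θ + Real.pi / 3)} : Set Plane)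
    rw [← e0, ← e1, ← e2]
  · have e0 : node c ℓ θ M ((a, b) + (1, 1)) = node c ℓ θ M ((a, b) + (1, 1)) +
        (-1 * meshSize ℓ M) • (0 : Plane) := by simp
    have e1 : node c ℓ θ M ((a, b) + (0, 1)) = node c ℓ θ M ((a, b) + (1, 1)) +
        (-1 * meshSize ℓ M) • dir θ := by
      simp only [node, Prod.mk_add_mk]; push_cast; module
    have e2 : node c ℓ θ M ((a, b) + (1, 0)) = node c ℓ θ M ((a, b) + (1, 1)) +
        (-1 * meshSize ℓ M) • dir (θ + Real.pi / 3) := by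
      simp only [node, Prod.mk_add_mk]; push_cast; module
    simp only [triVertices, apex, orient, if_true,
      Finset.coe_insert, Finset.coe_singleton, Set.image_insert_eq, Set.image_singleton]
    change _ = ({node c ℓ θ M ((a, b) + (1, 1)) + (-1 * meshSize ℓ M) • (0 : Plane),
      node c ℓ θ M ((a, b) + (1, 1)) + (-1 * meshSize ℓ M) • dir θ,
      node c ℓ θ M ((a, b) + (1, 1)) + (-1 * meshSize ℓ M) • dir (θ + Real.pi / 3)} : Set Plane)
    rw [← e0, ← e1, ← e2, Set.pair_comm]

/-- The open triangle coded by `K`, in lattice coordinates. -/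
def openTri (c : Plane) (h θ : ℝ) (K : (ℤ × ℤ) × Bool) : Set Plane :=
  {p | if K.2 then coordX c h θ p < K.1.1 + 1 ∧ coordY c h θ p < K.1.2 + 1 ∧
        (K.1.1 : ℝ) + K.1.2 + 1 < coordX c h θ p + coordY c h θ p
      else (K.1.1 : ℝ) < coordX c h θ p ∧ (K.1.2 : ℝ) < coordY c h θ p ∧
        coordX c h θ p + coordY c h θ p < K.1.1 + K.1.2 + 1}

lemma mem_tri {c : Plane} {ℓ θ : ℝ} {M : ℕ} (hh : 0 < meshSize ℓ M) {K : (ℤ × ℤ) × Bool}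
    {p : Plane} : p ∈ tri c ℓ θ M K ↔
      if K.2 then coordX c (meshSize ℓ M) θ p ≤ K.1.1 + 1 ∧ coordY c (meshSize ℓ M) θ p ≤ K.1.2 + 1 ∧
        (K.1.1 : ℝ) + K.1.2 + 1 ≤ coordX c (meshSize ℓ M) θ p + coordY c (meshSize ℓ M) θ p
      else (K.1.1 : ℝ) ≤ coordX c (meshSize ℓ M) θ p ∧ (K.1.2 : ℝ) ≤ coordY c (meshSize ℓ M) θ p ∧
        coordX c (meshSize ℓ M) θ p + coordY c (meshSize ℓ M) θ p ≤ K.1.1 + K.1.2 + 1 := by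
  have hk : orient K * meshSize ℓ M ≠ 0 := mul_ne_zero (orient_ne_zero K) hh.ne'
  have h1 : p ∈ tri c ℓ θ M K ↔
      (orient K * meshSize ℓ M)⁻¹ • (p - node c ℓ θ M (apex K)) ∈ refTri θ := by
    rw [tri_eq_image]
    constructor
    · rintro ⟨v, hv, rfl⟩
      rwa [add_sub_cancel_left, smul_smul, inv_mul_cancel₀ hk, one_smul]
    · intro h
      exact ⟨_, h, by
        simp only [smul_smul, mul_inv_cancel₀ hk, one_smul, add_sub_cancel]⟩
  have hx : inner ℝ (dualX θ) (p - node c ℓ θ M (apex K)) =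
      meshSize ℓ M * (coordX c (meshSize ℓ M) θ p - (apex K).1) := by
    rw [← sub_sub_sub_cancel_right p _ c, inner_sub_right, inner_dualX_node_sub, coordX]
    field_simp
  have hy : inner ℝ (dualY θ) (p - node c ℓ θ M (apex K)) =
      meshSize ℓ M * (coordY c (meshSize ℓ M) θ p - (apex K).2) := by
    rw [← sub_sub_sub_cancel_right p _ c, inner_sub_right, inner_dualY_node_sub, coordY]
    field_simp
  rw [h1, mem_refTri, inner_smul_right, inner_smul_right, hx, hy, mul_inv, mul_assoc, mul_assoc,
    inv_mul_cancel_left₀ hh.ne', inv_mul_cancel_left₀ hh.ne']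
  obtain ⟨⟨a, b⟩, o⟩ := K
  cases o <;> simp [orient, apex]
  · intro _ _; constructor <;> intro h <;> linarith
  · intro _ _; constructor <;> intro h <;> linarith

lemma mem_meshTriangles_false {M : ℕ} {s : ℤ × ℤ} : (s, false) ∈ meshTriangles M ↔
    -(M : ℤ) ≤ s.1 ∧ s.1 + 1 ≤ M ∧ -(M : ℤ) ≤ s.2 ∧ s.2 + 1 ≤ M ∧
      -(M : ℤ) ≤ s.1 + s.2 ∧ s.1 + s.2 + 1 ≤ M := by
  obtain ⟨a, b⟩ := s
  simp only [meshTriangles, Finset.mem_filter, Finset.mem_product, Finset.mem_Icc,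
    Finset.mem_univ, and_true, triVertices, Finset.insert_subset_iff, Finset.singleton_subset_iff,
    mem_meshNodes, abs_le]
  simp
  omega

lemma mem_meshTriangles_true {M : ℕ} {s : ℤ × ℤ} : (s, true) ∈ meshTriangles M ↔
    -(M : ℤ) ≤ s.1 ∧ s.1 + 1 ≤ M ∧ -(M : ℤ) ≤ s.2 ∧ s.2 + 1 ≤ M ∧
      -(M : ℤ) ≤ s.1 + s.2 + 1 ∧ s.1 + s.2 + 2 ≤ M := by
  obtain ⟨a, b⟩ := s
  simp only [meshTriangles, Finset.mem_filter, Finset.mem_product, Finset.mem_Icc,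
    Finset.mem_univ, and_true, triVertices, Finset.insert_subset_iff, Finset.singleton_subset_iff,
    mem_meshNodes, abs_le]
  simp
  omega

lemma continuous_coordX (c : Plane) (h θ : ℝ) : Continuous (coordX c h θ) := by
  unfold coordX; fun_prop

lemma continuous_coordY (c : Plane) (h θ : ℝ) : Continuous (coordY c h θ) := by
  unfold coordY; fun_prop

lemma isOpen_openTri (c : Plane) (h θ : ℝ) (K : (ℤ × ℤ) × Bool) : IsOpen (openTri c h θ K) := by
  have hX := continuous_coordX c h θ
  have hY := continuous_coordY c h θ
  obtain ⟨s, o⟩ := K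
  cases o
  · simp only [openTri, Bool.false_eq_true, if_false]
    exact (isOpen_lt continuous_const hX).inter ((isOpen_lt continuous_const hY).inter
      (isOpen_lt (hX.add hY) continuous_const))
  · simp only [openTri, if_true]
    exact (isOpen_lt hX continuous_const).inter ((isOpen_lt hY continuous_const).inter
      (isOpen_lt continuous_const (hX.add hY)))

lemma openTri_subset_tri {c : Plane} {ℓ θ : ℝ} {M : ℕ} (hh : 0 < meshSize ℓ M)
    (K : (ℤ × ℤ) × Bool) : openTri c (meshSize ℓ M) θ K ⊆ tri c ℓ θ M K := by
  intro p hp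
  rw [mem_tri hh]
  obtain ⟨s, o⟩ := K
  cases o
  · simp only [openTri, Bool.false_eq_true, if_false] at hp ⊢
    exact ⟨hp.1.le, hp.2.1.le, hp.2.2.le⟩
  · simp only [openTri, if_true] at hp ⊢
    exact ⟨hp.1.le, hp.2.1.le, hp.2.2.le⟩

/-- Almost no point lies on a line of the lattice with normal `g`. -/
lemma ae_inner_div_ne_int {g : Plane} (hg : g ≠ 0) (c : Plane) {h : ℝ} (hh : 0 < h) :
    ∀ᵐ p : Plane, ∀ n : ℤ, inner ℝ g (p - c) / h ≠ n := by
  have hsurj : Function.Surjective (innerSL ℝ g).toLinearMap := by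
    intro t
    refine ⟨(t / inner ℝ g g) • g, ?_⟩
    have : inner ℝ g g ≠ (0 : ℝ) := inner_self_ne_zero.mpr hg
    simp only [ContinuousLinearMap.coe_coe, innerSL_apply_apply, inner_smul_right]
    field_simp
  have hcount : (Set.range fun n : ℤ => (inner ℝ g c + h * n : ℝ)).Countable :=
    Set.countable_range _
  have key := (ae_comp_linearMap_mem_iff (innerSL ℝ g).toLinearMap (volume : Measure Plane)
    (volume : Measure ℝ) hsurj hcount.measurableSet.compl).mpr (hcount.ae_notMem volume)
  filter_upwards [key] with p hp n hn
  apply hp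
  refine ⟨n, ?_⟩
  change inner ℝ g c + h * (n : ℝ) = _
  rw [← hn, inner_sub_right]
  simp only [ContinuousLinearMap.coe_coe, innerSL_apply_apply]
  field_simp
  ring

lemma ae_coord_ne_int (c : Plane) {h : ℝ} (hh : 0 < h) (θ : ℝ) :
    ∀ᵐ p : Plane, ∀ n : ℤ, coordX c h θ p ≠ n ∧ coordY c h θ p ≠ n ∧
      coordX c h θ p + coordY c h θ p ≠ n := by
  have hX : dualX θ ≠ 0 := fun h0 => by
    have := inner_dualX_self θ; rw [h0, inner_zero_left] at this; norm_num at this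
  have hY : dualY θ ≠ 0 := fun h0 => by
    have := inner_dualY_self θ; rw [h0, inner_zero_left] at this; norm_num at this
  have hXY : dualX θ + dualY θ ≠ 0 := fun h0 => by
    have h1 : inner ℝ (dualX θ) (dualX θ + dualY θ) = (2 / 3 : ℝ) := by
      rw [inner_add_right, inner_dualX_self, inner_dualX_dualY]; norm_num
    rw [h0, inner_zero_right] at h1; norm_num at h1
  filter_upwards [ae_inner_div_ne_int hX c hh, ae_inner_div_ne_int hY c hh,
    ae_inner_div_ne_int hXY c hh] with p h1 h2 h3 n
  refine ⟨h1 n, h2 n, ?_⟩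
  have := h3 n
  rwa [inner_add_left, add_div] at this

lemma openTri_ae_eq_tri {c : Plane} {ℓ θ : ℝ} {M : ℕ} (hh : 0 < meshSize ℓ M)
    (K : (ℤ × ℤ) × Bool) :
    openTri c (meshSize ℓ M) θ K =ᵐ[volume] tri c ℓ θ M K := by
  filter_upwards [ae_coord_ne_int c hh θ] with p hp
  refine propext ⟨fun h => openTri_subset_tri hh K h, fun h => ?_⟩
  have h' := (mem_tri hh).mp h
  obtain ⟨s, o⟩ := K
  have e1 := hp s.1
  have e2 := hp s.2
  have e3 := hp (s.1 + 1)
  have e4 := hp (s.2 + 1)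
  have e5 := hp (s.1 + s.2 + 1)
  push_cast at e3 e4 e5
  cases o
  · simp only [Bool.false_eq_true, if_false] at h'
    change p ∈ openTri c (meshSize ℓ M) θ (s, false)
    simp only [openTri, Bool.false_eq_true, if_false, Set.mem_ofPred_eq]
    exact ⟨lt_of_le_of_ne h'.1 e1.1.symm, lt_of_le_of_ne h'.2.1 e2.2.1.symm,
      lt_of_le_of_ne h'.2.2 e5.2.2⟩
  · simp only [if_true] at h'
    change p ∈ openTri c (meshSize ℓ M) θ (s, true)
    simp only [openTri, if_true, Set.mem_ofPred_eq]
    exact ⟨lt_of_le_of_ne h'.1 e3.1, lt_of_le_of_ne h'.2.1 e4.2.1,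
      lt_of_le_of_ne h'.2.2 e5.2.2.symm⟩

lemma hexNorm_sub_eq (c : Plane) {h : ℝ} (hh : 0 < h) (θ : ℝ) (p : Plane) :
    hexNorm θ (p - c) = h * max |coordX c h θ p + coordY c h θ p|
      (max |coordY c h θ p| |coordX c h θ p|) := by
  rw [hexNorm_eq, coordX, coordY, mul_max_of_nonneg _ _ hh.le, mul_max_of_nonneg _ _ hh.le,
    ← abs_of_pos hh, ← abs_mul, ← abs_mul, ← abs_mul, abs_of_pos hh, mul_add,
    mul_div_cancel₀ _ hh.ne', mul_div_cancel₀ _ hh.ne']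

lemma mem_hexagon_iff {c : Plane} {ℓ θ : ℝ} {M : ℕ} (hM : 1 ≤ M) (hh : 0 < meshSize ℓ M)
    {p : Plane} : p ∈ hexagon c ℓ θ ↔
      |coordX c (meshSize ℓ M) θ p + coordY c (meshSize ℓ M) θ p| < M ∧
        |coordY c (meshSize ℓ M) θ p| < M ∧ |coordX c (meshSize ℓ M) θ p| < M := by
  have hM0 : (M : ℝ) ≠ 0 := by positivity
  have hl : ℓ = meshSize ℓ M * M := by rw [meshSize]; field_simp
  have : p ∈ hexagon c ℓ θ ↔ hexNorm θ (p - c) < ℓ := Iff.rfl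
  rw [this, hexNorm_sub_eq c hh]
  conv_lhs => rw [hl]
  rw [show meshSize (meshSize ℓ M * ↑M) M = meshSize ℓ M by rw [← hl],
    mul_lt_mul_iff_right₀ hh, max_lt_iff, max_lt_iff]

lemma mem_closedHexagon_iff {c : Plane} {ℓ θ : ℝ} {M : ℕ} (hM : 1 ≤ M) (hh : 0 < meshSize ℓ M)
    {p : Plane} : p ∈ closedHexagon c ℓ θ ↔
      |coordX c (meshSize ℓ M) θ p + coordY c (meshSize ℓ M) θ p| ≤ M ∧
        |coordY c (meshSize ℓ M) θ p| ≤ M ∧ |coordX c (meshSize ℓ M) θ p| ≤ M := by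
  have hM0 : (M : ℝ) ≠ 0 := by positivity
  have hl : ℓ = meshSize ℓ M * M := by rw [meshSize]; field_simp
  have : p ∈ closedHexagon c ℓ θ ↔ hexNorm θ (p - c) ≤ ℓ := Iff.rfl
  rw [this, hexNorm_sub_eq c hh]
  conv_lhs => rw [hl]
  rw [show meshSize (meshSize ℓ M * ↑M) M = meshSize ℓ M by rw [← hl],
    mul_le_mul_iff_right₀ hh, max_le_iff, max_le_iff]

lemma tri_subset_closedHexagon {c : Plane} {ℓ θ : ℝ} {M : ℕ} (hM : 1 ≤ M)
    (hh : 0 < meshSize ℓ M) {K : (ℤ × ℤ) × Bool} (hK : K ∈ meshTriangles M) :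
    tri c ℓ θ M K ⊆ closedHexagon c ℓ θ := by
  intro p hp
  rw [mem_tri hh] at hp
  rw [mem_closedHexagon_iff hM hh]
  obtain ⟨s, o⟩ := K
  simp only [abs_le]
  cases o
  · simp only [Bool.false_eq_true, if_false] at hp
    rw [mem_meshTriangles_false] at hK
    obtain ⟨h1, h2, h3, h4, h5, h6⟩ := hK
    rify at h1 h2 h3 h4 h5 h6
    refine ⟨⟨?_, ?_⟩, ⟨?_, ?_⟩, ⟨?_, ?_⟩⟩ <;> linarith [hp.1, hp.2.1, hp.2.2]
  · simp only [if_true] at hp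
    rw [mem_meshTriangles_true] at hK
    obtain ⟨h1, h2, h3, h4, h5, h6⟩ := hK
    rify at h1 h2 h3 h4 h5 h6
    refine ⟨⟨?_, ?_⟩, ⟨?_, ?_⟩, ⟨?_, ?_⟩⟩ <;> linarith [hp.1, hp.2.1, hp.2.2]

lemma openTri_subset_hexagon {c : Plane} {ℓ θ : ℝ} {M : ℕ} (hM : 1 ≤ M)
    (hh : 0 < meshSize ℓ M) {K : (ℤ × ℤ) × Bool} (hK : K ∈ meshTriangles M) :
    openTri c (meshSize ℓ M) θ K ⊆ hexagon c ℓ θ := by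
  intro p hp
  rw [mem_hexagon_iff hM hh]
  obtain ⟨s, o⟩ := K
  simp only [abs_lt]
  cases o
  · simp only [openTri, Bool.false_eq_true, if_false, Set.mem_ofPred_eq] at hp
    rw [mem_meshTriangles_false] at hK
    obtain ⟨h1, h2, h3, h4, h5, h6⟩ := hK
    rify at h1 h2 h3 h4 h5 h6
    refine ⟨⟨?_, ?_⟩, ⟨?_, ?_⟩, ⟨?_, ?_⟩⟩ <;> linarith [hp.1, hp.2.1, hp.2.2]
  · simp only [openTri, if_true, Set.mem_ofPred_eq] at hp
    rw [mem_meshTriangles_true] at hK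
    obtain ⟨h1, h2, h3, h4, h5, h6⟩ := hK
    rify at h1 h2 h3 h4 h5 h6
    refine ⟨⟨?_, ?_⟩, ⟨?_, ?_⟩, ⟨?_, ?_⟩⟩ <;> linarith [hp.1, hp.2.1, hp.2.2]

lemma pairwise_disjoint_openTri (c : Plane) (h θ : ℝ) :
    Pairwise (Function.onFun Disjoint (openTri c h θ)) := by
  intro K K' hne
  rw [Function.onFun, Set.disjoint_left]
  intro p hp hp'
  apply hne
  obtain ⟨⟨a, b⟩, o⟩ := K
  obtain ⟨⟨a', b'⟩, o'⟩ := K'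
  have key : ∀ m n : ℤ, (m : ℝ) < n + 1 → m ≤ n := fun m n h => by
    have : m < n + 1 := by exact_mod_cast h
    omega
  cases o <;> cases o' <;>
    simp only [openTri, Bool.false_eq_true, if_false, if_true, Set.mem_ofPred_eq] at hp hp' <;>
    obtain ⟨h1, h2, h3⟩ := hp <;> obtain ⟨h1', h2', h3'⟩ := hp'
  · have := key a a' (by linarith)
    have := key a' a (by linarith)
    have := key b b' (by linarith)
    have := key b' b (by linarith)
    simp only [Prod.mk.injEq, and_true]; omega
  · exfalso
    have := key a a' (by linarith)
    have := key a' a (by linarith)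
    have := key b b' (by linarith)
    have := key b' b (by linarith)
    have ha : a = a' := by omega
    have hb : b = b' := by omega
    subst ha hb
    linarith
  · exfalso
    have := key a a' (by linarith)
    have := key a' a (by linarith)
    have := key b b' (by linarith)
    have := key b' b (by linarith)
    have ha : a = a' := by omega
    have hb : b = b' := by omega
    subst ha hb
    linarith
  · have := key a a' (by linarith)
    have := key a' a (by linarith)
    have := key b b' (by linarith)
    have := key b' b (by linarith)
    simp only [Prod.mk.injEq, and_true]; omega

/-- Up to a null set, the hexagon is the union of the open triangles of the mesh. -/
lemma hexagon_ae_eq {c : Plane} {ℓ θ : ℝ} {M : ℕ} (hM : 1 ≤ M) (hh : 0 < meshSize ℓ M) :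
    hexagon c ℓ θ =ᵐ[volume] ⋃ K ∈ meshTriangles M, openTri c (meshSize ℓ M) θ K := by
  filter_upwards [ae_coord_ne_int c hh θ] with p hp
  refine propext ⟨fun h => ?_, fun h => ?_⟩
  · have h' := (mem_hexagon_iff hM hh).mp h
    change p ∈ ⋃ K ∈ meshTriangles M, openTri c (meshSize ℓ M) θ K
    simp only [Set.mem_iUnion]
    set x := coordX c (meshSize ℓ M) θ p with hx
    set y := coordY c (meshSize ℓ M) θ p with hy
    have x1 : (⌊x⌋ : ℝ) < x := lt_of_le_of_ne (Int.floor_le x) (hp _).1.symm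
    have x2 := Int.lt_floor_add_one x
    have y1 : (⌊y⌋ : ℝ) < y := lt_of_le_of_ne (Int.floor_le y) (hp _).2.1.symm
    have y2 := Int.lt_floor_add_one y
    simp only [abs_lt] at h'
    obtain ⟨⟨h1, h2⟩, ⟨h3, h4⟩, ⟨h5, h6⟩⟩ := h'
    have b1 : (-(M : ℤ)) < ⌊x⌋ + 1 := by exact_mod_cast h5.trans x2
    have b2 : ⌊x⌋ < (M : ℤ) := by exact_mod_cast x1.trans h6
    have b3 : (-(M : ℤ)) < ⌊y⌋ + 1 := by exact_mod_cast h3.trans y2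
    have b4 : ⌊y⌋ < (M : ℤ) := by exact_mod_cast y1.trans h4
    have hne := (hp (⌊x⌋ + ⌊y⌋ + 1)).2.2
    push_cast at hne
    rcases lt_or_gt_of_ne hne with hlt | hgt
    · have b5 : (-(M : ℤ)) < ⌊x⌋ + ⌊y⌋ + 1 := by exact_mod_cast h1.trans hlt
      have b6 : ⌊x⌋ + ⌊y⌋ < (M : ℤ) := by exact_mod_cast (add_lt_add x1 y1).trans h2
      refine ⟨((⌊x⌋, ⌊y⌋), false), mem_meshTriangles_false.mpr (by simp only; omega), ?_⟩
      simp only [openTri, Bool.false_eq_true, if_false, Set.mem_ofPred_eq]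
      exact ⟨x1, y1, hlt⟩
    · have b5 : (-(M : ℤ)) < (⌊x⌋ + 1) + (⌊y⌋ + 1) := by
        exact_mod_cast h1.trans (add_lt_add x2 y2)
      have b6 : ⌊x⌋ + ⌊y⌋ + 1 < (M : ℤ) := by exact_mod_cast hgt.trans h2
      refine ⟨((⌊x⌋, ⌊y⌋), true), mem_meshTriangles_true.mpr (by simp only; omega), ?_⟩
      simp only [openTri, if_true, Set.mem_ofPred_eq]
      exact ⟨x2, y2, hgt⟩
  · have h' : p ∈ ⋃ K ∈ meshTriangles M, openTri c (meshSize ℓ M) θ K := h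
    simp only [Set.mem_iUnion] at h'
    obtain ⟨K, hK, hp'⟩ := h'
    exact openTri_subset_hexagon hM hh hK hp'

/-- The open triangles are used in place of the closed ones because the hat functions need not
be differentiable on the edges. -/
lemma setIntegral_hexagon_eq_sum {c : Plane} {ℓ θ : ℝ} {M : ℕ} (hM : 1 ≤ M)
    (hh : 0 < meshSize ℓ M) {f : Plane → ℝ}
    (hf : ∀ K ∈ meshTriangles M, IntegrableOn f (openTri c (meshSize ℓ M) θ K)) :
    ∫ x in hexagon c ℓ θ, f x = ∑ K ∈ meshTriangles M, ∫ x in openTri c (meshSize ℓ M) θ K, f x := by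
  rw [setIntegral_congr_set (hexagon_ae_eq hM hh), integral_biUnion_finset]
  · exact fun K _ => (isOpen_openTri _ _ _ K).measurableSet
  · exact (pairwise_disjoint_openTri _ _ _).set_pairwise _
  · exact hf

/-! ### Gradients of the hat functions and entries of the stiffness matrices -/

/-- The gradient, multiplied by the mesh size, of the hat function of the node `s` on the
triangle `K`. -/
def gradVec (θ : ℝ) (K : (ℤ × ℤ) × Bool) (s : ℤ × ℤ) : Plane :=
  if s = apex K then -orient K • (dualX θ + dualY θ)
  else if s = K.1 + (1, 0) then (if K.2 then -dualY θ else dualX θ)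
  else if s = K.1 + (0, 1) then (if K.2 then -dualX θ else dualY θ)
  else 0

lemma inner_gradVec (θ : ℝ) (K : (ℤ × ℤ) × Bool) (s t : ℤ × ℤ) :
    inner ℝ (gradVec θ K s) (gradVec θ K t) = 2 / 3 * triCoef K s t := by
  have hXX := inner_dualX_self θ
  have hYY := inner_dualY_self θ
  have hXY := inner_dualX_dualY θ
  have hYX : inner ℝ (dualY θ) (dualX θ) = (-(2 / 3) : ℝ) := by rw [real_inner_comm, hXY]
  by_cases hs : s ∈ triVertices K
  · by_cases ht : t ∈ triVertices K
    · obtain ⟨⟨a, b⟩, o⟩ := K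
      cases o <;>
      · simp only [triVertices, Finset.mem_insert, Finset.mem_singleton] at hs ht
        rcases hs with rfl | rfl | rfl <;> rcases ht with rfl | rfl | rfl <;>
          simp [gradVec, triCoef, triVertices, apex, orient, inner_add_left, inner_add_right,
            inner_neg_left, inner_neg_right, hXX, hYY, hXY, hYX,
            -inner_self_eq_norm_sq_to_K] <;> norm_num
    · have : gradVec θ K t = 0 := by
        simp only [triVertices, Finset.mem_insert, Finset.mem_singleton, not_or] at ht
        simp [gradVec, apex, ht.1, ht.2.1, ht.2.2]
      simp [this, triCoef, ht]
  · have : gradVec θ K s = 0 := by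
      simp only [triVertices, Finset.mem_insert, Finset.mem_singleton, not_or] at hs
      simp [gradVec, apex, hs.1, hs.2.1, hs.2.2]
    simp [this, triCoef, hs]

lemma hat_eq {c : Plane} {ℓ θ : ℝ} {M : ℕ} (hh : 0 < meshSize ℓ M) (s : ℤ × ℤ) (p : Plane) :
    hat c ℓ θ M s p = max 0 (1 - max
      |(coordX c (meshSize ℓ M) θ p - s.1) + (coordY c (meshSize ℓ M) θ p - s.2)|
      (max |coordY c (meshSize ℓ M) θ p - s.2| |coordX c (meshSize ℓ M) θ p - s.1|)) := by
  have hx : coordX (node c ℓ θ M s) (meshSize ℓ M) θ p = coordX c (meshSize ℓ M) θ p - s.1 := by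
    rw [coordX, coordX, ← sub_sub_sub_cancel_right p _ c, inner_sub_right, inner_dualX_node_sub]
    field_simp
  have hy : coordY (node c ℓ θ M s) (meshSize ℓ M) θ p = coordY c (meshSize ℓ M) θ p - s.2 := by
    rw [coordY, coordY, ← sub_sub_sub_cancel_right p _ c, inner_sub_right, inner_dualY_node_sub]
    field_simp
  rw [hat, hexNorm_sub_eq _ hh, mul_div_cancel_left₀ _ hh.ne', hx, hy]

lemma max_zero_one_sub_of_eq {x y z : ℝ} (hz : z ≤ 1) (h1 : |x + y| ≤ z) (h2 : |y| ≤ z)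
    (h3 : |x| ≤ z) (h : |x + y| = z ∨ |y| = z ∨ |x| = z) :
    max 0 (1 - max |x + y| (max |y| |x|)) = 1 - z := by
  have : max |x + y| (max |y| |x|) = z := by
    refine le_antisymm (max_le h1 (max_le h2 h3)) ?_
    rcases h with h | h | h <;> simp [h]
  rw [this, max_eq_right (by linarith)]

lemma max_zero_one_sub_of_le {x y : ℝ} (h : 1 ≤ |x + y| ∨ 1 ≤ |y| ∨ 1 ≤ |x|) :
    max 0 (1 - max |x + y| (max |y| |x|)) = 0 := by
  have : 1 ≤ max |x + y| (max |y| |x|) := by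
    rcases h with h | h | h <;> simp [h]
  rw [max_eq_left (by linarith)]

/-- The hat functions are affine on the triangles. -/
lemma exists_hat_eq_on_openTri (c : Plane) {ℓ : ℝ} (θ : ℝ) {M : ℕ} (hh : 0 < meshSize ℓ M)
    (s : ℤ × ℤ) (K : (ℤ × ℤ) × Bool) :
    ∃ k : ℝ, ∀ p ∈ openTri c (meshSize ℓ M) θ K,
      hat c ℓ θ M s p = k + inner ℝ (gradVec θ K s) (p - c) / meshSize ℓ M := by
  obtain ⟨⟨a, b⟩, o⟩ := K
  obtain ⟨m, n⟩ := s
  cases o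
  · by_cases h0 : (m, n) = (a, b)
    · obtain ⟨rfl, rfl⟩ := Prod.mk.inj h0
      refine ⟨1 + m + n, fun p hp => ?_⟩
      simp only [openTri, Bool.false_eq_true, if_false, Set.mem_ofPred_eq] at hp
      obtain ⟨h1, h2, h3⟩ := hp
      have hg : inner ℝ (gradVec θ ((m, n), false) (m, n)) (p - c) / meshSize ℓ M =
          -(coordX c (meshSize ℓ M) θ p + coordY c (meshSize ℓ M) θ p) := by
        simp [gradVec, apex, orient, coordX, coordY, inner_add_left, inner_neg_left]; ring
      rw [hg, hat_eq hh, max_zero_one_sub_of_eq (z := (coordX c (meshSize ℓ M) θ p - m) +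
        (coordY c (meshSize ℓ M) θ p - n))]
      · ring
      · linarith
      · rw [abs_of_nonneg (by linarith)]
      · rw [abs_of_nonneg (by linarith)]; linarith
      · rw [abs_of_nonneg (by linarith)]; linarith
      · exact Or.inl (abs_of_nonneg (by linarith))
    by_cases h1 : (m, n) = (a + 1, b)
    · obtain ⟨rfl, rfl⟩ := Prod.mk.inj h1
      refine ⟨-a, fun p hp => ?_⟩
      simp only [openTri, Bool.false_eq_true, if_false, Set.mem_ofPred_eq] at hp
      obtain ⟨h1, h2, h3⟩ := hp
      have hg : inner ℝ (gradVec θ ((a, n), false) (a + 1, n)) (p - c) / meshSize ℓ M =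
          coordX c (meshSize ℓ M) θ p := by
        simp [gradVec, apex, coordX]
      rw [hg, hat_eq hh, max_zero_one_sub_of_eq (z := -(coordX c (meshSize ℓ M) θ p - (a + 1 : ℤ)))]
      · push_cast; ring
      · push_cast; linarith
      · push_cast; rw [abs_le]; constructor <;> linarith
      · push_cast; rw [abs_le]; constructor <;> linarith
      · rw [abs_of_nonpos (by push_cast; linarith)]
      · exact Or.inr (Or.inr (abs_of_nonpos (by push_cast; linarith)))
    by_cases h2 : (m, n) = (a, b + 1)
    · obtain ⟨rfl, rfl⟩ := Prod.mk.inj h2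
      refine ⟨-b, fun p hp => ?_⟩
      simp only [openTri, Bool.false_eq_true, if_false, Set.mem_ofPred_eq] at hp
      obtain ⟨h1, h2, h3⟩ := hp
      have hg : inner ℝ (gradVec θ ((m, b), false) (m, b + 1)) (p - c) / meshSize ℓ M =
          coordY c (meshSize ℓ M) θ p := by
        simp [gradVec, apex, coordY]
      rw [hg, hat_eq hh, max_zero_one_sub_of_eq (z := -(coordY c (meshSize ℓ M) θ p - (b + 1 : ℤ)))]
      · push_cast; ring
      · push_cast; linarith
      · push_cast; rw [abs_le]; constructor <;> linarith
      · rw [abs_of_nonpos (by push_cast; linarith)]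
      · push_cast; rw [abs_le]; constructor <;> linarith
      · exact Or.inr (Or.inl (abs_of_nonpos (by push_cast; linarith)))
    · refine ⟨0, fun p hp => ?_⟩
      simp only [openTri, Bool.false_eq_true, if_false, Set.mem_ofPred_eq] at hp
      obtain ⟨e1, e2, e3⟩ := hp
      have hg : gradVec θ ((a, b), false) (m, n) = 0 := by
        simp only [Prod.mk.injEq] at h0 h1 h2
        simp [gradVec, apex, h0, h1, h2]
      rw [hg, inner_zero_left, zero_div, add_zero, hat_eq hh, max_zero_one_sub_of_le]
      simp only [Prod.mk.injEq] at h0 h1 h2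
      have cases : m ≤ a - 1 ∨ a + 2 ≤ m ∨ n ≤ b - 1 ∨ b + 2 ≤ n ∨ (m = a + 1 ∧ n = b + 1) := by
        omega
      rcases cases with h | h | h | h | ⟨rfl, rfl⟩
      · rify at h
        refine Or.inr (Or.inr (le_abs.mpr (Or.inl ?_))); linarith
      · rify at h
        refine Or.inr (Or.inr (le_abs.mpr (Or.inr ?_))); linarith
      · rify at h
        refine Or.inr (Or.inl (le_abs.mpr (Or.inl ?_))); linarith
      · rify at h
        refine Or.inr (Or.inl (le_abs.mpr (Or.inr ?_))); linarith
      · push_cast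
        refine Or.inl (le_abs.mpr (Or.inr ?_)); linarith
  · by_cases h0 : (m, n) = (a + 1, b + 1)
    · obtain ⟨rfl, rfl⟩ := Prod.mk.inj h0
      refine ⟨-1 - a - b, fun p hp => ?_⟩
      simp only [openTri, if_true, Set.mem_ofPred_eq] at hp
      obtain ⟨h1, h2, h3⟩ := hp
      have hg : inner ℝ (gradVec θ ((a, b), true) (a + 1, b + 1)) (p - c) / meshSize ℓ M =
          coordX c (meshSize ℓ M) θ p + coordY c (meshSize ℓ M) θ p := by
        simp [gradVec, apex, orient, coordX, coordY, inner_add_left]; ring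
      rw [hg, hat_eq hh, max_zero_one_sub_of_eq
        (z := -((coordX c (meshSize ℓ M) θ p - (a + 1 : ℤ)) +
          (coordY c (meshSize ℓ M) θ p - (b + 1 : ℤ))))]
      · push_cast; ring
      · push_cast; linarith
      · rw [abs_of_nonpos (by push_cast; linarith)]
      · rw [abs_of_nonpos (by push_cast; linarith)]; push_cast; linarith
      · rw [abs_of_nonpos (by push_cast; linarith)]; push_cast; linarith
      · exact Or.inl (abs_of_nonpos (by push_cast; linarith))
    by_cases h1 : (m, n) = (a + 1, b)
    · obtain ⟨rfl, rfl⟩ := Prod.mk.inj h1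
      refine ⟨1 + n, fun p hp => ?_⟩
      simp only [openTri, if_true, Set.mem_ofPred_eq] at hp
      obtain ⟨h1, h2, h3⟩ := hp
      have hg : inner ℝ (gradVec θ ((a, n), true) (a + 1, n)) (p - c) / meshSize ℓ M =
          -coordY c (meshSize ℓ M) θ p := by
        simp [gradVec, apex, coordY, inner_neg_left, neg_div]
      rw [hg, hat_eq hh, max_zero_one_sub_of_eq (z := coordY c (meshSize ℓ M) θ p - n)]
      · ring
      · linarith
      · push_cast; rw [abs_le]; constructor <;> linarith
      · rw [abs_of_nonneg (by linarith)]
      · push_cast; rw [abs_le]; constructor <;> linarith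
      · exact Or.inr (Or.inl (abs_of_nonneg (by linarith)))
    by_cases h2 : (m, n) = (a, b + 1)
    · obtain ⟨rfl, rfl⟩ := Prod.mk.inj h2
      refine ⟨1 + m, fun p hp => ?_⟩
      simp only [openTri, if_true, Set.mem_ofPred_eq] at hp
      obtain ⟨h1, h2, h3⟩ := hp
      have hg : inner ℝ (gradVec θ ((m, b), true) (m, b + 1)) (p - c) / meshSize ℓ M =
          -coordX c (meshSize ℓ M) θ p := by
        simp [gradVec, apex, coordX, inner_neg_left, neg_div]
      rw [hg, hat_eq hh, max_zero_one_sub_of_eq (z := coordX c (meshSize ℓ M) θ p - m)]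
      · ring
      · linarith
      · push_cast; rw [abs_le]; constructor <;> linarith
      · push_cast; rw [abs_le]; constructor <;> linarith
      · rw [abs_of_nonneg (by linarith)]
      · exact Or.inr (Or.inr (abs_of_nonneg (by linarith)))
    · refine ⟨0, fun p hp => ?_⟩
      simp only [openTri, if_true, Set.mem_ofPred_eq] at hp
      obtain ⟨e1, e2, e3⟩ := hp
      have hg : gradVec θ ((a, b), true) (m, n) = 0 := by
        simp only [Prod.mk.injEq] at h0 h1 h2
        simp [gradVec, apex, h0, h1, h2]
      rw [hg, inner_zero_left, zero_div, add_zero, hat_eq hh, max_zero_one_sub_of_le]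
      simp only [Prod.mk.injEq] at h0 h1 h2
      have cases : m ≤ a - 1 ∨ a + 2 ≤ m ∨ n ≤ b - 1 ∨ b + 2 ≤ n ∨ (m = a ∧ n = b) := by
        omega
      rcases cases with h | h | h | h | ⟨rfl, rfl⟩
      · rify at h
        refine Or.inr (Or.inr (le_abs.mpr (Or.inl ?_))); linarith
      · rify at h
        refine Or.inr (Or.inr (le_abs.mpr (Or.inr ?_))); linarith
      · rify at h
        refine Or.inr (Or.inl (le_abs.mpr (Or.inl ?_))); linarith
      · rify at h
        refine Or.inr (Or.inl (le_abs.mpr (Or.inr ?_))); linarith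
      · refine Or.inl (le_abs.mpr (Or.inl ?_)); linarith

lemma gradient_hat_of_mem_openTri {c : Plane} {ℓ θ : ℝ} {M : ℕ} (hh : 0 < meshSize ℓ M)
    (s : ℤ × ℤ) {K : (ℤ × ℤ) × Bool} {p : Plane} (hp : p ∈ openTri c (meshSize ℓ M) θ K) :
    gradient (hat c ℓ θ M s) p = (meshSize ℓ M)⁻¹ • gradVec θ K s := by
  obtain ⟨k, hk⟩ := exists_hat_eq_on_openTri c θ hh s K
  apply HasGradientAt.gradient
  have h1 : HasGradientAt
      (fun p => k + inner ℝ (gradVec θ K s) (p - c) / meshSize ℓ M)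
      ((meshSize ℓ M)⁻¹ • gradVec θ K s) p := by
    rw [hasGradientAt_iff_hasFDerivAt]
    have h2 : HasFDerivAt (fun p : Plane => innerSL ℝ (gradVec θ K s) (p - c))
        (innerSL ℝ (gradVec θ K s)) p :=
      (innerSL ℝ (gradVec θ K s)).hasFDerivAt.comp p ((hasFDerivAt_id p).sub_const c)
    have h3 := (h2.mul_const (meshSize ℓ M)⁻¹).const_add k
    have e : InnerProductSpace.toDual ℝ Plane ((meshSize ℓ M)⁻¹ • gradVec θ K s) =
        (meshSize ℓ M)⁻¹ • innerSL ℝ (gradVec θ K s) := by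
      ext v; simp
    rw [e]
    simpa only [div_eq_mul_inv, innerSL_apply_apply] using h3
  refine h1.congr_of_eventuallyEq ?_
  filter_upwards [(isOpen_openTri c (meshSize ℓ M) θ K).mem_nhds hp] with p' hp'
  exact hk p' hp'

lemma inner_gradient_hat_of_mem_openTri {c : Plane} {ℓ θ : ℝ} {M : ℕ} (hh : 0 < meshSize ℓ M)
    (s t : ℤ × ℤ) {K : (ℤ × ℤ) × Bool} {p : Plane} (hp : p ∈ openTri c (meshSize ℓ M) θ K) :
    inner ℝ (gradient (hat c ℓ θ M s) p) (gradient (hat c ℓ θ M t) p) =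
      2 / 3 * ((meshSize ℓ M)⁻¹) ^ 2 * triCoef K t s := by
  rw [gradient_hat_of_mem_openTri hh s hp, gradient_hat_of_mem_openTri hh t hp, inner_smul_left,
    inner_smul_right, inner_gradVec, triCoef_comm]
  simp
  ring

open scoped Pointwise in
/-- Change of variables from a mesh triangle to the reference triangle. -/
lemma setIntegral_tri {c : Plane} {ℓ θ : ℝ} {M : ℕ} (hh : 0 < meshSize ℓ M)
    (K : (ℤ × ℤ) × Bool) (f : Plane → ℝ) :
    ∫ x in tri c ℓ θ M K, f x = meshSize ℓ M ^ 2 *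
      ∫ v in refTri θ, f (node c ℓ θ M (apex K) + (orient K * meshSize ℓ M) • v) := by
  have hk : orient K * meshSize ℓ M ≠ 0 := mul_ne_zero (orient_ne_zero K) hh.ne'
  have h1 := Measure.setIntegral_comp_smul (volume : Measure Plane)
    (fun x => f (node c ℓ θ M (apex K) + x)) (refTri θ) hk
  have h2 := (measurePreserving_add_left (volume : Measure Plane)
    (node c ℓ θ M (apex K))).setIntegral_preimage_emb (measurableEmbedding_addLeft _) f
      (tri c ℓ θ M K)
  have h3 : (fun x => node c ℓ θ M (apex K) + x) ⁻¹' tri c ℓ θ M K =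
      (orient K * meshSize ℓ M) • refTri θ := by
    rw [tri_eq_image]
    ext x
    simp [Set.mem_smul_set]
  have ho : orient K ^ 2 = 1 := by unfold orient; split_ifs <;> norm_num
  rw [h1, ← h3, h2, finrank_euclideanSpace_fin, mul_pow, ho, one_mul, abs_of_pos (by positivity),
    smul_eq_mul, mul_inv_cancel_left₀ (by positivity)]

lemma isCompact_refTri (θ : ℝ) : IsCompact (refTri θ) :=
  Set.Finite.isCompact_convexHull ℝ (by simp)

lemma measureReal_refTri_pos (θ : ℝ) : 0 < volume.real (refTri θ) := by
  have hopen : IsOpen {v : Plane | 0 < inner ℝ (dualX θ) v ∧ 0 < inner ℝ (dualY θ) v ∧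
      inner ℝ (dualX θ) v + inner ℝ (dualY θ) v < 1} :=
    (isOpen_lt (g := fun v : Plane => inner ℝ (dualX θ) v) continuous_const (by fun_prop)).inter
      ((isOpen_lt (g := fun v : Plane => inner ℝ (dualY θ) v) continuous_const
        (by fun_prop)).inter (isOpen_lt
          (f := fun v : Plane => inner ℝ (dualX θ) v + inner ℝ (dualY θ) v) (by fun_prop)
          continuous_const))
  have hne : {v : Plane | 0 < inner ℝ (dualX θ) v ∧ 0 < inner ℝ (dualY θ) v ∧
      inner ℝ (dualX θ) v + inner ℝ (dualY θ) v < 1}.Nonempty := by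
    refine ⟨(1 / 3 : ℝ) • dir θ + (1 / 3 : ℝ) • dir (θ + Real.pi / 3), ?_⟩
    simp only [Set.mem_ofPred_eq, inner_add_right, inner_smul_right, inner_dualX_dir,
      inner_dualX_dir', inner_dualY_dir, inner_dualY_dir']
    norm_num
  rw [measureReal_def, ENNReal.toReal_pos_iff]
  refine ⟨(hopen.measure_pos volume hne).trans_le (measure_mono fun v hv => ?_),
    (isCompact_refTri θ).measure_lt_top⟩
  exact mem_refTri.mpr ⟨hv.1.le, hv.2.1.le, hv.2.2.le⟩

lemma measureReal_tri {c : Plane} {ℓ θ : ℝ} {M : ℕ} (hh : 0 < meshSize ℓ M)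
    (K : (ℤ × ℤ) × Bool) :
    volume.real (tri c ℓ θ M K) = meshSize ℓ M ^ 2 * volume.real (refTri θ) := by
  have := setIntegral_tri (c := c) (θ := θ) hh K (fun _ => 1)
  simpa using this

/-- The mean value on a mesh triangle as a mean value on the reference triangle. -/
lemma setAverage_tri {c : Plane} {ℓ θ : ℝ} {M : ℕ} (hh : 0 < meshSize ℓ M)
    (K : (ℤ × ℤ) × Bool) (f : Plane → ℝ) :
    ⨍ x in tri c ℓ θ M K, f x =
      ⨍ v in refTri θ, f (node c ℓ θ M (apex K) + (orient K * meshSize ℓ M) • v) := by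
  have h := measureReal_refTri_pos θ
  rw [setAverage_eq, setAverage_eq, measureReal_tri hh, setIntegral_tri hh, smul_eq_mul,
    smul_eq_mul]
  field_simp

/-- The common factor of the stiffness matrix and the mesh matrix. -/
def stiffFactor (θ : ℝ) : ℝ := 2 / 3 * volume.real (refTri θ)

lemma stiffFactor_pos (θ : ℝ) : 0 < stiffFactor θ :=
  mul_pos (by norm_num) (measureReal_refTri_pos θ)

theorem quadStiffness_eq (c : Plane) {ℓ : ℝ} (hℓ : 0 < ℓ) (θ : ℝ) {M : ℕ} (hM : 1 ≤ M)
    (q : (ℤ × ℤ) × Bool → ℝ) :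
    quadStiffness c ℓ θ M q = stiffFactor θ • meshMatrix M q := by
  have hh := meshSize_pos hℓ hM
  ext i j
  simp only [quadStiffness, meshMatrix, Matrix.of_apply, Matrix.smul_apply, smul_eq_mul,
    Finset.mul_sum]
  refine Finset.sum_congr rfl fun K _ => ?_
  rw [← setIntegral_congr_set (openTri_ae_eq_tri hh K),
    setIntegral_congr_fun (isOpen_openTri _ _ _ K).measurableSet
      fun p hp => inner_gradient_hat_of_mem_openTri hh _ _ hp,
    setIntegral_const, measureReal_congr (openTri_ae_eq_tri hh K), measureReal_tri hh, stiffFactor,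
    smul_eq_mul]
  field_simp

lemma integrableOn_tri {c : Plane} {ℓ θ : ℝ} (hℓ : 0 < ℓ) {a : Plane → ℝ}
    (ha : ContinuousOn a (closedHexagon c ℓ θ)) {M : ℕ} (hM : 1 ≤ M) {K : (ℤ × ℤ) × Bool}
    (hK : K ∈ meshTriangles M) : IntegrableOn a (tri c ℓ θ M K) := by
  refine (ha.mono (tri_subset_closedHexagon hM (meshSize_pos hℓ hM) hK)).integrableOn_compact ?_
  exact Set.Finite.isCompact_convexHull ℝ ((Finset.finite_toSet _).image _)

/-- Exact integration amounts to the quadrature with the mean values on the triangles. -/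
theorem stiffness_eq (c : Plane) {ℓ : ℝ} (hℓ : 0 < ℓ) (θ : ℝ) {a : Plane → ℝ}
    (ha : ContinuousOn a (closedHexagon c ℓ θ)) {M : ℕ} (hM : 1 ≤ M) :
    stiffness c ℓ θ a M = stiffFactor θ • meshMatrix M fun K => ⨍ x in tri c ℓ θ M K, a x := by
  have hh := meshSize_pos hℓ hM
  have hr := measureReal_refTri_pos θ
  have heq : ∀ (i j : innerNodes M) (K : (ℤ × ℤ) × Bool), Set.EqOn
      (fun x => a x * inner ℝ (gradient (hat c ℓ θ M j) x) (gradient (hat c ℓ θ M i) x))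
      (fun x => a x * (2 / 3 * ((meshSize ℓ M)⁻¹) ^ 2 * triCoef K i j))
      (openTri c (meshSize ℓ M) θ K) := fun i j K x hx => by
    simp only [inner_gradient_hat_of_mem_openTri hh _ _ hx]
  ext i j
  simp only [stiffness, meshMatrix, Matrix.of_apply, Matrix.smul_apply, smul_eq_mul,
    Finset.mul_sum]
  rw [setIntegral_hexagon_eq_sum hM hh]
  · refine Finset.sum_congr rfl fun K _ => ?_
    rw [setIntegral_congr_fun (isOpen_openTri _ _ _ K).measurableSet (heq i j K),
      integral_mul_const, setIntegral_congr_set (openTri_ae_eq_tri hh K), setAverage_eq,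
      measureReal_tri hh, stiffFactor, smul_eq_mul]
    field_simp
  · intro K hK
    rw [integrableOn_congr_fun (heq i j K) (isOpen_openTri _ _ _ K).measurableSet]
    exact ((integrableOn_tri hℓ ha hM hK).mono_set (openTri_subset_tri hh K)).mul_const _

/-! ### Second differences and mean values of the coefficient -/

section Taylor

variable {E F : Type*} [NormedAddCommGroup E] [NormedSpace ℝ E] [NormedAddCommGroup F]
  [NormedSpace ℝ F] {S : Set E}

lemma exists_norm_sub_le_of_contDiffOn_one (hS : Convex ℝ S) (hc : IsCompact S)
    (hu : UniqueDiffOn ℝ S) {g : E → F} (hg : ContDiffOn ℝ 1 g S) :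
    ∃ C : ℝ, 0 ≤ C ∧ ∀ x ∈ S, ∀ y ∈ S, ‖g y - g x‖ ≤ C * ‖y - x‖ := by
  obtain ⟨C, hC⟩ := hc.exists_bound_of_continuousOn (hg.continuousOn_fderivWithin hu le_rfl)
  refine ⟨|C|, abs_nonneg C, fun x hx y hy => ?_⟩
  exact hS.norm_image_sub_le_of_norm_fderivWithin_le (hg.differentiableOn one_ne_zero)
    (fun z hz => (hC z hz).trans (le_abs_self C)) hx hy

/-- A `C²` function on a compact convex set is Lipschitz and has second differences of second
order. -/
lemma exists_second_difference_le (hS : Convex ℝ S) (hc : IsCompact S) (hu : UniqueDiffOn ℝ S)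
    {a : E → ℝ} (ha : ContDiffOn ℝ 2 a S) :
    ∃ C : ℝ, 0 ≤ C ∧ (∀ x ∈ S, ∀ y ∈ S, |a y - a x| ≤ C * ‖y - x‖) ∧
      ∀ m ∈ S, ∀ w, m + w ∈ S → m - w ∈ S → |a (m + w) + a (m - w) - 2 * a m| ≤ C * ‖w‖ ^ 2 := by
  obtain ⟨C₁, hC₁, h1⟩ := exists_norm_sub_le_of_contDiffOn_one hS hc hu (ha.of_le one_le_two)
  obtain ⟨C₂, hC₂, h2⟩ := exists_norm_sub_le_of_contDiffOn_one hS hc hu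
    (ha.fderivWithin hu (m := 1) (by norm_num))
  have taylor : ∀ m ∈ S, ∀ v, m + v ∈ S →
      |a (m + v) - a m - fderivWithin ℝ a S m v| ≤ C₂ * ‖v‖ ^ 2 := by
    intro m hm v hv
    have hseg : segment ℝ m (m + v) ⊆ S := hS.segment_subset hm hv
    have := (convex_segment m (m + v)).norm_image_sub_le_of_norm_hasFDerivWithin_le'
      (f := a) (f' := fderivWithin ℝ a S) (φ := fderivWithin ℝ a S m) (C := C₂ * ‖v‖)
      (fun z hz => ((ha.differentiableOn two_ne_zero) z (hseg hz)).hasFDerivWithinAt.mono hseg)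
      (fun z hz => (h2 m hm z (hseg hz)).trans (by
        have := norm_sub_le_of_mem_segment hz
        rw [add_sub_cancel_left] at this
        gcongr))
      (left_mem_segment ℝ m (m + v)) (right_mem_segment ℝ m (m + v))
    rw [add_sub_cancel_left] at this
    rw [← Real.norm_eq_abs]
    linarith
  refine ⟨C₁ + 2 * C₂, by positivity, fun x hx y hy => ?_, fun m hm w hw hw' => ?_⟩
  · refine (h1 x hx y hy).trans ?_
    gcongr; linarith
  · have e1 := abs_le.mp (taylor m hm w hw)
    have e2 := abs_le.mp (taylor m hm (-w) (by rwa [← sub_eq_add_neg]))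
    rw [map_neg, norm_neg, ← sub_eq_add_neg] at e2
    have e3 : 0 ≤ C₁ * ‖w‖ ^ 2 := by positivity
    rw [abs_le]
    constructor <;> linarith [e1.1, e1.2, e2.1, e2.2]

end Taylor

lemma abs_setAverage_add_sub_le {α : Type*} [MeasurableSpace α] {μ : Measure α} {s : Set α}
    (hs : 0 < μ.real s) {f g : α → ℝ} (hf : IntegrableOn f s μ)
    (hg : IntegrableOn g s μ) {k B : ℝ} (h : ∀ x ∈ s, |f x + g x - k| ≤ B) :
    |(⨍ x in s, f x ∂μ) + (⨍ x in s, g x ∂μ) - k| ≤ B := by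
  have hfin : μ s < ⊤ := by
    by_contra h0
    rw [not_lt, top_le_iff] at h0
    simp [measureReal_def, h0] at hs
  have hk : IntegrableOn (fun _ => k) s μ := integrableOn_const hfin.ne
  have h1 : (⨍ x in s, f x ∂μ) + (⨍ x in s, g x ∂μ) - k =
      (μ.real s)⁻¹ * ∫ x in s, (f x + g x - k) ∂μ := by
    have e1 : ∫ x in s, (f x + g x - k) ∂μ = ∫ x in s, (f x + g x) ∂μ - ∫ _ in s, k ∂μ :=
      integral_sub (hf.add hg) hk
    rw [e1, integral_add hf hg, setAverage_eq, setAverage_eq,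
      setIntegral_const, smul_eq_mul, smul_eq_mul, smul_eq_mul]
    field_simp
  have h2 := norm_setIntegral_le_of_norm_le_const hfin (f := fun x => f x + g x - k) h
  rw [h1, abs_mul, abs_of_pos (inv_pos.mpr hs), inv_mul_le_iff₀ hs, mul_comm]
  exact h2

lemma le_setAverage {α : Type*} [MeasurableSpace α] {μ : Measure α} {s : Set α}
    (hs : 0 < μ.real s) (hms : MeasurableSet s) {f : α → ℝ} (hf : IntegrableOn f s μ)
    {k : ℝ} (h : ∀ x ∈ s, k ≤ f x) : k ≤ ⨍ x in s, f x ∂μ := by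
  have hfin : μ s < ⊤ := by
    by_contra h0
    rw [not_lt, top_le_iff] at h0
    simp [measureReal_def, h0] at hs
  have h1 := setIntegral_mono_on (integrableOn_const hfin.ne) hf hms h
  rw [setIntegral_const, smul_eq_mul] at h1
  rw [setAverage_eq, smul_eq_mul, le_inv_mul_iff₀ hs]
  exact h1

/-! ### Approximation of the mean values by nodal values -/

section Hexagon

variable {c : Plane} {ℓ θ : ℝ}

lemma convex_tri (M : ℕ) (K : (ℤ × ℤ) × Bool) : Convex ℝ (tri c ℓ θ M K) := convex_convexHull ℝ _

lemma node_mem_tri {M : ℕ} {K : (ℤ × ℤ) × Bool} {s : ℤ × ℤ} (hs : s ∈ triVertices K) :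
    node c ℓ θ M s ∈ tri c ℓ θ M K :=
  subset_convexHull ℝ _ ⟨s, by simpa using hs, rfl⟩

lemma norm_dir (t : ℝ) : ‖dir t‖ = 1 := by
  rw [EuclideanSpace.norm_eq]
  simp [dir, Fin.sum_univ_two]

lemma norm_le_one_of_mem_refTri {v : Plane} (hv : v ∈ refTri θ) : ‖v‖ ≤ 1 := by
  have h : refTri θ ⊆ Metric.closedBall 0 1 := by
    refine convexHull_min ?_ (convex_closedBall 0 1)
    rintro w (rfl | rfl | rfl) <;> simp [norm_dir]
  simpa using h hv

lemma norm_sub_le_of_mem_tri {M : ℕ} (hh : 0 < meshSize ℓ M) {K : (ℤ × ℤ) × Bool} {x y : Plane}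
    (hx : x ∈ tri c ℓ θ M K) (hy : y ∈ tri c ℓ θ M K) : ‖x - y‖ ≤ 2 * meshSize ℓ M := by
  rw [tri_eq_image] at hx hy
  obtain ⟨v, hv, rfl⟩ := hx
  obtain ⟨w, hw, rfl⟩ := hy
  have h1 := norm_le_one_of_mem_refTri hv
  have h2 := norm_le_one_of_mem_refTri hw
  have h3 : |orient K| = 1 := by unfold orient; split_ifs <;> simp
  simp only [add_sub_add_left_eq_sub, ← smul_sub, norm_smul, norm_mul, Real.norm_eq_abs, h3,
    one_mul, abs_of_pos hh]
  have h4 : ‖v - w‖ ≤ 2 := (norm_sub_le v w).trans (by linarith)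
  nlinarith

lemma node_add_node {M : ℕ} {s t s' t' : ℤ × ℤ} (h : s + t = s' + t') :
    node c ℓ θ M s + node c ℓ θ M t = node c ℓ θ M s' + node c ℓ θ M t' := by
  have h1 : (s.1 : ℝ) + t.1 = s'.1 + t'.1 := by exact_mod_cast congrArg Prod.fst h
  have h2 : (s.2 : ℝ) + t.2 = s'.2 + t'.2 := by exact_mod_cast congrArg Prod.snd h
  have key : ∀ u v : ℤ × ℤ, node c ℓ θ M u + node c ℓ θ M v = (2 : ℝ) • c +
      meshSize ℓ M • (((u.1 : ℝ) + v.1) • dir θ + ((u.2 : ℝ) + v.2) • dir (θ + Real.pi / 3)) :=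
    fun u v => by simp only [node]; module
  rw [key, key, h1, h2]

lemma isCompact_tri (M : ℕ) (K : (ℤ × ℤ) × Bool) : IsCompact (tri c ℓ θ M K) :=
  Set.Finite.isCompact_convexHull ℝ ((Finset.finite_toSet _).image _)

lemma integrableOn_comp_refTri (hℓ : 0 < ℓ) {a : Plane → ℝ}
    (ha : ContinuousOn a (closedHexagon c ℓ θ)) {M : ℕ} (hM : 1 ≤ M) {K : (ℤ × ℤ) × Bool}
    (hK : K ∈ meshTriangles M) :
    IntegrableOn (fun v => a (node c ℓ θ M (apex K) + (orient K * meshSize ℓ M) • v))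
      (refTri θ) := by
  refine ContinuousOn.integrableOn_compact (isCompact_refTri θ) ?_
  refine ha.comp (Continuous.continuousOn (by fun_prop)) fun v hv => ?_
  refine tri_subset_closedHexagon hM (meshSize_pos hℓ hM) hK ?_
  rw [tri_eq_image]
  exact ⟨v, hv, rfl⟩

/-- Averaging over two triangles exchanged by a point reflection cancels the first order term of the
error. -/
lemma abs_setAverage_pair_sub_le (hℓ : 0 < ℓ) {a : Plane → ℝ}
    (ha : ContinuousOn a (closedHexagon c ℓ θ)) {C : ℝ} (hC : 0 ≤ C)
    (hC2 : ∀ m ∈ closedHexagon c ℓ θ, ∀ w, m + w ∈ closedHexagon c ℓ θ →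
      m - w ∈ closedHexagon c ℓ θ → |a (m + w) + a (m - w) - 2 * a m| ≤ C * ‖w‖ ^ 2)
    {M : ℕ} (hM : 1 ≤ M) {σ τ s t : ℤ × ℤ} (h : OppositePair M σ τ s t) :
    |(⨍ x in tri c ℓ θ M (σ, false), a x) + (⨍ x in tri c ℓ θ M (τ, true), a x) -
      (a (node c ℓ θ M s) + a (node c ℓ θ M t))| ≤ 8 * C * meshSize ℓ M ^ 2 := by
  have hh := meshSize_pos hℓ hM
  rw [setAverage_tri hh, setAverage_tri hh]
  refine abs_setAverage_add_sub_le (measureReal_refTri_pos θ)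
    (integrableOn_comp_refTri hℓ ha hM h.mem_left) (integrableOn_comp_refTri hℓ ha hM h.mem_right)
    fun v hv => ?_
  set x := node c ℓ θ M (apex (σ, false)) + (orient (σ, false) * meshSize ℓ M) • v with hx
  set y := node c ℓ θ M (apex (τ, true)) + (orient (τ, true) * meshSize ℓ M) • v with hy
  have hxT : x ∈ tri c ℓ θ M (σ, false) := by rw [tri_eq_image]; exact ⟨v, hv, rfl⟩
  have hyT : y ∈ tri c ℓ θ M (τ, true) := by rw [tri_eq_image]; exact ⟨v, hv, rfl⟩
  have hsum : x + y = node c ℓ θ M s + node c ℓ θ M t := by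
    -- The orientations are opposite, so that the contributions of `v` cancel.
    rw [← node_add_node h.center, hx, hy]
    simp only [apex, orient, Bool.false_eq_true, if_false, if_true]
    module
  have hsT := node_mem_tri (c := c) (ℓ := ℓ) (θ := θ) (M := M) h.left_s
  have htT := node_mem_tri (c := c) (ℓ := ℓ) (θ := θ) (M := M) h.left_t
  have hT := tri_subset_closedHexagon (c := c) (θ := θ) hM hh h.mem_left
  have hT' := tri_subset_closedHexagon (c := c) (θ := θ) hM hh h.mem_right
  generalize node c ℓ θ M s = ns at *
  generalize node c ℓ θ M t = nt at *
  set m : Plane := (1 / 2 : ℝ) • ns + (1 / 2 : ℝ) • nt with hm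
  have hmT : m ∈ tri c ℓ θ M (σ, false) :=
    convex_tri M _ hsT htT (by norm_num) (by norm_num) (by norm_num)
  have hmx : m + (x - m) = x := by abel
  have hmy : m - (x - m) = y := by
    have : y = ns + nt - x := by rw [← hsum]; abel
    rw [this, hm]; module
  have hms : m + (ns - m) = ns := by abel
  have hmt : m - (ns - m) = nt := by rw [hm]; module
  have e1 := hC2 m (hT hmT) (x - m) (by rw [hmx]; exact hT hxT) (by rw [hmy]; exact hT' hyT)
  have e2 := hC2 m (hT hmT) (ns - m) (by rw [hms]; exact hT hsT) (by rw [hmt]; exact hT htT)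
  rw [hmx, hmy] at e1
  rw [hms, hmt] at e2
  have b1 : C * ‖x - m‖ ^ 2 ≤ C * (2 * meshSize ℓ M) ^ 2 := by
    gcongr; exact norm_sub_le_of_mem_tri hh hxT hmT
  have b2 : C * ‖ns - m‖ ^ 2 ≤ C * (2 * meshSize ℓ M) ^ 2 := by
    gcongr; exact norm_sub_le_of_mem_tri hh hsT hmT
  rw [abs_le] at e1 e2 ⊢
  constructor <;> nlinarith [e1.1, e1.2, e2.1, e2.2]

lemma coordX_combo {h : ℝ} {x y : Plane} {s t : ℝ} (hst : s + t = 1) :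
    coordX c h θ (s • x + t • y) = s * coordX c h θ x + t * coordX c h θ y := by
  have : s • x + t • y - c = s • (x - c) + t • (y - c) := by
    conv_lhs => rw [← one_smul ℝ c, ← hst]
    module
  rw [coordX, this, inner_add_right, inner_smul_right, inner_smul_right, coordX, coordX]
  ring

lemma coordY_combo {h : ℝ} {x y : Plane} {s t : ℝ} (hst : s + t = 1) :
    coordY c h θ (s • x + t • y) = s * coordY c h θ x + t * coordY c h θ y := by
  have : s • x + t • y - c = s • (x - c) + t • (y - c) := by
    conv_lhs => rw [← one_smul ℝ c, ← hst]
    module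
  rw [coordY, this, inner_add_right, inner_smul_right, inner_smul_right, coordY, coordY]
  ring

lemma convex_closedHexagon (hℓ : 0 < ℓ) : Convex ℝ (closedHexagon c ℓ θ) := by
  have hh := meshSize_pos hℓ le_rfl
  intro x hx y hy s t hs ht hst
  rw [mem_closedHexagon_iff le_rfl hh] at hx hy ⊢
  rw [coordX_combo hst, coordY_combo hst]
  have key : ∀ u v B : ℝ, |u| ≤ B → |v| ≤ B → |s * u + t * v| ≤ B := by
    intro u v B hu hv
    calc |s * u + t * v| ≤ |s * u| + |t * v| := abs_add_le _ _
      _ = s * |u| + t * |v| := by rw [abs_mul, abs_mul, abs_of_nonneg hs, abs_of_nonneg ht]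
      _ ≤ s * B + t * B := by gcongr
      _ = B := by rw [← add_mul, hst, one_mul]
  refine ⟨?_, key _ _ _ hx.2.1 hy.2.1, key _ _ _ hx.2.2 hy.2.2⟩
  have := key _ _ _ hx.1 hy.1
  convert this using 2
  ring

lemma continuous_hexNorm (θ : ℝ) : Continuous (hexNorm θ) := by
  unfold hexNorm; fun_prop

lemma isCompact_closedHexagon (hℓ : 0 < ℓ) : IsCompact (closedHexagon c ℓ θ) := by
  have hh := meshSize_pos hℓ le_rfl
  have hclosed : IsClosed (closedHexagon c ℓ θ) :=
    isClosed_le ((continuous_hexNorm θ).comp (continuous_id.sub continuous_const)) continuous_const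
  refine Metric.isCompact_of_isClosed_isBounded hclosed ?_
  refine (Metric.isBounded_closedBall (x := c) (r := 2 * ℓ)).subset fun p hp => ?_
  rw [mem_closedHexagon_iff le_rfl hh] at hp
  have h1 : meshSize ℓ 1 = ℓ := by simp [meshSize]
  rw [h1, coordX, coordY, abs_div, abs_div, abs_of_pos hℓ, div_le_iff₀ hℓ, div_le_iff₀ hℓ] at hp
  rw [mem_closedBall_iff_norm, eq_smul_dir_add θ (p - c)]
  refine (norm_add_le _ _).trans ?_
  rw [norm_smul, norm_smul, norm_dir, norm_dir, Real.norm_eq_abs, Real.norm_eq_abs]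
  push_cast at hp
  linarith [hp.2.1, hp.2.2]

lemma uniqueDiffOn_closedHexagon (hℓ : 0 < ℓ) : UniqueDiffOn ℝ (closedHexagon c ℓ θ) := by
  refine uniqueDiffOn_convex (convex_closedHexagon hℓ) ⟨c, ?_⟩
  have hopen : IsOpen (hexagon c ℓ θ) :=
    isOpen_lt ((continuous_hexNorm θ).comp (continuous_id.sub continuous_const)) continuous_const
  refine interior_maximal (s := closedHexagon c ℓ θ)
    (fun p (hp : hexNorm θ (p - c) < ℓ) => hp.le) hopen ?_
  change hexNorm θ (c - c) < ℓ
  simpa [hexNorm] using hℓ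

/-- The weights of a quadrature of order two are approximated by the nodal values of the
coefficient. -/
lemma exists_approxNodal (hℓ : 0 < ℓ) {a : Plane → ℝ}
    (ha : ContDiffOn ℝ 2 a (closedHexagon c ℓ θ)) {q : ℕ → (ℤ × ℤ) × Bool → ℝ}
    (hq : IsQuadratureOrderTwo c ℓ θ a q) :
    ∃ C : ℝ, 0 ≤ C ∧ ∀ M : ℕ, 1 ≤ M →
      ApproxNodal M (q M) (fun s => a (node c ℓ θ M s)) C ((M : ℝ)⁻¹) := by
  obtain ⟨C, hC, h1, h2⟩ := exists_second_difference_le (convex_closedHexagon hℓ)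
    (isCompact_closedHexagon hℓ) (uniqueDiffOn_closedHexagon hℓ) ha
  obtain ⟨B, hB⟩ := hq
  refine ⟨(8 * C + 2 * |B|) * ℓ ^ 2 + 2 * C * ℓ, by positivity, fun M hM => ?_⟩
  have hh := meshSize_pos hℓ hM
  have hme : meshSize ℓ M = ℓ * (M : ℝ)⁻¹ := div_eq_mul_inv _ _
  constructor
  · intro σ τ s t h
    have e1 := abs_setAverage_pair_sub_le hℓ ha.continuousOn hC h2 hM h
    have hB' : B * meshSize ℓ M ^ 2 ≤ |B| * meshSize ℓ M ^ 2 := by gcongr; exact le_abs_self B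
    have e2 := (hB M hM _ h.mem_left).trans hB'
    have e3 := (hB M hM _ h.mem_right).trans hB'
    have e4 : 0 ≤ 2 * C * ℓ * ((M : ℝ)⁻¹) ^ 2 := by positivity
    rw [hme] at e1 e2 e3
    rw [abs_le] at e1 e2 e3 ⊢
    constructor <;> nlinarith [e1.1, e1.2, e2.1, e2.2, e3.1, e3.2]
  · intro K hK s hs t ht
    have hT := tri_subset_closedHexagon (c := c) (θ := θ) hM hh hK
    refine (h1 _ (hT (node_mem_tri ht)) _ (hT (node_mem_tri hs))).trans ?_
    have e1 := norm_sub_le_of_mem_tri (c := c) (θ := θ) hh (node_mem_tri hs) (node_mem_tri ht)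
    calc C * ‖node c ℓ θ M s - node c ℓ θ M t‖ ≤ C * (2 * meshSize ℓ M) := by gcongr
      _ = 2 * C * ℓ * (M : ℝ)⁻¹ := by rw [hme]; ring
      _ ≤ _ := by
        have : 0 ≤ (8 * C + 2 * |B|) * ℓ ^ 2 * (M : ℝ)⁻¹ := by positivity
        linarith

lemma le_setAverage_tri (hℓ : 0 < ℓ) {a : Plane → ℝ}
    (ha : ContinuousOn a (closedHexagon c ℓ θ)) {a₀ : ℝ}
    (hpos : ∀ x ∈ closedHexagon c ℓ θ, a₀ ≤ a x) {M : ℕ} (hM : 1 ≤ M) {K : (ℤ × ℤ) × Bool}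
    (hK : K ∈ meshTriangles M) : a₀ ≤ ⨍ x in tri c ℓ θ M K, a x := by
  have hh := meshSize_pos hℓ hM
  refine le_setAverage ?_ (isCompact_tri M K).measurableSet (integrableOn_tri hℓ ha hM hK)
    fun x hx => hpos x (tri_subset_closedHexagon hM hh hK hx)
  rw [measureReal_tri hh]
  exact mul_pos (by positivity) (measureReal_refTri_pos θ)

/-- For a fine mesh, the weights of a quadrature of order two inherit the positive lower bound of the
coefficient. -/
lemma exists_half_le_weights (hℓ : 0 < ℓ) {a : Plane → ℝ}
    (ha : ContinuousOn a (closedHexagon c ℓ θ)) {a₀ : ℝ} (ha₀ : 0 < a₀)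
    (hpos : ∀ x ∈ closedHexagon c ℓ θ, a₀ ≤ a x) {q : ℕ → (ℤ × ℤ) × Bool → ℝ}
    (hq : IsQuadratureOrderTwo c ℓ θ a q) :
    ∃ M₀ : ℕ, ∀ M, 1 ≤ M → M₀ ≤ M → ∀ K ∈ meshTriangles M, a₀ / 2 ≤ q M K := by
  obtain ⟨B, hB⟩ := hq
  obtain ⟨M₀, hM₀⟩ := exists_nat_ge (|B| * ℓ ^ 2 / (a₀ / 2))
  refine ⟨M₀, fun M hM hMM K hK => ?_⟩
  have hM' : (1 : ℝ) ≤ M := by exact_mod_cast hM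
  have h1 : |B| * ℓ ^ 2 ≤ a₀ / 2 * M := by
    rw [div_le_iff₀ (by positivity)] at hM₀
    refine hM₀.trans ?_
    rw [mul_comm]
    gcongr
  have h2 : B * meshSize ℓ M ^ 2 ≤ a₀ / 2 := by
    have e : meshSize ℓ M ^ 2 = ℓ ^ 2 / (M : ℝ) ^ 2 := by rw [meshSize, div_pow]
    calc B * meshSize ℓ M ^ 2 ≤ |B| * meshSize ℓ M ^ 2 := by gcongr; exact le_abs_self B
      _ = |B| * ℓ ^ 2 / (M : ℝ) ^ 2 := by rw [e, mul_div_assoc]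
      _ ≤ a₀ / 2 * M / (M : ℝ) ^ 2 := by gcongr
      _ ≤ a₀ / 2 := by
        rw [div_le_iff₀ (by positivity)]
        have : (M : ℝ) ≤ (M : ℝ) ^ 2 := by nlinarith
        gcongr
  have h3 := (abs_le.mp (hB M hM K hK)).1
  have h4 := le_setAverage_tri hℓ ha hpos hM hK
  linarith

lemma stiffness_one_eq (c : Plane) (hℓ : 0 < ℓ) (θ : ℝ) {M : ℕ} (hM : 1 ≤ M) :
    stiffness c ℓ θ (fun _ => 1) M = stiffFactor θ • meshMatrix M fun _ => 1 := by
  have hh := meshSize_pos hℓ hM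
  rw [stiffness_eq c hℓ θ continuousOn_const hM]
  congr 2
  ext K
  have h0 : volume.real (tri c ℓ θ M K) ≠ 0 := by
    rw [measureReal_tri hh]
    exact (mul_pos (by positivity) (measureReal_refTri_pos θ)).ne'
  rw [setAverage_eq, setIntegral_const, smul_eq_mul, smul_eq_mul, mul_one, inv_mul_cancel₀ h0]

/-- The conclusions for weights of order two. The positive definiteness of `A M` is a hypothesis, as
the weights need not be positive on coarse meshes. -/
theorem clustered_and_optimal_of_quadrature (hℓ : 0 < ℓ) {a : Plane → ℝ}
    (ha : ContDiffOn ℝ 2 a (closedHexagon c ℓ θ)) {a₀ : ℝ} (ha₀ : 0 < a₀)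
    (hpos : ∀ x ∈ closedHexagon c ℓ θ, a₀ ≤ a x) {q : ℕ → (ℤ × ℤ) × Bool → ℝ}
    (hq : IsQuadratureOrderTwo c ℓ θ a q) {A : ∀ M, Matrix (innerNodes M) (innerNodes M) ℝ}
    (hA : ∀ M, 1 ≤ M → A M = stiffFactor θ • meshMatrix M (q M))
    (hAp : ∀ M, 1 ≤ M → (A M).PosDef) :
    (∀ M, 1 ≤ M → (precond (A M) (stiffness c ℓ θ (fun _ => 1) M)).PosDef) ∧
    ProperlyClusteredAt
      (fun M => (precond (A M) (stiffness c ℓ θ (fun _ => 1) M))⁻¹ * A M) 1 ∧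
    EigsInPositiveInterval
      (fun M => (precond (A M) (stiffness c ℓ θ (fun _ => 1) M))⁻¹ * A M) ∧
    PCGOptimal A (fun M => precond (A M) (stiffness c ℓ θ (fun _ => 1) M)) := by
  obtain ⟨C, hC, hap⟩ := exists_approxNodal hℓ ha hq
  obtain ⟨M₀, hM₀⟩ := exists_half_le_weights hℓ ha.continuousOn ha₀ hpos hq
  exact clustered_and_optimal_of_approxNodal (γ := fun _ => stiffFactor θ)
    (fun _ _ => stiffFactor_pos θ) hA (fun M hM => stiffness_one_eq c hℓ θ hM) hAp hC
    (half_pos ha₀) hM₀ hap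

end Hexagon

theorem mainTheorem1 (c : Plane) (ℓ θ : ℝ) (hℓ : 0 < ℓ) (a : Plane → ℝ)
    (ha : ContDiffOn ℝ 2 a (closedHexagon c ℓ θ))
    (a₀ : ℝ) (ha₀ : 0 < a₀) (hpos : ∀ x ∈ closedHexagon c ℓ θ, a₀ ≤ a x) :
    -- exact integration
    (let A₁ := stiffness c ℓ θ (fun _ => 1)
     let A := stiffness c ℓ θ a
     let P := fun M => precond (A M) (A₁ M)
     (∀ M, 1 ≤ M → (A M).PosDef ∧ (P M).PosDef) ∧
     ProperlyClusteredAt (fun M => (P M)⁻¹ * A M) 1 ∧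
     EigsInPositiveInterval (fun M => (P M)⁻¹ * A M) ∧
     PCGOptimal A P) ∧
    -- quadrature with error `O(h²)` and positive definite matrices
    (∀ q : ℕ → (ℤ × ℤ) × Bool → ℝ, IsQuadratureOrderTwo c ℓ θ a q →
      (∀ M, 1 ≤ M → (quadStiffness c ℓ θ M (q M)).PosDef) →
      let A₁ := stiffness c ℓ θ (fun _ => 1)
      let A := fun M => quadStiffness c ℓ θ M (q M)
      let P := fun M => precond (A M) (A₁ M)
      (∀ M, 1 ≤ M → (P M).PosDef) ∧
      ProperlyClusteredAt (fun M => (P M)⁻¹ * A M) 1 ∧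
      EigsInPositiveInterval (fun M => (P M)⁻¹ * A M) ∧
      PCGOptimal A P) := by
  refine ⟨?_, fun q hq hAp => clustered_and_optimal_of_quadrature hℓ ha ha₀ hpos hq
    (fun M hM => quadStiffness_eq c hℓ θ hM (q M)) hAp⟩
  intro A₁ A P
  have hA : ∀ M, 1 ≤ M → A M =
      stiffFactor θ • meshMatrix M fun K => ⨍ x in tri c ℓ θ M K, a x := fun M hM =>
    stiffness_eq c hℓ θ ha.continuousOn hM
  have hAp : ∀ M, 1 ≤ M → (A M).PosDef := fun M hM => by
    rw [hA M hM]
    exact (posDef_meshMatrix hM ha₀ fun K hK =>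
      le_setAverage_tri hℓ ha.continuousOn hpos hM hK).smul (stiffFactor_pos θ)
  have hq : IsQuadratureOrderTwo c ℓ θ a fun M K => ⨍ x in tri c ℓ θ M K, a x :=
    ⟨0, fun M _ K _ => by simp⟩
  obtain ⟨h1, h2⟩ := clustered_and_optimal_of_quadrature hℓ ha ha₀ hpos hq hA hAp
  exact ⟨fun M hM => ⟨hAp M hM, h1 M hM⟩, h2⟩

end
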